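/- **Conventions.** Locally compact groups are Hausdorff. Let $G$ be a locally compact group and $H\subseteq G$ a closed subgroup. The pair $(G,H)$ has *Property $(T)$* if every (strongly continuous) unitary representation $(u,\mathfrak H)$ of $G$ for which there is a net $(\xi_i)$ of unit vectors with $\sup_{s\in Q}\|u(s)\xi_i-\xi_i\|\to 0$ for every compact $Q\subseteq G$ has a non-zero $H$-invariant vector; $G$ has Property $(T)$ if $(G,G)$ does. $G$ is an *IN-group* if the identity $e$ has a compact neighbourhood that is invariant under conjugation. $C^*_r(G)$ is the norm closure of $\{\lambda_G(f): f\in C_c(G)\}$ in $\mathcal B(L^2(G))$, where $\lambda_G$ is the left regular representation and $\lambda_G(f)=\int_G f(s)\lambda_G(s)\,ds$ (left Haar measure). $C^*_r(H)$ is identified with its canonical image in the multiplier algebra $M(C^*_r(G))\subseteq\mathcal B(L^2(G))$, the norm closure of the operators $\int_H f(h)\lambda_G(h)\,dh$, $f\in C_c(H)$. Let $A$ be a $C^*$-algebra. A *non-degenerate Hilbert $^*$-bimodule* over $A$ is a Hilbert space $\mathfrak H$ with a non-degenerate $^*$-representation $\xi\mapsto a\cdot\xi$ and a non-degenerate $^*$-anti-representation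 $\xi\mapsto\xi\cdot a$ of $A$ that commute with each other; both extend uniquely to $M(A)$. A net $(\xi_i)$ in $\mathfrak H$ is *almost-$\mathfrak K_A$-central* if $\sup_{x\in L}\|x\cdot\xi_i-\xi_i\cdot x\|\to 0$ for every $L\subseteq M(A)$ that is compact in the strict topology, i.e. the weakest topology for which $x\mapsto xa$ and $x\mapsto ax$ are continuous from $M(A)$ to $A$ (with its norm topology) for all $a\in A$. For a non-degenerate $C^*$-subalgebra $B\subseteq M(A)$ (one with an approximate identity that converges strictly to $1$), the pair $(A,B)$ has *strong Property $(T)$* if, for every non-degenerate Hilbert $^*$-bimodule $\mathfrak H$ over $A$ and every almost-$\mathfrak K_A$-central net $(\xi_i)$ of unit vectors in $\mathfrak H$, one has $\|\xi_i-P^B\xi_i\|\to 0$, where $P^B$ is the orthogonal projection onto $\mathfrak H^B=\{\xi: b\cdot\xi=\xi\cdot b\text{ for all }b\in B\}$; $A$ has strong Property $(T)$ if $(A,A)$ does. **Theorem.** Let $G$ be a locally compact IN-group and $H$ a closed subgroup of $G$. (a) If $(C^*_r(G),C^*_r(H))$ has strong Property $(T)$, then $(G,H)$ has Property $(T)$.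 (b) If $G$ is $\sigma$-compact, then $(G,H)$ has Property $(T)$ if and only if $(C^*_r(G),C^*_r(H))$ has strong Property $(T)$. (c) $G$ has Property $(T)$ if and only if $C^*_r(G)$ has strong Property $(T)$. -/

import Mathlib

open MeasureTheory Filter Topology
open scoped MultiplierAlgebra ENNReal CompactlySupported

universe u

noncomputable section

namespace PropertyT

/-! ### Unitary representations and Property (T) for pairs of groups -/

/-- A (strongly continuous) unitary representation of a topological group `G` on a complex
Hilbert space `E`. -/
structure UnitaryRep (G : Type*) [Group G] [TopologicalSpace G]
    (E : Type*) [NormedAddCommGroup E] [InnerProductSpace ℂ E] where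
  /-- the homomorphism into the unitary group of `E` -/
  toHom : G →* (E ≃ₗᵢ[ℂ] E)
  continuous_apply : ∀ ξ : E, Continuous fun g => toHom g ξ

namespace UnitaryRep

variable {G : Type*} [Group G] [TopologicalSpace G]
  {E : Type*} [NormedAddCommGroup E] [InnerProductSpace ℂ E]

/-- The restriction of a unitary representation to a subgroup. -/
def restrict (v : UnitaryRep G E) (H : Subgroup G) : UnitaryRep H E where
  toHom := v.toHom.comp H.subtype
  continuous_apply ξ := (v.continuous_apply ξ).comp continuous_subtype_val

/-- The net `ξ` is almost invariant: `sup_{s ∈ Q} ‖v(s) ξ_i - ξ_i‖ → 0` for every compact `Q`. -/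
def IsAlmostInvariant (v : UnitaryRep G E) {ι : Type*} [Preorder ι] (ξ : ι → E) : Prop :=
  ∀ Q : Set G, IsCompact Q → ∀ ε : ℝ, 0 < ε →
    ∀ᶠ i in atTop, ∀ s ∈ Q, ‖v.toHom s (ξ i) - ξ i‖ ≤ ε

end UnitaryRep

/-- Property (T) for the pair `(G, H)`: every unitary representation of `G` that has an
almost invariant net of unit vectors has a nonzero `H`-invariant vector. -/
def GroupPairPropertyT (G : Type u) [Group G] [TopologicalSpace G] (H : Subgroup G) : Prop :=
  ∀ (E : Type u) [NormedAddCommGroup E] [InnerProductSpace ℂ E] [CompleteSpace E]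
    (v : UnitaryRep G E)
    (ι : Type u) [Preorder ι] [IsDirectedOrder ι] [Nonempty ι] (ξ : ι → E),
    (∀ i, ‖ξ i‖ = 1) → v.IsAlmostInvariant ξ →
    ∃ η : E, η ≠ 0 ∧ ∀ h ∈ H, v.toHom h η = η

/-- Property (T) for a group `G`, i.e. for the pair `(G, G)`. -/
def GroupPropertyT (G : Type u) [Group G] [TopologicalSpace G] : Prop :=
  GroupPairPropertyT G ⊤

/-- `G` is an IN-group: the identity has a compact neighbourhood invariant under conjugation. -/
def IsINGroup (G : Type*) [Group G] [TopologicalSpace G] : Prop :=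
  ∃ V : Set G, IsCompact V ∧ V ∈ 𝓝 (1 : G) ∧ ∀ g : G, ∀ x ∈ V, g * x * g⁻¹ ∈ V

/-! ### Hilbert bimodules over a C⋆-algebra, and their extension to the multiplier algebra -/

/-- If `φ : A → B(E)` is bounded and nondegenerate, `m` is a bounded linear map of `A`, and
`φ (m e) φ a → φ (m a)` along a bounded net `e`, then there is exactly one operator `T` with
`T φ a = φ (m a)` for all `a`. -/
theorem existsUnique_extension {A E : Type*} [NormedAddCommGroup A]
    [NormedAddCommGroup E] [InnerProductSpace ℂ E] [CompleteSpace E]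
    (φ : A → E →L[ℂ] E)
    (hφ : Dense (Submodule.span ℂ {η : E | ∃ a ξ, φ a ξ = η} : Set E))
    (m : A → A) (l : Filter A) [l.NeBot] (c : ℝ) (hc : ∀ᶠ e in l, ‖φ (m e)‖ ≤ c)
    (hlim : ∀ a ξ, Tendsto (fun e => φ (m e) (φ a ξ)) l (𝓝 (φ (m a) ξ))) :
    ∃! T : E →L[ℂ] E, ∀ a ξ, T (φ a ξ) = φ (m a) ξ := by
  have hc0 : 0 ≤ c := by
    obtain ⟨e, he⟩ := hc.exists
    exact (norm_nonneg _).trans he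
  -- convergence on the dense span
  have h1 : ∀ η ∈ Submodule.span ℂ {η : E | ∃ a ξ, φ a ξ = η},
      ∃ y, Tendsto (fun e => φ (m e) η) l (𝓝 y) := by
    intro η hη
    induction hη using Submodule.span_induction with
    | mem x hx =>
      obtain ⟨a, ξ, rfl⟩ := hx
      exact ⟨_, hlim a ξ⟩
    | zero => exact ⟨0, by simp⟩
    | add x y _ _ hx hy =>
      obtain ⟨p, hp⟩ := hx
      obtain ⟨q, hq⟩ := hy
      exact ⟨p + q, by simpa using hp.add hq⟩
    | smul k x _ hx =>
      obtain ⟨p, hp⟩ := hx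
      exact ⟨k • p, by simpa using hp.const_smul k⟩
  -- convergence everywhere
  have h2 : ∀ η : E, ∃ y, Tendsto (fun e => φ (m e) η) l (𝓝 y) := by
    intro η
    apply cauchy_map_iff_exists_tendsto.1
    rw [Metric.cauchy_iff]
    refine ⟨inferInstance, fun ε hε => ?_⟩
    obtain ⟨η', hη', hd⟩ := Metric.dense_iff.1 hφ η (ε / (4 * (c + 1))) (by positivity)
    obtain ⟨y, hy⟩ := h1 η' hd
    refine ⟨Metric.ball y (ε / 2), ?_, ?_⟩
    · have hy' : ∀ᶠ e in l, φ (m e) η' ∈ Metric.ball y (ε / 4) :=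
        hy.eventually (Metric.ball_mem_nhds y (by positivity))
      rw [mem_map]
      filter_upwards [hc, hy'] with e he1 he2
      have h3 : ‖φ (m e) (η - η')‖ ≤ ε / 4 := by
        refine ((φ (m e)).le_opNorm _).trans ?_
        have h4 : ‖η - η'‖ ≤ ε / (4 * (c + 1)) := by
          rw [← dist_eq_norm, dist_comm]
          exact (Metric.mem_ball.1 hη').le
        calc ‖φ (m e)‖ * ‖η - η'‖ ≤ (c + 1) * (ε / (4 * (c + 1))) := by
              gcongr
              linarith
          _ = ε / 4 := by field_simp
      have h5 : ‖φ (m e) η' - y‖ < ε / 4 := by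
        rw [← dist_eq_norm]
        exact he2
      rw [Set.mem_preimage, Metric.mem_ball, dist_eq_norm]
      calc ‖φ (m e) η - y‖ = ‖φ (m e) (η - η') + (φ (m e) η' - y)‖ := by
            rw [map_sub]; congr 1; abel
        _ ≤ _ := norm_add_le _ _
        _ < ε / 2 := by linarith
    · intro a ha b hb
      have := dist_triangle_right a b y
      rw [Metric.mem_ball] at ha hb
      linarith
  choose T hT using h2
  let L : E →ₗ[ℂ] E :=
    { toFun := T
      map_add' := fun x y => tendsto_nhds_unique (hT _) (by simpa using (hT x).add (hT y))
      map_smul' := fun k x => tendsto_nhds_unique (hT _) (by simpa using (hT x).const_smul k) }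
  have hL : ∀ x, ‖L x‖ ≤ c * ‖x‖ := by
    intro x
    refine le_of_tendsto (hT x).norm ?_
    filter_upwards [hc] with e he
    exact ((φ (m e)).le_opNorm x).trans (by gcongr)
  refine ⟨L.mkContinuous c hL, fun a ξ => tendsto_nhds_unique (hT _) (hlim a ξ), ?_⟩
  intro S hS
  apply ContinuousLinearMap.ext_on hφ
  rintro _ ⟨a, ξ, rfl⟩
  rw [hS]
  exact (tendsto_nhds_unique (hT _) (hlim a ξ)).symm

/-- A nondegenerate Hilbert `⋆`-bimodule over a C⋆-algebra `A`: a Hilbert space `E` with a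
`⋆`-representation and a `⋆`-anti-representation of `A`, both nondegenerate, which commute. -/
structure HilbertBimodule (A : Type*) [NonUnitalCStarAlgebra A]
    (E : Type*) [NormedAddCommGroup E] [InnerProductSpace ℂ E] [CompleteSpace E] where
  /-- the left action `a ↦ (ξ ↦ a · ξ)`, a `⋆`-representation -/
  left : A →⋆ₙₐ[ℂ] (E →L[ℂ] E)
  /-- the right action `a ↦ (ξ ↦ ξ · a)`, a `⋆`-anti-representation -/
  right : A →⋆ₙₐ[ℂ] (E →L[ℂ] E)ᵐᵒᵖ
  commute : ∀ a b ξ, left a ((right b).unop ξ) = (right b).unop (left a ξ)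
  left_nondegenerate : Dense (Submodule.span ℂ {η : E | ∃ a ξ, left a ξ = η} : Set E)
  right_nondegenerate :
    Dense (Submodule.span ℂ {η : E | ∃ a ξ, (right a).unop ξ = η} : Set E)

namespace HilbertBimodule

variable {A : Type*} [NonUnitalCStarAlgebra A]
  {E : Type*} [NormedAddCommGroup E] [InnerProductSpace ℂ E] [CompleteSpace E]

theorem existsUnique_leftMul (X : HilbertBimodule A E) (x : 𝓜(ℂ, A)) :
    ∃! T : E →L[ℂ] E, ∀ (a : A) (ξ : E), T (X.left a ξ) = X.left (x.fst a) ξ := by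
  let _ : PartialOrder A := CStarAlgebra.spectralOrder A
  have _ : StarOrderedRing A := CStarAlgebra.spectralOrderedRing A
  have hl := CStarAlgebra.increasingApproximateUnit A
  refine existsUnique_extension (fun a => X.left a) X.left_nondegenerate (fun a => x.fst a)
    (CStarAlgebra.approximateUnit A) ‖x.fst‖ ?_ ?_
  · filter_upwards [hl.eventually_norm] with e he
    refine (NonUnitalStarAlgHom.norm_apply_le X.left _).trans ?_
    exact (x.fst.le_opNorm e).trans (by nlinarith [norm_nonneg x.fst])
  · intro a ξ
    have hmul : ∀ e : A, X.left (x.fst e) (X.left a ξ) = X.left (x.fst (e * a)) ξ := by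
      intro e
      have h1 : x.fst (e * a) = x.fst e * a := by
        -- `x (e a) = (x e) a`, since both agree after multiplication on the left
        rw [← sub_eq_zero]
        set d := x.fst (e * a) - x.fst e * a with hd
        have h0 : ∀ y : A, y * d = 0 := by
          intro y
          rw [hd, mul_sub, ← x.central, ← mul_assoc, ← mul_assoc, ← x.central, sub_self]
        exact (CStarRing.star_mul_self_eq_zero_iff d).1 (h0 _)
      rw [h1, map_mul]
      rfl
    simp only [hmul]
    have hcont : Continuous fun y : A => X.left y ξ := by
      have : Continuous X.left :=
        AddMonoidHomClass.continuous_of_bound X.left 1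
          (fun y => by simpa using NonUnitalStarAlgHom.norm_apply_le X.left y)
      exact this.clm_apply continuous_const
    exact (hcont.tendsto _).comp ((x.fst.continuous.tendsto _).comp (hl.tendsto_mul_right a))

theorem existsUnique_rightMul (X : HilbertBimodule A E) (x : 𝓜(ℂ, A)) :
    ∃! T : E →L[ℂ] E,
      ∀ (a : A) (ξ : E), T ((X.right a).unop ξ) = (X.right (x.snd a)).unop ξ := by
  let _ : PartialOrder A := CStarAlgebra.spectralOrder A
  have _ : StarOrderedRing A := CStarAlgebra.spectralOrderedRing A
  have hl := CStarAlgebra.increasingApproximateUnit A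
  refine existsUnique_extension (fun a => (X.right a).unop) X.right_nondegenerate
    (fun a => x.snd a) (CStarAlgebra.approximateUnit A) ‖x.snd‖ ?_ ?_
  · filter_upwards [hl.eventually_norm] with e he
    refine (NonUnitalStarAlgHom.norm_apply_le X.right _).trans ?_
    exact (x.snd.le_opNorm e).trans (by nlinarith [norm_nonneg x.snd])
  · intro a ξ
    have hmul : ∀ e : A, (X.right (x.snd e)).unop ((X.right a).unop ξ)
        = (X.right (x.snd (a * e))).unop ξ := by
      intro e
      have h1 : x.snd (a * e) = a * x.snd e := by
        rw [← sub_eq_zero]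
        set d := x.snd (a * e) - a * x.snd e with hd
        have h0 : ∀ y : A, d * y = 0 := by
          intro y
          rw [hd, sub_mul, x.central, mul_assoc, mul_assoc, x.central, sub_self]
        exact (CStarRing.mul_star_self_eq_zero_iff d).1 (h0 _)
      rw [h1, map_mul]
      rfl
    simp only [hmul]
    have hcont : Continuous fun y : A => (X.right y).unop ξ := by
      have : Continuous X.right :=
        AddMonoidHomClass.continuous_of_bound X.right 1
          (fun y => by simpa using NonUnitalStarAlgHom.norm_apply_le X.right y)
      exact (MulOpposite.continuous_unop.comp this).clm_apply continuous_const
    exact (hcont.tendsto _).comp ((x.snd.continuous.tendsto _).comp (hl.tendsto_mul_left a))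

/-- The operator `ξ ↦ x · ξ` for a multiplier `x`: the unique one with
`x · (a · ξ) = (x a) · ξ` for `a ∈ A`. -/
def leftMul (X : HilbertBimodule A E) (x : 𝓜(ℂ, A)) : E →L[ℂ] E :=
  (X.existsUnique_leftMul x).choose

/-- The operator `ξ ↦ ξ · x` for a multiplier `x`: the unique one with
`(ξ · a) · x = ξ · (a x)` for `a ∈ A`. -/
def rightMul (X : HilbertBimodule A E) (x : 𝓜(ℂ, A)) : E →L[ℂ] E :=
  (X.existsUnique_rightMul x).choose

theorem leftMul_apply (X : HilbertBimodule A E) (x : 𝓜(ℂ, A)) (a : A) (ξ : E) :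
    X.leftMul x (X.left a ξ) = X.left (x.fst a) ξ :=
  (X.existsUnique_leftMul x).choose_spec.1 a ξ

theorem rightMul_apply (X : HilbertBimodule A E) (x : 𝓜(ℂ, A)) (a : A) (ξ : E) :
    X.rightMul x ((X.right a).unop ξ) = (X.right (x.snd a)).unop ξ :=
  (X.existsUnique_rightMul x).choose_spec.1 a ξ

/-- The space `{ξ : b · ξ = ξ · b for all b ∈ B}` of `B`-central vectors. -/
def central (X : HilbertBimodule A E) (B : NonUnitalStarSubalgebra ℂ 𝓜(ℂ, A)) :
    Submodule ℂ E where
  carrier := {ξ | ∀ b ∈ B, X.leftMul b ξ = X.rightMul b ξ}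
  add_mem' hx hy b hb := by rw [map_add, map_add, hx b hb, hy b hb]
  zero_mem' b _ := by simp
  smul_mem' c x hx b hb := by rw [map_smul, map_smul, hx b hb]

theorem isClosed_central (X : HilbertBimodule A E) (B : NonUnitalStarSubalgebra ℂ 𝓜(ℂ, A)) :
    IsClosed (X.central B : Set E) := by
  have : (X.central B : Set E) = ⋂ b ∈ B, {ξ | X.leftMul b ξ = X.rightMul b ξ} := by
    ext ξ
    simp [central]
  rw [this]
  exact isClosed_biInter fun b _ =>
    isClosed_eq (X.leftMul b).continuous (X.rightMul b).continuous

instance (X : HilbertBimodule A E) (B : NonUnitalStarSubalgebra ℂ 𝓜(ℂ, A)) :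
    (X.central B).HasOrthogonalProjection :=
  haveI : CompleteSpace (X.central B) := (X.isClosed_central B).completeSpace_coe
  inferInstance

end HilbertBimodule

/-! ### Strong Property (T) for C⋆-algebras -/

/-- The strict topology on `M(A)`: the weakest topology such that `x ↦ x a` and `x ↦ a x` are
continuous from `M(A)` to the normed space `A`, for every `a ∈ A`. -/
@[reducible]
def strictTopology (A : Type*) [NonUnitalCStarAlgebra A] : TopologicalSpace 𝓜(ℂ, A) :=
  (⨅ a : A, TopologicalSpace.induced (fun x : 𝓜(ℂ, A) => x.fst a) inferInstance) ⊓
    ⨅ a : A, TopologicalSpace.induced (fun x : 𝓜(ℂ, A) => x.snd a) inferInstance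

/-- The net `ξ` is almost-`𝔎_A`-central: `sup_{x ∈ L} ‖x · ξ_i - ξ_i · x‖ → 0` for every strictly
compact subset `L` of `M(A)`. -/
def HilbertBimodule.IsAlmostCentral {A : Type*} [NonUnitalCStarAlgebra A]
    {E : Type*} [NormedAddCommGroup E] [InnerProductSpace ℂ E] [CompleteSpace E]
    (X : HilbertBimodule A E) {ι : Type*} [Preorder ι] (ξ : ι → E) : Prop :=
  ∀ L : Set 𝓜(ℂ, A), @IsCompact _ (strictTopology A) L → ∀ ε : ℝ, 0 < ε →
    ∀ᶠ i in atTop, ∀ x ∈ L, ‖X.leftMul x (ξ i) - X.rightMul x (ξ i)‖ ≤ ε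

/-- Strong Property (T) for the pair `(A, B)`, where `B ⊆ M(A)`: for every almost-`𝔎_A`-central
net of unit vectors in a nondegenerate Hilbert `⋆`-bimodule over `A`, the distance of `ξ_i` to
its projection on the `B`-central vectors tends to `0`. -/
def StrongPropertyTPair (A : Type u) [NonUnitalCStarAlgebra A]
    (B : NonUnitalStarSubalgebra ℂ 𝓜(ℂ, A)) : Prop :=
  ∀ (E : Type u) [NormedAddCommGroup E] [InnerProductSpace ℂ E] [CompleteSpace E]
    (X : HilbertBimodule A E)
    (ι : Type u) [Preorder ι] [IsDirectedOrder ι] [Nonempty ι] (ξ : ι → E),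
    (∀ i, ‖ξ i‖ = 1) → X.IsAlmostCentral ξ →
    Tendsto (fun i => ‖ξ i - (X.central B).starProjection (ξ i)‖) atTop (𝓝 0)

/-- Strong Property (T) for `A`, i.e. for the pair `(A, A)`. -/
def StrongPropertyT (A : Type u) [NonUnitalCStarAlgebra A] : Prop :=
  StrongPropertyTPair A
    (NonUnitalStarAlgHom.range (DoubleCentralizer.coeHom : A →⋆ₙₐ[ℂ] 𝓜(ℂ, A)))

/-- For C⋆-subalgebras `A` and `C` of a C⋆-algebra `D`: the multipliers `m` of `A` that are given
by multiplication with some `T ∈ C`, that is `m a = T a` and `a m = a T` for all `a ∈ A`. -/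
def implementedMultipliers {D : Type*} [CStarAlgebra D] (A C : NonUnitalStarSubalgebra ℂ D)
    [IsClosed (A : Set D)] : NonUnitalStarSubalgebra ℂ 𝓜(ℂ, A) where
  carrier := {m | ∃ T ∈ C, ∀ a : A, (m.fst a : D) = T * a ∧ (m.snd a : D) = a * T}
  add_mem' := by
    rintro m n ⟨S, hS, hm⟩ ⟨T, hT, hn⟩
    refine ⟨S + T, add_mem hS hT, fun a => ⟨?_, ?_⟩⟩
    · simp [(hm a).1, (hn a).1, add_mul]
    · simp [(hm a).2, (hn a).2, mul_add]
  zero_mem' := ⟨0, zero_mem _, fun a => by simp⟩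
  smul_mem' := by
    rintro c m ⟨S, hS, hm⟩
    refine ⟨c • S, SMulMemClass.smul_mem c hS, fun a => ⟨?_, ?_⟩⟩
    · simp [(hm a).1]
    · simp [(hm a).2]
  mul_mem' := by
    rintro m n ⟨S, hS, hm⟩ ⟨T, hT, hn⟩
    refine ⟨S * T, mul_mem hS hT, fun a => ⟨?_, ?_⟩⟩
    · simp [(hm _).1, (hn a).1, mul_assoc]
    · simp [(hm a).2, (hn _).2, mul_assoc]
  star_mem' := by
    rintro m ⟨S, hS, hm⟩
    refine ⟨star S, star_mem hS, fun a => ⟨?_, ?_⟩⟩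
    · rw [DoubleCentralizer.star_fst]
      simp [(hm _).2]
    · rw [DoubleCentralizer.star_snd]
      simp [(hm _).1]

/-! ### Reduced group C⋆-algebras -/

section Integrated

variable {G : Type*} [Group G] [TopologicalSpace G] [IsTopologicalGroup G]
  [LocallyCompactSpace G] [MeasurableSpace G] [BorelSpace G]
  {E : Type*} [NormedAddCommGroup E] [InnerProductSpace ℂ E]

theorem UnitaryRep.integrable_smul (v : UnitaryRep G E) (f : C_c(G, ℂ)) (ξ : E) :
    Integrable (fun s => f s • v.toHom s ξ) (Measure.haar : Measure G) :=
  Continuous.integrable_of_hasCompactSupport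
    (f.continuous.smul (v.continuous_apply ξ)) f.hasCompactSupport.smul_right

/-- The operator `v(f) = ∫ f(s) v(s) ds` for `f ∈ C_c(G)`, with respect to left Haar measure. -/
def UnitaryRep.integrated [CompleteSpace E] (v : UnitaryRep G E) (f : C_c(G, ℂ)) : E →L[ℂ] E :=
  LinearMap.mkContinuous
    { toFun := fun ξ => ∫ s, f s • v.toHom s ξ ∂(Measure.haar : Measure G)
      map_add' := fun ξ η => by
        simp only [map_add, smul_add]
        exact integral_add (v.integrable_smul f ξ) (v.integrable_smul f η)
      map_smul' := fun c ξ => by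
        simp only [map_smul, RingHom.id_apply, smul_comm _ c]
        exact integral_smul c _ }
    (∫ s, ‖f s‖ ∂(Measure.haar : Measure G))
    (fun ξ => by
      refine (norm_integral_le_integral_norm _).trans (le_of_eq ?_)
      simp only [norm_smul, LinearIsometryEquiv.norm_map]
      exact integral_mul_const _ _)

end Integrated

section Reduced

variable (G : Type u) [Group G] [TopologicalSpace G] [IsTopologicalGroup G]
  [LocallyCompactSpace G] [MeasurableSpace G] [BorelSpace G]

/-- `L²(G)` with respect to left Haar measure. -/
abbrev L2 : Type u := Lp ℂ 2 (Measure.haar : Measure G)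

/-- The left regular representation `(λ(s) ξ)(t) = ξ(s⁻¹ t)` of `G` on `L²(G)`. -/
def regularRep : UnitaryRep G (L2 G) where
  toHom :=
    { toFun := fun s =>
        { toFun := fun ξ => DomMulAct.mk s⁻¹ • ξ
          invFun := fun ξ => DomMulAct.mk s • ξ
          left_inv := fun ξ => by
            change DomMulAct.mk s • DomMulAct.mk s⁻¹ • ξ = ξ
            rw [smul_smul, ← DomMulAct.mk_mul]; simp
          right_inv := fun ξ => by
            change DomMulAct.mk s⁻¹ • DomMulAct.mk s • ξ = ξ
            rw [smul_smul, ← DomMulAct.mk_mul]; simp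
          map_add' := fun ξ η => smul_add _ _ _
          map_smul' := fun c ξ => smul_comm _ _ _
          norm_map' := fun ξ => DomMulAct.norm_smul_Lp _ _ }
      map_one' := by
        ext1 ξ
        change DomMulAct.mk (1 : G)⁻¹ • ξ = ξ
        simp
      map_mul' := fun s t => by
        ext1 ξ
        change DomMulAct.mk (s * t)⁻¹ • ξ = DomMulAct.mk s⁻¹ • DomMulAct.mk t⁻¹ • ξ
        rw [smul_smul, ← DomMulAct.mk_mul, mul_inv_rev] }
  continuous_apply ξ := by
    change Continuous fun s : G => DomMulAct.mk s⁻¹ • ξ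
    have _ : Fact ((2 : ℝ≥0∞) ≠ ∞) := ⟨by simp⟩
    exact (DomMulAct.continuous_mk.comp continuous_inv).smul continuous_const

/-- The reduced group C⋆-algebra `C⋆_r(G)`: the C⋆-algebra of operators on `L²(G)` generated by
the `λ(f)`, `f ∈ C_c(G)`; these already form a dense `⋆`-subalgebra. -/
def reducedCStar : NonUnitalStarSubalgebra ℂ (L2 G →L[ℂ] L2 G) :=
  (NonUnitalStarAlgebra.adjoin ℂ
    (Set.range fun f : C_c(G, ℂ) => (regularRep G).integrated f)).topologicalClosure

instance : IsClosed (reducedCStar G : Set (L2 G →L[ℂ] L2 G)) :=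
  NonUnitalStarSubalgebra.isClosed_topologicalClosure _

variable {G}

/-- For a closed (hence locally compact) subgroup `H` of `G`, the C⋆-algebra of operators on
`L²(G)` generated by `λ_G(f) = ∫_H f(h) λ_G(h) dh`, `f ∈ C_c(H)`. Since `λ_G|_H` and `λ_H` are
weakly equivalent, `λ_H(f) ↦ λ_G(f)` extends to an isomorphism of `C⋆_r(H)` with it. -/
def subgroupCStar (H : Subgroup G) [LocallyCompactSpace H] :
    NonUnitalStarSubalgebra ℂ (L2 G →L[ℂ] L2 G) :=
  (NonUnitalStarAlgebra.adjoin ℂ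
    (Set.range fun f : C_c(H, ℂ) =>
      ((regularRep G).restrict H).integrated f)).topologicalClosure

/-- `C⋆_r(H)` inside the multiplier algebra of `C⋆_r(G)`: the multipliers `m` that are given
by multiplication with an operator `T` on `L²(G)` belonging to `subgroupCStar H`, that is
`m a = T a` and `a m = a T` for all `a ∈ C⋆_r(G)`. -/
def subgroupMultipliers (H : Subgroup G) [LocallyCompactSpace H] :
    NonUnitalStarSubalgebra ℂ 𝓜(ℂ, reducedCStar G) :=
  implementedMultipliers (reducedCStar G) (subgroupCStar H)

end Reduced

end PropertyT

end

open PropertyT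

noncomputable section

namespace PropertyT

/-! Write A for the reduced group C⋆-algebra. The link between the two properties is the conjugation
representation `conjRep`, ξ ↦ λ(s)·ξ·λ(s⁻¹), which every bimodule over A carries. Since s ↦ λ(s) is
strictly continuous into M(A), compact subsets of G become strictly compact sets of multipliers, so
almost-𝔎_A-central nets are almost invariant for `conjRep`. Integration against C_c(H), and testing
a continuous function against all of C_c(H), shows that the vectors central for C⋆_r(H) are exactly
the H-invariant vectors of `conjRep` (`mem_central_subgroupMultipliers`).

From groups to algebras, it therefore suffices to strengthen Property (T): almost invariant unit
vectors must be close to H-invariant ones. For H = G this is elementary, because the orthogonal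
complement of the invariant vectors is a subrepresentation. For general H that complement need not
be stable under G, and σ-compactness is used instead. If almost invariant vectors stayed away from
the H-invariant ones, a circumcentre argument gives elements of H that move them by a fixed amount.
A weighted direct sum of the coboundaries of such vectors is a continuous map b from G to a Hilbert
space, with left invariant distances ‖b x - b y‖, that is unbounded on H. But Property (T) forces
such a map to be bounded on H: the Gaussian kernels exp(-‖b x - b y‖²/(n+1)) are positive
semidefinite (Schoenberg), and the representation they define has almost invariant vectors, and no
nonzero H-invariant vector if b is unbounded on H.

From algebras to groups, a representation v on E is turned into a bimodule on L²(G, E). The left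
action is translation. The right action is a ↦ J a⋆ J on the first factor of a second decomposition
of L²(G, E) as a tensor product, twisted by v; Fell absorption makes the two actions commute. In the
twisted decomposition `conjRep` is conjugation on L²(G) tensored with v. An IN-group has a
conjugation invariant unit vector χ, namely a normalised indicator function, so η ↦ χ ⊗ η embeds v
isometrically and equivariantly into `conjRep`. As the right action touches only χ, almost
invariance of ξ_i gives almost-𝔎_A-centrality of χ ⊗ ξ_i. A nearby central vector, mapped back by
the adjoint of the embedding, is a nonzero H-invariant vector.

IN-groups are unimodular, which is what makes inversion and J isometric on L²(G). -/

/-- Strong convergence of a bounded family of operators can be tested on a total set. -/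
theorem tendsto_apply_of_total {E F : Type*} [NormedAddCommGroup E] [NormedSpace ℂ E]
    [NormedAddCommGroup F] [NormedSpace ℂ F] {ι : Type*} {l : Filter ι} {T : ι → E →L[ℂ] F}
    {S : E →L[ℂ] F} {c : ℝ} (hT : ∀ᶠ i in l, ‖T i‖ ≤ c) {D : Set E}
    (hD : Dense (Submodule.span ℂ D : Set E))
    (h : ∀ x ∈ D, Tendsto (fun i => T i x) l (𝓝 (S x))) (x : E) :
    Tendsto (fun i => T i x) l (𝓝 (S x)) := by
  have h1 : ∀ y ∈ Submodule.span ℂ D, Tendsto (fun i => T i y) l (𝓝 (S y)) := by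
    intro y hy
    induction hy using Submodule.span_induction with
    | mem y hy => exact h y hy
    | zero => simpa using tendsto_const_nhds
    | add y z _ _ hy hz => simpa using hy.add hz
    | smul k y _ hy => simpa using hy.const_smul k
  rw [Metric.tendsto_nhds]
  intro ε hε
  set C : ℝ := max c 0 + ‖S‖ + 1 with hC
  have hC0 : 0 < C := by positivity
  obtain ⟨y, hy, hd⟩ := Metric.dense_iff.1 hD x (ε / (2 * C)) (by positivity)
  rw [Metric.mem_ball, dist_eq_norm'] at hy
  filter_upwards [hT, Metric.tendsto_nhds.1 (h1 y hd) (ε / 2) (by positivity)] with i hi hi'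
  rw [dist_eq_norm] at hi' ⊢
  have h2 : ‖T i (x - y)‖ ≤ max c 0 * ‖x - y‖ :=
    ((T i).le_opNorm _).trans (by gcongr; exact hi.trans (le_max_left _ _))
  have h3 : ‖S (x - y)‖ ≤ ‖S‖ * ‖x - y‖ := S.le_opNorm _
  have h4 : C * ‖x - y‖ < ε / 2 := by
    calc C * ‖x - y‖ < C * (ε / (2 * C)) := by gcongr
      _ = ε / 2 := by field_simp
  calc ‖T i x - S x‖ = ‖T i (x - y) + (T i y - S y) - S (x - y)‖ := by
        rw [map_sub, map_sub]; congr 1; abel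
    _ ≤ ‖T i (x - y)‖ + ‖T i y - S y‖ + ‖S (x - y)‖ :=
        (norm_sub_le _ _).trans (by gcongr; exact norm_add_le _ _)
    _ < ε := by nlinarith [norm_nonneg (x - y)]

/-- In a nondegenerate antirepresentation, some element of the unit ball almost fixes a given
vector and is almost a right unit for a given compact set. -/
theorem exists_approximate_right_unit {A : Type*} [NonUnitalCStarAlgebra A]
    {E : Type*} [NormedAddCommGroup E] [InnerProductSpace ℂ E] [CompleteSpace E]
    (φ : A →⋆ₙₐ[ℂ] (E →L[ℂ] E)ᵐᵒᵖ)
    (hφ : Dense (Submodule.span ℂ {η : E | ∃ a ξ, (φ a).unop ξ = η} : Set E))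
    {K : Set A} (hK : IsCompact K) (x : E) {ε : ℝ} (hε : 0 < ε) :
    ∃ e : A, ‖e‖ ≤ 1 ∧ (∀ k ∈ K, ‖k * e - k‖ ≤ ε) ∧ ‖(φ e).unop x - x‖ ≤ ε := by
  let _ : PartialOrder A := CStarAlgebra.spectralOrder A
  have _ : StarOrderedRing A := CStarAlgebra.spectralOrderedRing A
  have hl := CStarAlgebra.increasingApproximateUnit A
  have hcont : Continuous φ := AddMonoidHomClass.continuous_of_bound φ 1
    fun y => by simpa using NonUnitalStarAlgHom.norm_apply_le φ y
  have h1 : Tendsto (fun e => (φ e).unop x) (CStarAlgebra.approximateUnit A)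
      (𝓝 ((1 : E →L[ℂ] E) x)) := by
    refine tendsto_apply_of_total (c := 1) ?_ hφ ?_ x
    · filter_upwards [hl.eventually_norm] with e he
      exact (NonUnitalStarAlgHom.norm_apply_le φ e).trans he
    · rintro _ ⟨a, ξ, rfl⟩
      have h2 : ∀ e, (φ e).unop ((φ a).unop ξ) = (φ (a * e)).unop ξ := by
        intro e
        rw [map_mul]
        rfl
      simp only [h2]
      exact (((MulOpposite.continuous_unop.comp hcont).clm_apply continuous_const).tendsto
        a).comp (hl.tendsto_mul_left a)
  obtain ⟨t, htK, ht, hcov⟩ := hK.finite_cover_balls (e := ε / 3) (by positivity)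
  have h3 : ∀ᶠ e in CStarAlgebra.approximateUnit A, ∀ k ∈ t, ‖k * e - k‖ < ε / 3 := by
    refine (ht.eventually_all).2 fun k _ => ?_
    filter_upwards [Metric.tendsto_nhds.1 (hl.tendsto_mul_left k) (ε / 3) (by positivity)]
      with e he
    rwa [← dist_eq_norm]
  obtain ⟨e, he1, he2, he3⟩ := (hl.eventually_norm.and
    (h3.and (Metric.tendsto_nhds.1 h1 ε hε))).exists
  refine ⟨e, he1, fun k hk => ?_, ?_⟩
  · obtain ⟨k', hk', hkk⟩ := Set.mem_iUnion₂.1 (hcov hk)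
    rw [Metric.mem_ball, dist_eq_norm] at hkk
    have h4 : ‖(k - k') * e‖ ≤ ‖k - k'‖ :=
      (norm_mul_le _ _).trans (mul_le_of_le_one_right (norm_nonneg _) he1)
    calc ‖k * e - k‖ = ‖(k - k') * e + (k' * e - k') - (k - k')‖ := by
          rw [sub_mul]; congr 1; abel
      _ ≤ ‖(k - k') * e‖ + ‖k' * e - k'‖ + ‖k - k'‖ :=
          (norm_sub_le _ _).trans (by gcongr; exact norm_add_le _ _)
      _ ≤ ε := by linarith [he2 k' hk']
  · rw [dist_eq_norm] at he3
    exact he3.le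

/-! ### The strict topology -/

section Strict

variable {A : Type*} [NonUnitalCStarAlgebra A]

theorem continuous_strict_fst (a : A) :
    @Continuous _ _ (strictTopology A) _ (fun x : 𝓜(ℂ, A) => x.fst a) :=
  continuous_iff_le_induced.2 (inf_le_left.trans (iInf_le _ a))

theorem continuous_strict_snd (a : A) :
    @Continuous _ _ (strictTopology A) _ (fun x : 𝓜(ℂ, A) => x.snd a) :=
  continuous_iff_le_induced.2 (inf_le_right.trans (iInf_le _ a))

theorem continuous_strict_rng {S : Type*} [TopologicalSpace S] {f : S → 𝓜(ℂ, A)}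
    (h1 : ∀ a, Continuous fun s => (f s).fst a) (h2 : ∀ a, Continuous fun s => (f s).snd a) :
    @Continuous _ _ _ (strictTopology A) f :=
  continuous_inf_rng.2 ⟨continuous_iInf_rng.2 fun a => continuous_induced_rng.2 (h1 a),
    continuous_iInf_rng.2 fun a => continuous_induced_rng.2 (h2 a)⟩

/-- Strict compactness makes x ↦ x a bounded on L for each a, so the uniform boundedness principle
applies to the left multiplications. -/
theorem exists_norm_le_of_isCompact_strict {L : Set 𝓜(ℂ, A)}
    (hL : @IsCompact _ (strictTopology A) L) : ∃ C, 0 ≤ C ∧ ∀ x ∈ L, ‖x‖ ≤ C := by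
  obtain ⟨C, hC⟩ := banach_steinhaus (g := fun x : L => x.1.fst) fun a => by
    have h := @IsCompact.image _ _ (strictTopology A) _ _ _ hL (continuous_strict_fst a)
    obtain ⟨C, hC⟩ := h.isBounded.exists_norm_le
    exact ⟨C, fun x => hC _ ⟨x, x.2, rfl⟩⟩
  refine ⟨max C 0, le_max_right _ _, fun x hx => ?_⟩
  rw [← DoubleCentralizer.norm_fst]
  exact (hC ⟨x, hx⟩).trans (le_max_left _ _)

end Strict

/-! ### Multipliers acting on bimodules, and a criterion for almost centrality -/

namespace HilbertBimodule

variable {A : Type*} [NonUnitalCStarAlgebra A]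
  {E : Type*} [NormedAddCommGroup E] [InnerProductSpace ℂ E] [CompleteSpace E]

theorem ext_left (X : HilbertBimodule A E) {S T : E →L[ℂ] E}
    (h : ∀ a ξ, S (X.left a ξ) = T (X.left a ξ)) : S = T := by
  apply ContinuousLinearMap.ext_on X.left_nondegenerate
  rintro _ ⟨a, ξ, rfl⟩
  exact h a ξ

theorem ext_right (X : HilbertBimodule A E) {S T : E →L[ℂ] E}
    (h : ∀ a ξ, S ((X.right a).unop ξ) = T ((X.right a).unop ξ)) : S = T := by
  apply ContinuousLinearMap.ext_on X.right_nondegenerate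
  rintro _ ⟨a, ξ, rfl⟩
  exact h a ξ

theorem ext_inner_left (X : HilbertBimodule A E) {S T : E →L[ℂ] E}
    (h : ∀ a ξ b η, inner ℂ (S (X.left a ξ)) (X.left b η) = inner ℂ (T (X.left a ξ)) (X.left b η)) :
    S = T := by
  refine X.ext_left fun a ξ => ?_
  have : innerSL ℂ (S (X.left a ξ)) = innerSL ℂ (T (X.left a ξ)) := by
    apply ContinuousLinearMap.ext_on X.left_nondegenerate
    rintro _ ⟨b, η, rfl⟩
    exact h a ξ b η
  exact innerSL_inj.1 this

theorem ext_inner_right (X : HilbertBimodule A E) {S T : E →L[ℂ] E}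
    (h : ∀ a ξ b η, inner ℂ (S ((X.right a).unop ξ)) ((X.right b).unop η)
      = inner ℂ (T ((X.right a).unop ξ)) ((X.right b).unop η)) :
    S = T := by
  refine X.ext_right fun a ξ => ?_
  have : innerSL ℂ (S ((X.right a).unop ξ)) = innerSL ℂ (T ((X.right a).unop ξ)) := by
    apply ContinuousLinearMap.ext_on X.right_nondegenerate
    rintro _ ⟨b, η, rfl⟩
    exact h a ξ b η
  exact innerSL_inj.1 this

theorem inner_left_left (X : HilbertBimodule A E) (a b : A) (ξ η : E) :
    inner ℂ (X.left a ξ) (X.left b η) = inner ℂ ξ (X.left (star a * b) η) := by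
  rw [map_mul, map_star, ContinuousLinearMap.star_eq_adjoint, mul_apply_eq_comp,
    ContinuousLinearMap.adjoint_inner_right]

theorem inner_right_right (X : HilbertBimodule A E) (a b : A) (ξ η : E) :
    inner ℂ ((X.right a).unop ξ) ((X.right b).unop η)
      = inner ℂ ξ ((X.right (b * star a)).unop η) := by
  rw [map_mul, map_star, MulOpposite.unop_mul, MulOpposite.unop_star,
    ContinuousLinearMap.star_eq_adjoint, mul_apply_eq_comp,
    ContinuousLinearMap.adjoint_inner_right]

/-- The extension of the left action to the multiplier algebra, as a `⋆`-homomorphism. -/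
def leftMulHom (X : HilbertBimodule A E) : 𝓜(ℂ, A) →⋆ₙₐ[ℂ] (E →L[ℂ] E) where
  toFun := X.leftMul
  map_smul' c x := X.ext_left fun a ξ => by
    simp [leftMul_apply]
  map_zero' := X.ext_left fun a ξ => by simp [leftMul_apply]
  map_add' x y := X.ext_left fun a ξ => by
    simp [leftMul_apply]
  map_mul' x y := X.ext_left fun a ξ => by
    simp [leftMul_apply]
  map_star' x := X.ext_inner_left fun a ξ b η => by
    rw [ContinuousLinearMap.star_eq_adjoint, ContinuousLinearMap.adjoint_inner_left,
      leftMul_apply, leftMul_apply, inner_left_left, inner_left_left,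
      DoubleCentralizer.star_fst, star_star, x.central]

@[simp]
theorem leftMulHom_apply (X : HilbertBimodule A E) (x : 𝓜(ℂ, A)) :
    X.leftMulHom x = X.leftMul x := rfl

/-- The extension of the right action to the multiplier algebra, as a `⋆`-antihomomorphism. -/
def rightMulHom (X : HilbertBimodule A E) : 𝓜(ℂ, A) →⋆ₙₐ[ℂ] (E →L[ℂ] E)ᵐᵒᵖ where
  toFun x := MulOpposite.op (X.rightMul x)
  map_smul' c x := MulOpposite.unop_injective <| X.ext_right fun a ξ => by
    simp [rightMul_apply]
  map_zero' := MulOpposite.unop_injective <| X.ext_right fun a ξ => by simp [rightMul_apply]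
  map_add' x y := MulOpposite.unop_injective <| X.ext_right fun a ξ => by
    simp [rightMul_apply]
  map_mul' x y := MulOpposite.unop_injective <| X.ext_right fun a ξ => by
    simp [rightMul_apply]
  map_star' x := MulOpposite.unop_injective <| X.ext_inner_right fun a ξ b η => by
    rw [MulOpposite.unop_star, MulOpposite.unop_op, MulOpposite.unop_op,
      ContinuousLinearMap.star_eq_adjoint, ContinuousLinearMap.adjoint_inner_left,
      rightMul_apply, rightMul_apply, inner_right_right, inner_right_right,
      DoubleCentralizer.star_snd, star_star, x.central]

@[simp]
theorem unop_rightMulHom_apply (X : HilbertBimodule A E) (x : 𝓜(ℂ, A)) :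
    (X.rightMulHom x).unop = X.rightMul x := rfl

theorem leftMul_mul (X : HilbertBimodule A E) (x y : 𝓜(ℂ, A)) :
    X.leftMul (x * y) = X.leftMul x * X.leftMul y := map_mul X.leftMulHom x y

theorem rightMul_mul (X : HilbertBimodule A E) (x y : 𝓜(ℂ, A)) :
    X.rightMul (x * y) = X.rightMul y * X.rightMul x :=
  congrArg MulOpposite.unop (map_mul X.rightMulHom x y)

theorem leftMul_one (X : HilbertBimodule A E) : X.leftMul 1 = 1 :=
  X.ext_left fun a ξ => by simp [leftMul_apply]

theorem rightMul_one (X : HilbertBimodule A E) : X.rightMul 1 = 1 :=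
  X.ext_right fun a ξ => by simp [rightMul_apply]

theorem norm_leftMul_le (X : HilbertBimodule A E) (x : 𝓜(ℂ, A)) : ‖X.leftMul x‖ ≤ ‖x‖ :=
  NonUnitalStarAlgHom.norm_apply_le X.leftMulHom x

theorem norm_rightMul_le (X : HilbertBimodule A E) (x : 𝓜(ℂ, A)) : ‖X.rightMul x‖ ≤ ‖x‖ :=
  NonUnitalStarAlgHom.norm_apply_le X.rightMulHom x

theorem norm_left_le (X : HilbertBimodule A E) (a : A) : ‖X.left a‖ ≤ ‖a‖ :=
  NonUnitalStarAlgHom.norm_apply_le X.left a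

theorem norm_right_le (X : HilbertBimodule A E) (a : A) : ‖(X.right a).unop‖ ≤ ‖a‖ :=
  NonUnitalStarAlgHom.norm_apply_le X.right a

theorem continuous_left (X : HilbertBimodule A E) : Continuous X.left :=
  AddMonoidHomClass.continuous_of_bound X.left 1 fun y => by simpa using X.norm_left_le y

theorem continuous_right (X : HilbertBimodule A E) : Continuous X.right :=
  AddMonoidHomClass.continuous_of_bound X.right 1
    fun y => (one_mul ‖y‖).symm ▸ X.norm_right_le y

/-- Companion of the defining relation `leftMul_apply`: there A acts before the multiplier, here
after it. It lets identities between multiplier operators be tested after applying A. -/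
theorem left_mul_leftMul (X : HilbertBimodule A E) (x : 𝓜(ℂ, A)) (a : A) :
    X.left a * X.leftMul x = X.left (x.snd a) :=
  X.ext_left fun b ξ => by
    rw [mul_apply_eq_comp, leftMul_apply, ← mul_apply_eq_comp,
      ← mul_apply_eq_comp, ← map_mul, ← map_mul, x.central]

theorem right_mul_rightMul (X : HilbertBimodule A E) (x : 𝓜(ℂ, A)) (a : A) :
    (X.right a).unop * X.rightMul x = (X.right (x.fst a)).unop :=
  X.ext_right fun b ξ => by
    rw [mul_apply_eq_comp, rightMul_apply, ← mul_apply_eq_comp,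
      ← mul_apply_eq_comp, ← MulOpposite.unop_mul, ← MulOpposite.unop_mul,
      ← map_mul, ← map_mul, x.central]

theorem leftMul_coe (X : HilbertBimodule A E) (a : A) : X.leftMul (a : 𝓜(ℂ, A)) = X.left a :=
  X.ext_left fun b ξ => by simp [leftMul_apply]

theorem rightMul_coe (X : HilbertBimodule A E) (a : A) :
    X.rightMul (a : 𝓜(ℂ, A)) = (X.right a).unop :=
  X.ext_right fun b ξ => by simp [rightMul_apply]

theorem commute_leftMul_rightMul (X : HilbertBimodule A E) (x y : 𝓜(ℂ, A)) :
    Commute (X.leftMul x) (X.rightMul y) := by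
  have h1 : ∀ b ξ, X.leftMul x ((X.right b).unop ξ) = (X.right b).unop (X.leftMul x ξ) := by
    intro b
    suffices h : X.leftMul x * (X.right b).unop = (X.right b).unop * X.leftMul x from
      fun ξ => DFunLike.congr_fun h ξ
    refine X.ext_left fun a ξ => ?_
    simp only [mul_apply_eq_comp]
    rw [← X.commute, leftMul_apply, leftMul_apply, X.commute]
  refine X.ext_right fun b ξ => ?_
  simp only [mul_apply_eq_comp]
  rw [rightMul_apply, h1, h1, rightMul_apply]

theorem leftMul_rightMul_comm (X : HilbertBimodule A E) (x y : 𝓜(ℂ, A)) (ξ : E) :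
    X.leftMul x (X.rightMul y ξ) = X.rightMul y (X.leftMul x ξ) :=
  DFunLike.congr_fun (X.commute_leftMul_rightMul x y) ξ

/-- Pointwise asymptotic centrality is uniform on norm compact sets. -/
theorem eventually_forall_norm_left_sub_right_le (X : HilbertBimodule A E) {ι : Type*} {l : Filter ι}
    {ξ : ι → E} (hξ : ∀ i, ‖ξ i‖ = 1)
    (h : ∀ a, Tendsto (fun i => X.left a (ξ i) - (X.right a).unop (ξ i)) l (𝓝 0))
    {K : Set A} (hK : IsCompact K) {ε : ℝ} (hε : 0 < ε) :
    ∀ᶠ i in l, ∀ a ∈ K, ‖X.left a (ξ i) - (X.right a).unop (ξ i)‖ ≤ ε := by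
  obtain ⟨t, htK, ht, hcov⟩ := hK.finite_cover_balls (e := ε / 3) (by positivity)
  have h3 : ∀ᶠ i in l, ∀ k ∈ t, ‖X.left k (ξ i) - (X.right k).unop (ξ i)‖ < ε / 3 := by
    refine (ht.eventually_all).2 fun k _ => ?_
    filter_upwards [Metric.tendsto_nhds.1 (h k) (ε / 3) (by positivity)] with i hi
    rwa [dist_zero_right] at hi
  filter_upwards [h3] with i hi a ha
  obtain ⟨k, hk, hkk⟩ := Set.mem_iUnion₂.1 (hcov ha)
  rw [Metric.mem_ball, dist_eq_norm] at hkk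
  have h4 : ‖X.left (a - k) (ξ i)‖ ≤ ‖a - k‖ := by
    simpa [hξ i] using (X.left (a - k)).le_of_opNorm_le (X.norm_left_le _) (ξ i)
  have h5 : ‖(X.right (a - k)).unop (ξ i)‖ ≤ ‖a - k‖ := by
    simpa [hξ i] using ((X.right (a - k)).unop).le_of_opNorm_le (X.norm_right_le _) (ξ i)
  calc ‖X.left a (ξ i) - (X.right a).unop (ξ i)‖
      = ‖X.left (a - k) (ξ i) + (X.left k (ξ i) - (X.right k).unop (ξ i))
          - (X.right (a - k)).unop (ξ i)‖ := by
        congr 1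
        rw [map_sub X.left, map_sub X.right, MulOpposite.unop_sub, _root_.sub_apply,
          _root_.sub_apply]
        abel
    _ ≤ ‖X.left (a - k) (ξ i)‖ + ‖X.left k (ξ i) - (X.right k).unop (ξ i)‖
          + ‖(X.right (a - k)).unop (ξ i)‖ :=
        (norm_sub_le _ _).trans (by gcongr; exact norm_add_le _ _)
    _ ≤ ε := by linarith [hi k hk]

/-- A net of unit vectors is almost-`𝔎_A`-central if it is asymptotically central for each
element of `A` and, up to `ε`, fixed by right approximate units. -/
theorem isAlmostCentral_of_tendsto (X : HilbertBimodule A E) {ι : Type*} [Preorder ι]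
    {ξ : ι → E} (hξ : ∀ i, ‖ξ i‖ = 1)
    (h : ∀ a, Tendsto (fun i => X.left a (ξ i) - (X.right a).unop (ξ i)) atTop (𝓝 0))
    (hu : ∀ K : Set A, IsCompact K → ∀ ε : ℝ, 0 < ε → ∃ e : A, ‖e‖ ≤ 1 ∧
      (∀ k ∈ K, ‖k * e - k‖ ≤ ε) ∧ ∀ i, ‖(X.right e).unop (ξ i) - ξ i‖ ≤ ε) :
    X.IsAlmostCentral ξ := by
  intro L hL ε hε
  obtain ⟨C, hC0, hC⟩ := exists_norm_le_of_isCompact_strict hL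
  set δ : ℝ := ε / (4 * C + 3) with hδ
  have hδ0 : 0 < δ := by positivity
  have hδε : (4 * C + 3) * δ = ε := by rw [hδ]; field_simp
  -- The element e brings the net into the range of the right action of A, where multipliers act
  -- through A. Then f is chosen as an approximate right unit for the norm compact set {e x : x ∈
  -- L}. Asymptotic centrality is needed only on the norm compact sets {x f : x ∈ L} and {f}.
  obtain ⟨e, he1, -, he⟩ := hu ∅ isCompact_empty δ hδ0
  have hK1 : IsCompact ((fun x : 𝓜(ℂ, A) => x.snd e) '' L) :=
    @IsCompact.image _ _ (strictTopology A) _ _ _ hL (continuous_strict_snd e)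
  obtain ⟨f, hf1, hfK, hf⟩ := hu _ hK1 δ hδ0
  have hK2 : IsCompact ((fun x : 𝓜(ℂ, A) => x.fst f) '' L) :=
    @IsCompact.image _ _ (strictTopology A) _ _ _ hL (continuous_strict_fst f)
  filter_upwards [X.eventually_forall_norm_left_sub_right_le hξ h hK2 hδ0,
    X.eventually_forall_norm_left_sub_right_le hξ h (isCompact_singleton (x := f)) hδ0]
    with i hi1 hi2 x hx
  have hxC := hC x hx
  have hR : ∀ y, ‖X.rightMul x y‖ ≤ C * ‖y‖ := fun y =>
    (X.rightMul x).le_of_opNorm_le ((X.norm_rightMul_le x).trans hxC) y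
  have hLx : ∀ y, ‖X.leftMul x y‖ ≤ C * ‖y‖ := fun y =>
    (X.leftMul x).le_of_opNorm_le ((X.norm_leftMul_le x).trans hxC) y
  have hRf : ∀ y, ‖(X.right f).unop y‖ ≤ ‖y‖ := fun y => by
    simpa using ((X.right f).unop).le_of_opNorm_le ((X.norm_right_le f).trans hf1) y
  set η := ξ i
  have s1 : ‖X.rightMul x (η - (X.right e).unop η)‖ ≤ C * δ :=
    (hR _).trans (by gcongr; rw [norm_sub_rev]; exact he i)
  have s2 : ‖(X.right (x.snd e * f - x.snd e)).unop η‖ ≤ δ := by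
    refine (((X.right _).unop).le_of_opNorm_le (X.norm_right_le _) η).trans ?_
    rw [hξ i, mul_one]
    exact hfK _ ⟨x, hx, rfl⟩
  have s3 : ‖(X.right f).unop (X.rightMul x ((X.right e).unop η - η))‖ ≤ C * δ :=
    (hRf _).trans ((hR _).trans (by gcongr; exact he i))
  have s4 : ‖X.left (x.fst f) η - (X.right (x.fst f)).unop η‖ ≤ δ := hi1 _ ⟨x, hx, rfl⟩
  have s5 : ‖X.leftMul x (X.left f η - (X.right f).unop η)‖ ≤ C * δ :=
    (hLx _).trans (by gcongr; exact hi2 f rfl)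
  have s6 : ‖X.leftMul x ((X.right f).unop η - η)‖ ≤ C * δ :=
    (hLx _).trans (by gcongr; exact hf i)
  -- Telescoping along x·η ≈ x·(η·f) ≈ x·(f·η) = (xf)·η ≈ η·(xf) = (η·x)·f ≈ ((η·e)·x)·f = η·(exf) ≈
  -- η·(ex) = (η·e)·x ≈ η·x. Four errors are at most Cδ and two are at most δ, which fits into (4C +
  -- 3)δ = ε.
  have key : X.leftMul x η - X.rightMul x η
      = (X.left (x.fst f) η - (X.right (x.fst f)).unop η)
        - X.leftMul x (X.left f η - (X.right f).unop η)
        - X.leftMul x ((X.right f).unop η - η)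
        - (X.right f).unop (X.rightMul x ((X.right e).unop η - η))
        + (X.right (x.snd e * f - x.snd e)).unop η
        - X.rightMul x (η - (X.right e).unop η) := by
    have e1 : X.leftMul x (X.left f η) = X.left (x.fst f) η := X.leftMul_apply x f η
    have e2 : X.rightMul x ((X.right e).unop η) = (X.right (x.snd e)).unop η :=
      X.rightMul_apply x e η
    have e3 : (X.right (x.snd e * f)).unop η = (X.right f).unop ((X.right (x.snd e)).unop η) := by
      rw [map_mul]; rfl
    have e4 : (X.right (x.fst f)).unop η = (X.right f).unop (X.rightMul x η) := by
      rw [← X.right_mul_rightMul]; rfl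
    rw [map_sub X.right, MulOpposite.unop_sub, _root_.sub_apply]
    simp only [map_sub, e1, e2, e3, e4]
    abel
  rw [key]
  refine (norm_sub_le _ _).trans ?_
  refine (add_le_add_left (norm_add_le _ _) _).trans ?_
  refine (add_le_add_left (add_le_add_left (norm_sub_le _ _) _) _).trans ?_
  refine (add_le_add_left (add_le_add_left (add_le_add_left (norm_sub_le _ _) _) _) _).trans ?_
  refine (add_le_add_left (add_le_add_left (add_le_add_left (add_le_add_left
    (norm_sub_le _ _) _) _) _) _).trans ?_
  linarith

end HilbertBimodule

/-! ### Operators of a unitary representation -/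

namespace UnitaryRep

section Op

variable {G : Type*} [Group G] [TopologicalSpace G]
  {E : Type*} [NormedAddCommGroup E] [InnerProductSpace ℂ E]

/-- The operator `v(s)` as a continuous linear map. -/
def op (v : UnitaryRep G E) (s : G) : E →L[ℂ] E :=
  (v.toHom s).toContinuousLinearEquiv.toContinuousLinearMap

@[simp]
theorem op_apply (v : UnitaryRep G E) (s : G) (ξ : E) : v.op s ξ = v.toHom s ξ := rfl

theorem op_one (v : UnitaryRep G E) : v.op 1 = 1 := by
  ext ξ
  simp

theorem op_mul (v : UnitaryRep G E) (s t : G) : v.op (s * t) = v.op s * v.op t := by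
  ext ξ
  simp

theorem norm_op_le (v : UnitaryRep G E) (s : G) : ‖v.op s‖ ≤ 1 :=
  ContinuousLinearMap.opNorm_le_bound _ zero_le_one fun ξ => by simp

theorem toHom_mul_apply (v : UnitaryRep G E) (s t : G) (ξ : E) :
    v.toHom (s * t) ξ = v.toHom s (v.toHom t ξ) := by
  rw [map_mul]
  rfl

theorem inner_toHom_left (v : UnitaryRep G E) (s : G) (ξ η : E) :
    inner ℂ (v.toHom s ξ) η = inner ℂ ξ (v.toHom s⁻¹ η) := by
  rw [← LinearIsometryEquiv.inner_map_map (v.toHom s) ξ, ← toHom_mul_apply, mul_inv_cancel,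
    map_one]
  rfl

theorem star_op [CompleteSpace E] (v : UnitaryRep G E) (s : G) : star (v.op s) = v.op s⁻¹ := by
  rw [ContinuousLinearMap.star_eq_adjoint, eq_comm, ContinuousLinearMap.eq_adjoint_iff]
  intro ξ η
  change inner ℂ (v.toHom s⁻¹ ξ) η = inner ℂ ξ (v.toHom s η)
  rw [inner_toHom_left, inv_inv]

/-- The pull-back of a unitary representation along a continuous homomorphism. -/
def comap {K : Type*} [Group K] [TopologicalSpace K] (v : UnitaryRep G E) (j : K →* G)
    (hj : Continuous j) : UnitaryRep K E where
  toHom := v.toHom.comp j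
  continuous_apply ξ := (v.continuous_apply ξ).comp hj

@[simp]
theorem comap_toHom_apply {K : Type*} [Group K] [TopologicalSpace K] (v : UnitaryRep G E)
    (j : K →* G) (hj : Continuous j) (k : K) : (v.comap j hj).toHom k = v.toHom (j k) := rfl

/-- A unitary representation from a strongly continuous homomorphism into the contractions. -/
def ofContractions (U : G → E →L[ℂ] E) (h1 : ∀ ξ, U 1 ξ = ξ)
    (hmul : ∀ s t ξ, U (s * t) ξ = U s (U t ξ)) (hU : ∀ s ξ, ‖U s ξ‖ ≤ ‖ξ‖)
    (hc : ∀ ξ, Continuous fun s => U s ξ) : UnitaryRep G E where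
  toHom :=
    { toFun := fun s =>
        { (U s).toLinearMap with
          invFun := U s⁻¹
          left_inv := fun ξ => by
            change U s⁻¹ (U s ξ) = ξ
            rw [← hmul, inv_mul_cancel, h1]
          right_inv := fun ξ => by
            change U s (U s⁻¹ ξ) = ξ
            rw [← hmul, mul_inv_cancel, h1]
          norm_map' := fun ξ => le_antisymm (hU s ξ) (by
            have h := hU s⁻¹ (U s ξ)
            rwa [← hmul, inv_mul_cancel, h1] at h) }
      map_one' := by
        ext ξ
        exact h1 ξ
      map_mul' := fun s t => by
        ext ξ
        exact hmul s t ξ }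
  continuous_apply := hc

@[simp]
theorem ofContractions_apply (U : G → E →L[ℂ] E) (h1 : ∀ ξ, U 1 ξ = ξ)
    (hmul : ∀ s t ξ, U (s * t) ξ = U s (U t ξ)) (hU : ∀ s ξ, ‖U s ξ‖ ≤ ‖ξ‖)
    (hc : ∀ ξ, Continuous fun s => U s ξ) (s : G) (ξ : E) :
    (ofContractions U h1 hmul hU hc).toHom s ξ = U s ξ := rfl

end Op

section Integrated

variable {G : Type*} [Group G] [TopologicalSpace G] [IsTopologicalGroup G]
  [LocallyCompactSpace G] [MeasurableSpace G] [BorelSpace G]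
  {E : Type*} [NormedAddCommGroup E] [InnerProductSpace ℂ E] [CompleteSpace E]

theorem integrated_apply (v : UnitaryRep G E) (f : C_c(G, ℂ)) (ξ : E) :
    v.integrated f ξ = ∫ s, f s • v.toHom s ξ ∂(Measure.haar : Measure G) := rfl

theorem inner_integrated (v : UnitaryRep G E) (f : C_c(G, ℂ)) (ξ η : E) :
    inner ℂ η (v.integrated f ξ)
      = ∫ s, f s * inner ℂ η (v.toHom s ξ) ∂(Measure.haar : Measure G) := by
  rw [integrated_apply, ← integral_inner (v.integrable_smul f ξ)]
  simp only [inner_smul_right]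

theorem norm_integrated_le (v : UnitaryRep G E) (f : C_c(G, ℂ)) :
    ‖v.integrated f‖ ≤ ∫ s, ‖f s‖ ∂(Measure.haar : Measure G) :=
  LinearMap.mkContinuous_norm_le _ (integral_nonneg fun _ => norm_nonneg _) _

theorem integrated_sub (v : UnitaryRep G E) (f g : C_c(G, ℂ)) :
    v.integrated (f - g) = v.integrated f - v.integrated g := by
  ext ξ
  rw [_root_.sub_apply, integrated_apply, integrated_apply, integrated_apply,
    ← integral_sub (v.integrable_smul f ξ) (v.integrable_smul g ξ)]
  simp [sub_smul]

/-- The left translate `t ↦ f (s⁻¹ t)` of a compactly supported function. -/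
def translate (s : G) (f : C_c(G, ℂ)) : C_c(G, ℂ) :=
  ⟨⟨fun t => f (s⁻¹ * t), f.continuous.comp (continuous_const_mul _)⟩,
    f.hasCompactSupport.comp_homeomorph (Homeomorph.mulLeft s⁻¹)⟩

theorem op_mul_integrated (v : UnitaryRep G E) (f : C_c(G, ℂ)) (s : G) :
    v.op s * v.integrated f = v.integrated (translate s f) := by
  ext ξ
  have h : v.op s (v.integrated f ξ)
      = ∫ t, v.op s (f t • v.toHom t ξ) ∂(Measure.haar : Measure G) :=
    ((v.op s).integral_comp_comm (v.integrable_smul f ξ)).symm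
  rw [mul_apply_eq_comp, h, integrated_apply,
    ← integral_mul_left_eq_self (fun t => translate s f t • v.toHom t ξ) s]
  refine integral_congr_ae (ae_of_all _ fun t => ?_)
  change v.op s (f t • v.toHom t ξ) = f (s⁻¹ * (s * t)) • v.toHom (s * t) ξ
  rw [inv_mul_cancel_left, map_smul, toHom_mul_apply]
  rfl

/-- Norm continuity, not just strong continuity: v(s)v(f) is v of a translate of f, the norm of v(f)
is at most the L¹ norm of f, and translation is continuous in L¹. -/
theorem continuous_op_mul_integrated (v : UnitaryRep G E) (f : C_c(G, ℂ)) :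
    Continuous fun s => v.op s * v.integrated f := by
  have hf : MemLp f 1 (Measure.haar : Measure G) :=
    f.continuous.memLp_of_hasCompactSupport f.hasCompactSupport
  have h1 : Continuous fun s : G => DomMulAct.mk s⁻¹ • hf.toLp f := by
    have _ : Fact ((1 : ℝ≥0∞) ≠ ∞) := ⟨by simp⟩
    exact (DomMulAct.continuous_mk.comp continuous_inv).smul continuous_const
  refine continuous_iff_continuousAt.2 fun s₀ => ?_
  rw [ContinuousAt, tendsto_iff_norm_sub_tendsto_zero]
  refine squeeze_zero (fun _ => norm_nonneg _) (fun s => ?_)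
    (tendsto_iff_norm_sub_tendsto_zero.1 (h1.tendsto s₀))
  rw [op_mul_integrated, op_mul_integrated, ← integrated_sub]
  refine (v.norm_integrated_le _).trans (le_of_eq ?_)
  rw [L1.norm_eq_integral_norm]
  refine integral_congr_ae ?_
  have h2 : ∀ s : G, (DomMulAct.mk s⁻¹ • hf.toLp f : Lp ℂ 1 (Measure.haar : Measure G))
      =ᵐ[(Measure.haar : Measure G)] translate s f := fun s => by
    rw [DomMulAct.mk_smul_toLp]
    exact MemLp.coeFn_toLp _
  filter_upwards [h2 s, h2 s₀, Lp.coeFn_sub (DomMulAct.mk s⁻¹ • hf.toLp f)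
    (DomMulAct.mk s₀⁻¹ • hf.toLp f)] with t ht ht₀ hs
  rw [hs, Pi.sub_apply, ht, ht₀]
  rfl

/-- The function g is t ↦ conj f(t⁻¹); no modular function appears because Haar measure is inversion
invariant. -/
theorem star_integrated [(Measure.haar : Measure G).IsInvInvariant] (v : UnitaryRep G E)
    (f : C_c(G, ℂ)) : ∃ g : C_c(G, ℂ), star (v.integrated f) = v.integrated g := by
  refine ⟨⟨⟨fun t => star (f t⁻¹), (f.continuous.comp continuous_inv).star⟩,
    (f.hasCompactSupport.comp_homeomorph (Homeomorph.inv G)).comp_left (star_zero _)⟩, ?_⟩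
  rw [ContinuousLinearMap.star_eq_adjoint, eq_comm, ContinuousLinearMap.eq_adjoint_iff]
  intro ξ η
  rw [inner_integrated, ← inner_conj_symm, inner_integrated, ← integral_conj]
  refine Eq.trans (integral_congr_ae (ae_of_all _ fun t => ?_))
    (integral_inv_eq_self (fun t => f t * inner ℂ ξ (v.toHom t η)) (Measure.haar : Measure G))
  change starRingEnd ℂ (star (f t⁻¹) * inner ℂ η (v.toHom t ξ)) = f t⁻¹ * inner ℂ ξ (v.toHom t⁻¹ η)
  rw [map_mul, inner_conj_symm, inner_toHom_left, starRingEnd_apply, star_star]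

end Integrated

end UnitaryRep

/-- A continuous function is zero if all its integrals against `C_c`-functions are. -/
theorem eq_zero_of_forall_integral_smul_eq_zero {G : Type*} [Group G] [TopologicalSpace G]
    [IsTopologicalGroup G] [LocallyCompactSpace G] [MeasurableSpace G] [BorelSpace G]
    {E : Type*} [NormedAddCommGroup E] [InnerProductSpace ℂ E] [CompleteSpace E]
    {F : G → E} (hF : Continuous F)
    (h : ∀ f : C_c(G, ℂ), ∫ s, f s • F s ∂(Measure.haar : Measure G) = 0) (s : G) : F s = 0 := by
  by_contra hs
  -- If F s ≠ 0, then Re ⟨F s, F t⟩ is positive near t = s. A bump function supported there has a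
  -- positive integral against it, against the hypothesis.
  set g : G → ℝ := fun t => (inner ℂ (F s) (F t)).re with hg
  have hgc : Continuous g := Complex.continuous_re.comp (continuous_const.inner hF)
  have hgs : 0 < g s := by
    change 0 < RCLike.re (inner ℂ (F s) (F s))
    rw [inner_self_eq_norm_sq]
    exact pow_pos (norm_pos_iff.2 hs) 2
  obtain ⟨b, hb1, hb2, hb3, hb4⟩ := exists_continuousMap_one_of_isCompact_subset_isOpen
    (isCompact_singleton (x := s)) (isOpen_lt continuous_const hgc) (Set.singleton_subset_iff.2 hgs)
  have hbc : HasCompactSupport b := hb2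
  let f : C_c(G, ℂ) := ⟨⟨fun t => (b t : ℂ), Complex.continuous_ofReal.comp b.continuous⟩,
    hbc.comp_left Complex.ofReal_zero⟩
  have hint : Integrable (fun t => f t • F t) (Measure.haar : Measure G) :=
    (f.continuous.smul hF).integrable_of_hasCompactSupport f.hasCompactSupport.smul_right
  have hpos : 0 < ∫ t, b t * g t ∂(Measure.haar : Measure G) := by
    refine (b.continuous.mul hgc).integral_pos_of_hasCompactSupport_nonneg_nonzero
      hbc.mul_right (fun t => ?_) (x := s) ?_
    · by_cases ht : t ∈ tsupport b
      · exact mul_nonneg (hb4 t).1 (hb3 ht).le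
      · simp [image_eq_zero_of_notMem_tsupport ht]
    · simp [hb1 rfl, hgs.ne']
  have h0 := congrArg Complex.re (congrArg (inner ℂ (F s)) (h f))
  rw [← integral_inner hint, ← RCLike.re_eq_complex_re, ← integral_re (hint.const_inner (F s))] at h0
  simp only [inner_smul_right, inner_zero_right] at h0
  have h1 : ∀ t, RCLike.re (f t * inner ℂ (F s) (F t)) = b t * g t := fun t => by
    simp [f, hg]
  simp only [h1] at h0
  simp at h0
  exact hpos.ne' h0

/-! ### Multipliers of a concrete C⋆-algebra -/

section Idealizer

variable {D : Type*} [CStarAlgebra D]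

/-- The C⋆-algebra of those `T` with `T A ⊆ A` and `A T ⊆ A`. -/
def idealizer (A : NonUnitalStarSubalgebra ℂ D) : NonUnitalStarSubalgebra ℂ D where
  carrier := {T | ∀ a ∈ A, T * a ∈ A ∧ a * T ∈ A}
  add_mem' hS hT a ha := by
    simp only [add_mul, mul_add]
    exact ⟨add_mem (hS a ha).1 (hT a ha).1, add_mem (hS a ha).2 (hT a ha).2⟩
  zero_mem' a _ := by simp
  smul_mem' c T hT a ha := by
    simp only [smul_mul_assoc, mul_smul_comm]
    exact ⟨SMulMemClass.smul_mem c (hT a ha).1, SMulMemClass.smul_mem c (hT a ha).2⟩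
  mul_mem' {S T} hS hT a ha := by
    rw [mul_assoc, ← mul_assoc a]
    exact ⟨(hS _ (hT a ha).1).1, (hT _ (hS a ha).2).2⟩
  star_mem' {T} hT a ha := by
    have h := hT _ (star_mem ha)
    exact ⟨by simpa using star_mem h.2, by simpa using star_mem h.1⟩

variable (A : NonUnitalStarSubalgebra ℂ D) [hA : IsClosed (A : Set D)]

theorem isClosed_idealizer : IsClosed (idealizer A : Set D) := by
  have : (idealizer A : Set D) = ⋂ a ∈ A, {T | T * a ∈ A} ∩ {T | a * T ∈ A} := by
    ext T
    exact ⟨fun h => Set.mem_iInter₂.2 fun a ha => h a ha,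
      fun h a ha => Set.mem_iInter₂.1 h a ha⟩
  rw [this]
  exact isClosed_biInter fun a _ => (hA.preimage (continuous_mul_const a)).inter
    (hA.preimage (continuous_const_mul a))

/-- The multiplier of `A` given by an element of the idealizer. -/
def toMultiplier : idealizer A →⋆ₙₐ[ℂ] 𝓜(ℂ, A) where
  toFun T :=
    { fst := LinearMap.mkContinuous
        { toFun := fun a => ⟨T * a, (T.2 a a.2).1⟩
          map_add' := fun _ _ => Subtype.ext (mul_add _ _ _)
          map_smul' := fun _ _ => Subtype.ext (mul_smul_comm _ _ _) } ‖(T : D)‖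
          fun a => norm_mul_le (T : D) a
      snd := LinearMap.mkContinuous
        { toFun := fun a => ⟨a * T, (T.2 a a.2).2⟩
          map_add' := fun _ _ => Subtype.ext (add_mul _ _ _)
          map_smul' := fun _ _ => Subtype.ext (smul_mul_assoc _ _ _) } ‖(T : D)‖
          fun a => (norm_mul_le (a : D) T).trans_eq (mul_comm _ _)
      central := fun _ _ => Subtype.ext (mul_assoc _ _ _) }
  map_smul' _ _ := DoubleCentralizer.ext _ _ _ _ <| Prod.ext
    (ContinuousLinearMap.ext fun _ => Subtype.ext (smul_mul_assoc _ _ _))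
    (ContinuousLinearMap.ext fun _ => Subtype.ext (mul_smul_comm _ _ _))
  map_zero' := DoubleCentralizer.ext _ _ _ _ <| Prod.ext
    (ContinuousLinearMap.ext fun _ => Subtype.ext (zero_mul _))
    (ContinuousLinearMap.ext fun _ => Subtype.ext (mul_zero _))
  map_add' _ _ := DoubleCentralizer.ext _ _ _ _ <| Prod.ext
    (ContinuousLinearMap.ext fun _ => Subtype.ext (add_mul _ _ _))
    (ContinuousLinearMap.ext fun _ => Subtype.ext (mul_add _ _ _))
  map_mul' _ _ := DoubleCentralizer.ext _ _ _ _ <| Prod.ext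
    (ContinuousLinearMap.ext fun _ => Subtype.ext (mul_assoc _ _ _))
    (ContinuousLinearMap.ext fun _ => Subtype.ext (mul_assoc _ _ _).symm)
  map_star' _ := DoubleCentralizer.ext _ _ _ _ <| Prod.ext
    (ContinuousLinearMap.ext fun _ => Subtype.ext (star_star_mul _ _).symm)
    (ContinuousLinearMap.ext fun _ => Subtype.ext (star_mul_star _ _).symm)

@[simp]
theorem coe_toMultiplier_fst (T : idealizer A) (a : A) :
    (((toMultiplier A T).fst a : A) : D) = T * a := rfl

@[simp]
theorem coe_toMultiplier_snd (T : idealizer A) (a : A) :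
    (((toMultiplier A T).snd a : A) : D) = a * T := rfl

theorem eq_toMultiplier {m : 𝓜(ℂ, A)} (T : idealizer A)
    (h : ∀ a : A, (m.fst a : D) = T * a ∧ (m.snd a : D) = a * T) : m = toMultiplier A T :=
  DoubleCentralizer.ext _ _ _ _ <| Prod.ext
    (ContinuousLinearMap.ext fun a => Subtype.ext (h a).1)
    (ContinuousLinearMap.ext fun a => Subtype.ext (h a).2)

theorem norm_toMultiplier_le (T : idealizer A) : ‖toMultiplier A T‖ ≤ ‖(T : D)‖ := by
  rw [← DoubleCentralizer.norm_fst]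
  exact ContinuousLinearMap.opNorm_le_bound _ (norm_nonneg _) fun a => norm_mul_le (T : D) a

theorem continuous_toMultiplier : Continuous (toMultiplier A) :=
  AddMonoidHomClass.continuous_of_bound (toMultiplier A) 1
    fun y => (one_mul ‖(y : D)‖).symm ▸ norm_toMultiplier_le A y

end Idealizer

/-- The operators v(s) are contractions, so norm approximation of a gives uniform approximation of s
↦ v(s)a. This carries norm continuity from the operators v(f) to norm limits. -/
theorem isClosed_setOf_continuous_op_mul {G : Type*} [Group G] [TopologicalSpace G]
    {E : Type*} [NormedAddCommGroup E]
    [InnerProductSpace ℂ E] (v : UnitaryRep G E) :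
    IsClosed {a : E →L[ℂ] E | Continuous fun s => v.op s * a} := by
  refine isClosed_of_closure_subset fun a ha => ?_
  refine continuous_of_uniform_approx_of_continuous fun u hu => ?_
  obtain ⟨ε, hε, hεu⟩ := Metric.mem_uniformity_dist.1 hu
  obtain ⟨b, hb, hab⟩ := Metric.mem_closure_iff.1 ha ε hε
  refine ⟨_, hb, fun s => hεu ?_⟩
  rw [dist_eq_norm, ← mul_sub]
  rw [dist_eq_norm] at hab
  refine (norm_mul_le _ _).trans_lt (lt_of_le_of_lt ?_ hab)
  exact mul_le_of_le_one_left (norm_nonneg _) (v.norm_op_le s)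

section

variable {K : Type*} [TopologicalSpace K] [Group K] [IsTopologicalGroup K]
  [LocallyCompactSpace K] [MeasurableSpace K] [BorelSpace K]
  {E : Type*} [NormedAddCommGroup E] [NormedSpace ℂ E]

theorem integrable_smul_comp (f : C_c(K, ℂ)) {F : K → E} (hF : Continuous F) :
    Integrable (fun k => f k • F k) (Measure.haar : Measure K) :=
  (f.continuous.smul hF).integrable_of_hasCompactSupport f.hasCompactSupport.smul_right

/-- The map φ is unbundled so that the lemma applies directly to maps such as the evaluation of
operators at a vector. -/
theorem map_integral_smul_of_linear {E' : Type*} [NormedAddCommGroup E'] [NormedSpace ℂ E']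
    [CompleteSpace E] [CompleteSpace E'] (f : C_c(K, ℂ)) {F : K → E} (hF : Continuous F)
    {φ : E → E'} (hφ : Continuous φ) (hadd : ∀ x y, φ (x + y) = φ x + φ y)
    (hsmul : ∀ (c : ℂ) x, φ (c • x) = c • φ x) :
    φ (∫ k, f k • F k ∂(Measure.haar : Measure K))
      = ∫ k, f k • φ (F k) ∂(Measure.haar : Measure K) := by
  let Φ : E →L[ℂ] E' := { toFun := φ, map_add' := hadd, map_smul' := hsmul, cont := hφ }
  refine (Φ.integral_comp_comm (integrable_smul_comp f hF)).symm.trans ?_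
  exact integral_congr_ae (ae_of_all _ fun k => hsmul _ _)

end

/-! ### Group elements as multipliers of the reduced group C⋆-algebra -/

section Translation

variable {G : Type u} [Group G] [TopologicalSpace G] [IsTopologicalGroup G]
  [LocallyCompactSpace G] [MeasurableSpace G] [BorelSpace G]

/-- A shortcut for instance resolution. -/
instance : SMul ℂ (reducedCStar G) :=
  (inferInstance : NormedSpace ℂ (reducedCStar G)).toModule.toSMul

theorem isClosed_reducedCStar : IsClosed (reducedCStar G : Set (L2 G →L[ℂ] L2 G)) :=
  NonUnitalStarSubalgebra.isClosed_topologicalClosure _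

theorem integrated_mem_reducedCStar (f : C_c(G, ℂ)) :
    (regularRep G).integrated f ∈ reducedCStar G :=
  NonUnitalStarSubalgebra.le_topologicalClosure _
    (NonUnitalStarAlgebra.subset_adjoin _ _ ⟨f, rfl⟩)

variable [(Measure.haar : Measure G).IsInvInvariant]

/-- Both properties hold for λ(f), whose left translates are again of this form, and both survive
sums, products and norm limits. -/
theorem op_mul_mem_and_continuous (a : L2 G →L[ℂ] L2 G) (ha : a ∈ reducedCStar G) :
    (∀ s, (regularRep G).op s * a ∈ reducedCStar G) ∧
      Continuous fun s => (regularRep G).op s * a := by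
  let P : Set (L2 G →L[ℂ] L2 G) := {a | a ∈ reducedCStar G ∧
    (∀ s, (regularRep G).op s * a ∈ reducedCStar G) ∧
      Continuous fun s => (regularRep G).op s * a}
  have hP : IsClosed P := by
    have h1 : IsClosed (⋂ s, (fun a => (regularRep G).op s * a) ⁻¹'
        (reducedCStar G : Set (L2 G →L[ℂ] L2 G))) :=
      isClosed_iInter fun s => isClosed_reducedCStar.preimage (continuous_const_mul _)
    convert! isClosed_reducedCStar.inter
      (h1.inter (isClosed_setOf_continuous_op_mul (regularRep G))) using 1
    ext a
    exact ⟨fun h => ⟨h.1, Set.mem_iInter.2 h.2.1, h.2.2⟩,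
      fun h => ⟨h.1, Set.mem_iInter.1 h.2.1, h.2.2⟩⟩
  have hadd : ∀ {a b}, a ∈ P → b ∈ P → a + b ∈ P := fun ha hb =>
    ⟨add_mem ha.1 hb.1, fun s => by rw [mul_add]; exact add_mem (ha.2.1 s) (hb.2.1 s), by
      simp only [mul_add]; exact ha.2.2.add hb.2.2⟩
  have hsmul : ∀ (c : ℂ) {a}, a ∈ P → c • a ∈ P := fun c _ ha =>
    ⟨SMulMemClass.smul_mem c ha.1, fun s => by
      rw [mul_smul_comm]; exact SMulMemClass.smul_mem c (ha.2.1 s), by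
      simp only [mul_smul_comm]; exact ha.2.2.const_smul c⟩
  have hmul : ∀ {a b}, a ∈ P → b ∈ P → a * b ∈ P := fun ha hb =>
    ⟨mul_mem ha.1 hb.1, fun s => by rw [← mul_assoc]; exact mul_mem (ha.2.1 s) hb.1, by
      simp only [← mul_assoc]; exact ha.2.2.mul continuous_const⟩
  have hzero : (0 : L2 G →L[ℂ] L2 G) ∈ P :=
    ⟨zero_mem _, fun s => by rw [mul_zero]; exact zero_mem _, by
      simp only [mul_zero]; exact continuous_const⟩
  have hgen : ∀ f, (regularRep G).integrated f ∈ P := fun f =>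
    ⟨integrated_mem_reducedCStar f, fun s => by
      rw [UnitaryRep.op_mul_integrated]; exact integrated_mem_reducedCStar _,
      UnitaryRep.continuous_op_mul_integrated _ f⟩
  -- The conditions in P concern multiplication from the left, so P is not visibly closed under
  -- adjoints; P is intersected with its image under the adjoint. The generators lie in both, since
  -- λ(f)⋆ is again some λ(g).
  let S : NonUnitalStarSubalgebra ℂ (L2 G →L[ℂ] L2 G) :=
    { carrier := P ∩ star ⁻¹' P
      add_mem' := fun ha hb => ⟨hadd ha.1 hb.1, by
        rw [Set.mem_preimage, star_add]; exact hadd ha.2 hb.2⟩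
      zero_mem' := ⟨hzero, by rw [Set.mem_preimage, star_zero]; exact hzero⟩
      smul_mem' := fun c _ ha => ⟨hsmul c ha.1, by
        rw [Set.mem_preimage, star_smul]; exact hsmul _ ha.2⟩
      mul_mem' := fun ha hb => ⟨hmul ha.1 hb.1, by
        rw [Set.mem_preimage, star_mul]; exact hmul hb.2 ha.2⟩
      star_mem' := fun ha => ⟨ha.2, by rw [Set.mem_preimage, star_star]; exact ha.1⟩ }
  have hS : IsClosed (S : Set (L2 G →L[ℂ] L2 G)) := hP.inter (hP.preimage continuous_star)
  have hle : reducedCStar G ≤ S := by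
    refine NonUnitalStarSubalgebra.topologicalClosure_minimal _
      (NonUnitalStarAlgebra.adjoin_le ?_) hS
    rintro _ ⟨f, rfl⟩
    refine ⟨hgen f, ?_⟩
    obtain ⟨g, hg⟩ := (regularRep G).star_integrated f
    rw [Set.mem_preimage, hg]
    exact hgen g
  exact (hle ha).1.2

theorem op_mem_idealizer (s : G) : (regularRep G).op s ∈ idealizer (reducedCStar G) := by
  refine fun a ha => ⟨(op_mul_mem_and_continuous a ha).1 s, ?_⟩
  have h := star_mem ((op_mul_mem_and_continuous _ (star_mem ha)).1 s⁻¹)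
  rwa [star_mul, star_star, UnitaryRep.star_op, inv_inv] at h

/-- The multiplier `λ(s)` of the reduced group C⋆-algebra. -/
def groupMultiplier (s : G) : 𝓜(ℂ, reducedCStar G) :=
  toMultiplier (reducedCStar G) ⟨(regularRep G).op s, op_mem_idealizer s⟩

@[simp]
theorem coe_groupMultiplier_fst (s : G) (a : reducedCStar G) :
    (((groupMultiplier s).fst a : reducedCStar G) : L2 G →L[ℂ] L2 G)
      = (regularRep G).op s * a := rfl

@[simp]
theorem coe_groupMultiplier_snd (s : G) (a : reducedCStar G) :
    (((groupMultiplier s).snd a : reducedCStar G) : L2 G →L[ℂ] L2 G)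
      = a * (regularRep G).op s := rfl

theorem groupMultiplier_one : groupMultiplier (1 : G) = 1 := by
  refine DoubleCentralizer.ext _ _ _ _ <| Prod.ext
    (ContinuousLinearMap.ext fun a => Subtype.ext ?_)
    (ContinuousLinearMap.ext fun a => Subtype.ext ?_)
  · rw [coe_groupMultiplier_fst, UnitaryRep.op_one, one_mul]
    rfl
  · rw [coe_groupMultiplier_snd, UnitaryRep.op_one, mul_one]
    rfl

theorem groupMultiplier_mul (s t : G) :
    groupMultiplier (s * t) = groupMultiplier s * groupMultiplier t := by
  rw [groupMultiplier, groupMultiplier, groupMultiplier, ← map_mul]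
  congr 1
  exact Subtype.ext ((regularRep G).op_mul s t)

theorem star_groupMultiplier (s : G) : star (groupMultiplier s) = groupMultiplier s⁻¹ := by
  rw [groupMultiplier, groupMultiplier, ← map_star]
  congr 1
  exact Subtype.ext ((regularRep G).star_op s)

theorem norm_groupMultiplier_le (s : G) : ‖groupMultiplier s‖ ≤ 1 :=
  (norm_toMultiplier_le _ _).trans ((regularRep G).norm_op_le s)

theorem continuous_groupMultiplier_fst (a : reducedCStar G) :
    Continuous fun s => (groupMultiplier s).fst a :=
  Continuous.subtype_mk (op_mul_mem_and_continuous _ a.2).2 _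

theorem continuous_groupMultiplier_snd (a : reducedCStar G) :
    Continuous fun s => (groupMultiplier s).snd a := by
  have h := ((op_mul_mem_and_continuous _ (star_mem a.2)).2.comp continuous_inv).star
  refine Continuous.subtype_mk (h.congr fun s => ?_) _
  change star ((regularRep G).op s⁻¹ * star (a : L2 G →L[ℂ] L2 G)) = _
  rw [star_mul, star_star, UnitaryRep.star_op, inv_inv]

theorem continuous_groupMultiplier_strict :
    @Continuous _ _ _ (strictTopology (reducedCStar G)) (groupMultiplier (G := G)) :=
  continuous_strict_rng continuous_groupMultiplier_fst continuous_groupMultiplier_snd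

variable {K : Type*} [Group K] [TopologicalSpace K] [IsTopologicalGroup K]
  [LocallyCompactSpace K] [MeasurableSpace K] [BorelSpace K]

/-- The integral on the right is a Bochner integral in the closed algebra A, available because k ↦
λ(j k)a is norm continuous; hence the product lies in A. The homomorphism j covers the inclusion of
a subgroup and the identity of G at once. -/
theorem integrated_mul_eq (j : K →* G) (hj : Continuous j) (f : C_c(K, ℂ)) (a : reducedCStar G) :
    ((regularRep G).comap j hj).integrated f * (a : L2 G →L[ℂ] L2 G)
      = ((∫ k, f k • (groupMultiplier (j k)).fst a ∂(Measure.haar : Measure K) :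
          reducedCStar G) : L2 G →L[ℂ] L2 G) := by
  ext1 g
  exact (map_integral_smul_of_linear f ((continuous_groupMultiplier_fst a).comp hj)
    (φ := fun b : reducedCStar G => (b : L2 G →L[ℂ] L2 G) g)
    (continuous_subtype_val.clm_apply continuous_const) (fun _ _ => rfl) fun _ _ => rfl).symm

theorem mul_integrated_eq (j : K →* G) (hj : Continuous j) (f : C_c(K, ℂ)) (a : reducedCStar G) :
    (a : L2 G →L[ℂ] L2 G) * ((regularRep G).comap j hj).integrated f
      = ((∫ k, f k • (groupMultiplier (j k)).snd a ∂(Measure.haar : Measure K) :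
          reducedCStar G) : L2 G →L[ℂ] L2 G) := by
  ext1 g
  refine Eq.trans ?_ (map_integral_smul_of_linear f ((continuous_groupMultiplier_snd a).comp hj)
    (φ := fun b : reducedCStar G => (b : L2 G →L[ℂ] L2 G) g)
    (continuous_subtype_val.clm_apply continuous_const) (fun _ _ => rfl) fun _ _ => rfl).symm
  exact map_integral_smul_of_linear f (((regularRep G).comap j hj).continuous_apply g)
    (φ := fun x => (a : L2 G →L[ℂ] L2 G) x) (a : L2 G →L[ℂ] L2 G).continuous
    (fun _ _ => map_add _ _ _) fun _ _ => map_smul _ _ _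

theorem integrated_mem_idealizer (j : K →* G) (hj : Continuous j) (f : C_c(K, ℂ)) :
    ((regularRep G).comap j hj).integrated f ∈ idealizer (reducedCStar G) := by
  refine fun a ha => ⟨?_, ?_⟩
  · rw [integrated_mul_eq j hj f ⟨a, ha⟩]
    exact Subtype.property _
  · rw [mul_integrated_eq j hj f ⟨a, ha⟩]
    exact Subtype.property _

/-- The multiplier `∫ f(k) λ(j k) dk`. -/
def integratedMultiplier (j : K →* G) (hj : Continuous j) (f : C_c(K, ℂ)) :
    𝓜(ℂ, reducedCStar G) :=
  toMultiplier (reducedCStar G) ⟨_, integrated_mem_idealizer j hj f⟩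

theorem integratedMultiplier_fst (j : K →* G) (hj : Continuous j) (f : C_c(K, ℂ))
    (a : reducedCStar G) : (integratedMultiplier j hj f).fst a
      = ∫ k, f k • (groupMultiplier (j k)).fst a ∂(Measure.haar : Measure K) :=
  Subtype.ext (integrated_mul_eq j hj f a)

theorem integratedMultiplier_snd (j : K →* G) (hj : Continuous j) (f : C_c(K, ℂ))
    (a : reducedCStar G) : (integratedMultiplier j hj f).snd a
      = ∫ k, f k • (groupMultiplier (j k)).snd a ∂(Measure.haar : Measure K) :=
  Subtype.ext (mul_integrated_eq j hj f a)

end Translation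

/-! ### The conjugation representation of a bimodule over the reduced group C⋆-algebra -/

namespace HilbertBimodule

section Separation

variable {A : Type*} [NonUnitalCStarAlgebra A]
  {E : Type*} [NormedAddCommGroup E] [InnerProductSpace ℂ E] [CompleteSpace E]

theorem eq_of_forall_left_eq (X : HilbertBimodule A E) {x y : E}
    (h : ∀ a, X.left a x = X.left a y) : x = y := by
  suffices h' : innerSL ℂ x = innerSL ℂ y from innerSL_inj.1 h'
  apply ContinuousLinearMap.ext_on X.left_nondegenerate
  rintro _ ⟨b, η, rfl⟩
  have hb : ∀ z, inner ℂ z (X.left b η) = inner ℂ (X.left (star b) z) η := fun z => by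
    rw [map_star, ContinuousLinearMap.star_eq_adjoint, ContinuousLinearMap.adjoint_inner_left]
  change inner ℂ x (X.left b η) = inner ℂ y (X.left b η)
  rw [hb, hb, h]

theorem eq_of_forall_right_eq (X : HilbertBimodule A E) {x y : E}
    (h : ∀ a, (X.right a).unop x = (X.right a).unop y) : x = y := by
  suffices h' : innerSL ℂ x = innerSL ℂ y from innerSL_inj.1 h'
  apply ContinuousLinearMap.ext_on X.right_nondegenerate
  rintro _ ⟨b, η, rfl⟩
  have hb : ∀ z, inner ℂ z ((X.right b).unop η) = inner ℂ ((X.right (star b)).unop z) η :=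
    fun z => by
      rw [map_star, MulOpposite.unop_star, ContinuousLinearMap.star_eq_adjoint,
        ContinuousLinearMap.adjoint_inner_left]
  change inner ℂ x ((X.right b).unop η) = inner ℂ y ((X.right b).unop η)
  rw [hb, hb, h]

theorem star_leftMul (X : HilbertBimodule A E) (x : 𝓜(ℂ, A)) :
    star (X.leftMul x) = X.leftMul (star x) := (map_star X.leftMulHom x).symm

theorem star_rightMul (X : HilbertBimodule A E) (x : 𝓜(ℂ, A)) :
    star (X.rightMul x) = X.rightMul (star x) :=
  (congrArg MulOpposite.unop (map_star X.rightMulHom x)).symm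

theorem leftMul_add (X : HilbertBimodule A E) (x y : 𝓜(ℂ, A)) :
    X.leftMul (x + y) = X.leftMul x + X.leftMul y := map_add X.leftMulHom x y

theorem rightMul_add (X : HilbertBimodule A E) (x y : 𝓜(ℂ, A)) :
    X.rightMul (x + y) = X.rightMul x + X.rightMul y :=
  congrArg MulOpposite.unop (map_add X.rightMulHom x y)

theorem leftMul_sub (X : HilbertBimodule A E) (x y : 𝓜(ℂ, A)) :
    X.leftMul (x - y) = X.leftMul x - X.leftMul y := map_sub X.leftMulHom x y

theorem rightMul_sub (X : HilbertBimodule A E) (x y : 𝓜(ℂ, A)) :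
    X.rightMul (x - y) = X.rightMul x - X.rightMul y :=
  congrArg MulOpposite.unop (map_sub X.rightMulHom x y)

theorem leftMul_smul (X : HilbertBimodule A E) (c : ℂ) (x : 𝓜(ℂ, A)) :
    X.leftMul (c • x) = c • X.leftMul x := map_smul X.leftMulHom c x

theorem rightMul_smul (X : HilbertBimodule A E) (c : ℂ) (x : 𝓜(ℂ, A)) :
    X.rightMul (c • x) = c • X.rightMul x :=
  congrArg MulOpposite.unop (map_smul X.rightMulHom c x)

theorem leftMul_zero (X : HilbertBimodule A E) : X.leftMul 0 = 0 := map_zero X.leftMulHom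

theorem rightMul_zero (X : HilbertBimodule A E) : X.rightMul 0 = 0 :=
  congrArg MulOpposite.unop (map_zero X.rightMulHom)

end Separation

section Group

variable {G : Type u} [Group G] [TopologicalSpace G] [IsTopologicalGroup G]
  [LocallyCompactSpace G] [MeasurableSpace G] [BorelSpace G]
  [(Measure.haar : Measure G).IsInvInvariant]
  {E : Type*} [NormedAddCommGroup E] [InnerProductSpace ℂ E] [CompleteSpace E]
  (X : HilbertBimodule (reducedCStar G) E)

/-- The operator `ξ ↦ λ(s) · ξ`. -/
def groupLeft (s : G) : E →L[ℂ] E := X.leftMul (groupMultiplier s)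

/-- The operator `ξ ↦ ξ · λ(s)`. -/
def groupRight (s : G) : E →L[ℂ] E := X.rightMul (groupMultiplier s)

theorem groupLeft_one : X.groupLeft 1 = 1 := by
  rw [groupLeft, groupMultiplier_one, leftMul_one]

theorem groupRight_one : X.groupRight 1 = 1 := by
  rw [groupRight, groupMultiplier_one, rightMul_one]

theorem groupLeft_mul (s t : G) (ξ : E) :
    X.groupLeft (s * t) ξ = X.groupLeft s (X.groupLeft t ξ) := by
  rw [groupLeft, groupMultiplier_mul, leftMul_mul]
  rfl

theorem groupRight_mul (s t : G) (ξ : E) :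
    X.groupRight (s * t) ξ = X.groupRight t (X.groupRight s ξ) := by
  rw [groupRight, groupMultiplier_mul, rightMul_mul]
  rfl

theorem groupLeft_groupRight (s t : G) (ξ : E) :
    X.groupLeft s (X.groupRight t ξ) = X.groupRight t (X.groupLeft s ξ) :=
  X.leftMul_rightMul_comm _ _ ξ

theorem norm_groupLeft_le (s : G) : ‖X.groupLeft s‖ ≤ 1 :=
  (X.norm_leftMul_le _).trans (norm_groupMultiplier_le s)

theorem norm_groupRight_le (s : G) : ‖X.groupRight s‖ ≤ 1 :=
  (X.norm_rightMul_le _).trans (norm_groupMultiplier_le s)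

theorem norm_groupLeft_apply_le (s : G) (ξ : E) : ‖X.groupLeft s ξ‖ ≤ ‖ξ‖ :=
  (ContinuousLinearMap.le_of_opNorm_le _ (X.norm_groupLeft_le s) ξ).trans_eq (one_mul _)

theorem norm_groupRight_apply_le (s : G) (ξ : E) : ‖X.groupRight s ξ‖ ≤ ‖ξ‖ :=
  (ContinuousLinearMap.le_of_opNorm_le _ (X.norm_groupRight_le s) ξ).trans_eq (one_mul _)

theorem star_groupLeft (s : G) : star (X.groupLeft s) = X.groupLeft s⁻¹ := by
  rw [groupLeft, star_leftMul, star_groupMultiplier]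
  rfl

theorem star_groupRight (s : G) : star (X.groupRight s) = X.groupRight s⁻¹ := by
  rw [groupRight, star_rightMul, star_groupMultiplier]
  rfl

theorem continuous_groupLeft_apply (ξ : E) : Continuous fun s => X.groupLeft s ξ := by
  refine continuous_iff_continuousAt.2 fun s => ?_
  refine tendsto_apply_of_total (T := X.groupLeft) (S := X.groupLeft s) (c := 1)
    (Eventually.of_forall fun s => X.norm_groupLeft_le s) X.left_nondegenerate ?_ ξ
  rintro _ ⟨a, η, rfl⟩
  have h : ∀ s, X.groupLeft s (X.left a η) = X.left ((groupMultiplier s).fst a) η :=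
    fun s => X.leftMul_apply _ a η
  simp only [h]
  exact ((X.continuous_left.comp (continuous_groupMultiplier_fst a)).clm_apply
    continuous_const).tendsto s

theorem continuous_groupRight_apply (ξ : E) : Continuous fun s => X.groupRight s ξ := by
  refine continuous_iff_continuousAt.2 fun s => ?_
  refine tendsto_apply_of_total (T := X.groupRight) (S := X.groupRight s) (c := 1)
    (Eventually.of_forall fun s => X.norm_groupRight_le s) X.right_nondegenerate ?_ ξ
  rintro _ ⟨a, η, rfl⟩
  have h : ∀ s, X.groupRight s ((X.right a).unop η)
      = (X.right ((groupMultiplier s).snd a)).unop η := fun s => X.rightMul_apply _ a η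
  simp only [h]
  exact ((MulOpposite.continuous_unop.comp
    (X.continuous_right.comp (continuous_groupMultiplier_snd a))).clm_apply
    continuous_const).tendsto s

/-- The unitary representation `ξ ↦ λ(s) · ξ · λ(s⁻¹)` of `G` on a bimodule over `C⋆_r(G)`. -/
def conjRep : UnitaryRep G E :=
  UnitaryRep.ofContractions (fun s => X.groupLeft s * X.groupRight s⁻¹)
    (fun ξ => by simp [groupLeft_one, groupRight_one])
    (fun s t ξ => by
      simp only [mul_apply_eq_comp]
      rw [mul_inv_rev, groupLeft_mul, groupRight_mul, X.groupLeft_groupRight t])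
    (fun s ξ => (X.norm_groupLeft_apply_le _ _).trans (X.norm_groupRight_apply_le _ _))
    (fun ξ => by
      have h : ∀ s, (X.groupLeft s * X.groupRight s⁻¹) ξ
          = X.groupRight s⁻¹ (X.groupLeft s ξ) := fun s => X.groupLeft_groupRight _ _ _
      simp only [h]
      refine continuous_iff_continuousAt.2 fun s => ?_
      rw [ContinuousAt, tendsto_iff_norm_sub_tendsto_zero]
      have h1 := tendsto_iff_norm_sub_tendsto_zero.1 ((X.continuous_groupLeft_apply ξ).tendsto s)
      have h2 := tendsto_iff_norm_sub_tendsto_zero.1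
        (((X.continuous_groupRight_apply (X.groupLeft s ξ)).comp continuous_inv).tendsto s)
      refine squeeze_zero (fun _ => norm_nonneg _) (fun t => ?_) (by simpa using h1.add h2)
      calc ‖X.groupRight t⁻¹ (X.groupLeft t ξ) - X.groupRight s⁻¹ (X.groupLeft s ξ)‖
          = ‖X.groupRight t⁻¹ (X.groupLeft t ξ - X.groupLeft s ξ)
              + (X.groupRight t⁻¹ (X.groupLeft s ξ) - X.groupRight s⁻¹ (X.groupLeft s ξ))‖ := by
            rw [map_sub]; congr 1; abel
        _ ≤ _ := (norm_add_le _ _).trans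
            (add_le_add_left (X.norm_groupRight_apply_le _ _) _))

theorem conjRep_apply (s : G) (ξ : E) :
    X.conjRep.toHom s ξ = X.groupRight s⁻¹ (X.groupLeft s ξ) :=
  X.groupLeft_groupRight _ _ _

/-- Right multiplication by λ(s) is isometric; it turns the displacement under conjugation into a
commutator. -/
theorem norm_conjRep_sub (s : G) (ξ : E) :
    ‖X.conjRep.toHom s ξ - ξ‖ = ‖X.groupLeft s ξ - X.groupRight s ξ‖ := by
  have h1 : ∀ x, X.groupRight s⁻¹ (X.groupRight s x) = x := fun x => by
    rw [← groupRight_mul, mul_inv_cancel, groupRight_one]; rfl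
  have h2 : ∀ x, X.groupRight s (X.groupRight s⁻¹ x) = x := fun x => by
    rw [← groupRight_mul, inv_mul_cancel, groupRight_one]; rfl
  rw [conjRep_apply]
  refine le_antisymm ?_ ?_
  · have h := X.norm_groupRight_apply_le s⁻¹ (X.groupLeft s ξ - X.groupRight s ξ)
    rwa [map_sub, h1] at h
  · have h := X.norm_groupRight_apply_le s (X.groupRight s⁻¹ (X.groupLeft s ξ) - ξ)
    rwa [map_sub, h2] at h

theorem conjRep_eq_iff (s : G) (ξ : E) :
    X.conjRep.toHom s ξ = ξ ↔ X.groupLeft s ξ = X.groupRight s ξ := by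
  rw [← sub_eq_zero, ← norm_eq_zero, norm_conjRep_sub, norm_eq_zero, sub_eq_zero]

/-- Almost-`𝔎_A`-central nets are almost invariant under conjugation. -/
theorem isAlmostInvariant_of_isAlmostCentral {ι : Type*} [Preorder ι] {ξ : ι → E}
    (h : X.IsAlmostCentral ξ) : X.conjRep.IsAlmostInvariant ξ := by
  intro Q hQ ε hε
  -- The multipliers λ(s), s ∈ Q, form a strictly compact set, so they are admissible in the
  -- definition of almost centrality.
  have hL := @IsCompact.image _ _ _ (strictTopology (reducedCStar G)) _ _ hQ
    continuous_groupMultiplier_strict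
  filter_upwards [h _ hL ε hε] with i hi s hs
  rw [norm_conjRep_sub]
  exact hi _ ⟨s, hs, rfl⟩

theorem continuous_groupLeft_comp {K : Type*} [TopologicalSpace K] {j : K → G}
    (hj : Continuous j) (ξ : E) : Continuous fun k => X.groupLeft (j k) ξ :=
  (X.continuous_groupLeft_apply ξ).comp hj

theorem continuous_groupRight_comp {K : Type*} [TopologicalSpace K] {j : K → G}
    (hj : Continuous j) (ξ : E) : Continuous fun k => X.groupRight (j k) ξ :=
  (X.continuous_groupRight_apply ξ).comp hj

variable {K : Type*} [Group K] [TopologicalSpace K] [IsTopologicalGroup K]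
  [LocallyCompactSpace K] [MeasurableSpace K] [BorelSpace K]
  (j : K →* G) (hj : Continuous j)

/-- The action of A separates vectors, so it is enough to compare after applying a ∈ A. There the
multiplier is absorbed into a and the formula becomes a norm convergent integral in A, on which the
action is continuous. -/
theorem leftMul_integratedMultiplier (f : C_c(K, ℂ)) (ξ : E) :
    X.leftMul (integratedMultiplier j hj f) ξ
      = ∫ k, f k • X.groupLeft (j k) ξ ∂(Measure.haar : Measure K) := by
  refine X.eq_of_forall_left_eq fun a => ?_
  rw [map_integral_smul_of_linear f (X.continuous_groupLeft_comp hj ξ)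
    (X.left a).continuous (fun _ _ => map_add _ _ _) (fun _ _ => map_smul _ _ _),
    ← mul_apply_eq_comp, left_mul_leftMul, integratedMultiplier_snd,
    map_integral_smul_of_linear f
    (F := fun k => (groupMultiplier (j k)).snd a) ((continuous_groupMultiplier_snd a).comp hj)
    (φ := fun b => X.left b ξ) (X.continuous_left.clm_apply continuous_const)
    (fun _ _ => by rw [map_add]; rfl) (fun _ _ => by rw [map_smul]; rfl)]
  refine integral_congr_ae (ae_of_all _ fun k => ?_)
  dsimp only
  rw [← left_mul_leftMul]
  rfl

theorem rightMul_integratedMultiplier (f : C_c(K, ℂ)) (ξ : E) :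
    X.rightMul (integratedMultiplier j hj f) ξ
      = ∫ k, f k • X.groupRight (j k) ξ ∂(Measure.haar : Measure K) := by
  refine X.eq_of_forall_right_eq fun a => ?_
  rw [map_integral_smul_of_linear f (X.continuous_groupRight_comp hj ξ)
    ((X.right a).unop).continuous (fun _ _ => map_add _ _ _) (fun _ _ => map_smul _ _ _),
    ← mul_apply_eq_comp, right_mul_rightMul, integratedMultiplier_fst,
    map_integral_smul_of_linear f
    (F := fun k => (groupMultiplier (j k)).fst a) ((continuous_groupMultiplier_fst a).comp hj)
    (φ := fun b => (X.right b).unop ξ)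
    ((MulOpposite.continuous_unop.comp X.continuous_right).clm_apply continuous_const)
    (fun _ _ => by rw [map_add]; rfl) (fun _ _ => by rw [map_smul]; rfl)]
  refine integral_congr_ae (ae_of_all _ fun k => ?_)
  dsimp only
  rw [← right_mul_rightMul]
  rfl

/-- A vector is `λ(j k)`-central for all `k` if it is central for all `∫ f(k) λ(j k) dk`. -/
theorem groupLeft_eq_groupRight_of_integrated {ξ : E}
    (h : ∀ f : C_c(K, ℂ), X.leftMul (integratedMultiplier j hj f) ξ
      = X.rightMul (integratedMultiplier j hj f) ξ) (k : K) :
    X.groupLeft (j k) ξ = X.groupRight (j k) ξ := by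
  have hL := X.continuous_groupLeft_comp hj ξ
  have hR := X.continuous_groupRight_comp hj ξ
  refine sub_eq_zero.1 (eq_zero_of_forall_integral_smul_eq_zero
    (F := fun k => X.groupLeft (j k) ξ - X.groupRight (j k) ξ) (hL.sub hR) (fun f => ?_) k)
  simp only [smul_sub]
  rw [integral_sub (integrable_smul_comp f hL) (integrable_smul_comp f hR), sub_eq_zero]
  exact (X.leftMul_integratedMultiplier j hj f ξ).symm.trans
    ((h f).trans (X.rightMul_integratedMultiplier j hj f ξ))

/-- The multipliers that are asymptotically central for a bounded net. -/
def asymptoticallyCentral {A : Type*} [NonUnitalCStarAlgebra A] (X : HilbertBimodule A E)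
    {ι : Type*} (l : Filter ι) (ξ : ι → E) : NonUnitalStarSubalgebra ℂ 𝓜(ℂ, A) where
  carrier := {x | Tendsto (fun i => X.leftMul x (ξ i) - X.rightMul x (ξ i)) l (𝓝 0) ∧
    Tendsto (fun i => X.leftMul (star x) (ξ i) - X.rightMul (star x) (ξ i)) l (𝓝 0)}
  add_mem' {x y} hx hy := by
    have h : ∀ {x y}, Tendsto (fun i => X.leftMul x (ξ i) - X.rightMul x (ξ i)) l (𝓝 0) →
        Tendsto (fun i => X.leftMul y (ξ i) - X.rightMul y (ξ i)) l (𝓝 0) →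
        Tendsto (fun i => X.leftMul (x + y) (ξ i) - X.rightMul (x + y) (ξ i)) l (𝓝 0) := by
      intro x y hx hy
      refine (by simpa using hx.add hy : Tendsto _ l (𝓝 (0 : E))).congr fun i => ?_
      rw [leftMul_add, rightMul_add, _root_.add_apply, _root_.add_apply]
      abel
    exact ⟨h hx.1 hy.1, by rw [star_add]; exact h hx.2 hy.2⟩
  zero_mem' := by
    have h : Tendsto (fun i => X.leftMul 0 (ξ i) - X.rightMul 0 (ξ i)) l (𝓝 0) := by
      simpa [leftMul_zero, rightMul_zero] using tendsto_const_nhds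
    exact ⟨h, by rw [star_zero]; exact h⟩
  smul_mem' c x hx := by
    have h : ∀ (c : ℂ) {x}, Tendsto (fun i => X.leftMul x (ξ i) - X.rightMul x (ξ i)) l (𝓝 0) →
        Tendsto (fun i => X.leftMul (c • x) (ξ i) - X.rightMul (c • x) (ξ i)) l (𝓝 0) := by
      intro c x hx
      refine (by simpa using hx.const_smul c : Tendsto _ l (𝓝 (0 : E))).congr fun i => ?_
      rw [leftMul_smul, rightMul_smul, _root_.smul_apply, _root_.smul_apply, smul_sub]
    exact ⟨h c hx.1, by rw [star_smul]; exact h _ hx.2⟩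
  mul_mem' {x y} hx hy := by
    have h : ∀ {x y}, Tendsto (fun i => X.leftMul x (ξ i) - X.rightMul x (ξ i)) l (𝓝 0) →
        Tendsto (fun i => X.leftMul y (ξ i) - X.rightMul y (ξ i)) l (𝓝 0) →
        Tendsto (fun i => X.leftMul (x * y) (ξ i) - X.rightMul (x * y) (ξ i)) l (𝓝 0) := by
      intro x y hx hy
      -- The derivation identity xy·ξ - ξ·xy = x·(y·ξ - ξ·y) + (x·ξ - ξ·x)·y, whose mixed terms
      -- cancel because the two actions commute.
      have h1 := ((X.leftMul x).continuous.tendsto 0).comp hy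
      have h2 := ((X.rightMul y).continuous.tendsto 0).comp hx
      rw [map_zero] at h1 h2
      refine (by simpa using h1.add h2 : Tendsto _ l (𝓝 (0 : E))).congr fun i => ?_
      rw [leftMul_mul, rightMul_mul]
      simp only [mul_apply_eq_comp]
      rw [leftMul_rightMul_comm]
      abel
    exact ⟨h hx.1 hy.1, by rw [star_mul]; exact h hy.2 hx.2⟩
  star_mem' hx := ⟨hx.2, by simpa using hx.1⟩

theorem mem_asymptoticallyCentral {A : Type*} [NonUnitalCStarAlgebra A] {X : HilbertBimodule A E}
    {ι : Type*} {l : Filter ι} {ξ : ι → E} {x : 𝓜(ℂ, A)} :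
    x ∈ X.asymptoticallyCentral l ξ ↔
      Tendsto (fun i => X.leftMul x (ξ i) - X.rightMul x (ξ i)) l (𝓝 0) ∧
      Tendsto (fun i => X.leftMul (star x) (ξ i) - X.rightMul (star x) (ξ i)) l (𝓝 0) := Iff.rfl

theorem isClosed_asymptoticallyCentral {A : Type*} [NonUnitalCStarAlgebra A]
    (X : HilbertBimodule A E) {ι : Type*} (l : Filter ι) {ξ : ι → E} {c : ℝ}
    (hξ : ∀ i, ‖ξ i‖ ≤ c) :
    IsClosed (X.asymptoticallyCentral l ξ : Set 𝓜(ℂ, A)) := by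
  have h : IsClosed {x : 𝓜(ℂ, A) |
      Tendsto (fun i => X.leftMul x (ξ i) - X.rightMul x (ξ i)) l (𝓝 0)} := by
    refine isClosed_of_closure_subset fun x hx => ?_
    refine Metric.tendsto_nhds.2 fun ε hε => ?_
    obtain ⟨y, hy, hxy⟩ := Metric.mem_closure_iff.1 hx (ε / (4 * (|c| + 1))) (by positivity)
    rw [dist_eq_norm] at hxy
    filter_upwards [Metric.tendsto_nhds.1 hy (ε / 2) (by positivity)] with i hi
    rw [dist_zero_right] at hi ⊢
    have hc : ‖ξ i‖ ≤ |c| + 1 := (hξ i).trans ((le_abs_self c).trans (by linarith))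
    have h1 : ‖X.leftMul (x - y) (ξ i)‖ ≤ ‖x - y‖ * (|c| + 1) :=
      ((X.leftMul _).le_opNorm _).trans (by gcongr; exact X.norm_leftMul_le _)
    have h2 : ‖X.rightMul (x - y) (ξ i)‖ ≤ ‖x - y‖ * (|c| + 1) :=
      ((X.rightMul _).le_opNorm _).trans (by gcongr; exact X.norm_rightMul_le _)
    have h3 : ‖x - y‖ * (|c| + 1) < ε / 4 := by
      calc ‖x - y‖ * (|c| + 1) < ε / (4 * (|c| + 1)) * (|c| + 1) := by gcongr
        _ = ε / 4 := by field_simp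
    calc ‖X.leftMul x (ξ i) - X.rightMul x (ξ i)‖
        = ‖X.leftMul (x - y) (ξ i) + (X.leftMul y (ξ i) - X.rightMul y (ξ i))
            - X.rightMul (x - y) (ξ i)‖ := by
          congr 1
          rw [leftMul_sub, rightMul_sub, _root_.sub_apply, _root_.sub_apply]
          abel
      _ ≤ ‖X.leftMul (x - y) (ξ i)‖ + ‖X.leftMul y (ξ i) - X.rightMul y (ξ i)‖
            + ‖X.rightMul (x - y) (ξ i)‖ :=
          (norm_sub_le _ _).trans (by gcongr; exact norm_add_le _ _)
      _ < ε := by linarith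
  exact h.inter (h.preimage continuous_star)

/-- If `‖λ(j k) · ξ - ξ · λ(j k)‖ → 0` uniformly on compact sets, then the operators in the
C⋆-algebra generated by the `∫ f(k) λ(j k) dk` are asymptotically central. -/
theorem exists_mem_asymptoticallyCentral {ι : Type*} {l : Filter ι} {ξ : ι → E} {c : ℝ}
    (hξ : ∀ i, ‖ξ i‖ ≤ c)
    (h : ∀ Q : Set K, IsCompact Q → ∀ ε : ℝ, 0 < ε →
      ∀ᶠ i in l, ∀ k ∈ Q, ‖X.groupLeft (j k) (ξ i) - X.groupRight (j k) (ξ i)‖ ≤ ε)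
    {T : L2 G →L[ℂ] L2 G}
    (hT : T ∈ (NonUnitalStarAlgebra.adjoin ℂ (Set.range fun f : C_c(K, ℂ) =>
      ((regularRep G).comap j hj).integrated f)).topologicalClosure) :
    ∃ hT' : T ∈ idealizer (reducedCStar G),
      toMultiplier (reducedCStar G) ⟨T, hT'⟩ ∈ X.asymptoticallyCentral l ξ := by
  -- The good multipliers are pulled back to the idealizer and pushed forward to B(L²(G)). The
  -- idealizer is closed there, so the result is a closed ⋆-subalgebra and only the generators have
  -- to be checked.
  let S : NonUnitalStarSubalgebra ℂ (idealizer (reducedCStar G)) :=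
    (X.asymptoticallyCentral l ξ).comap (toMultiplier (reducedCStar G))
  let S' : NonUnitalStarSubalgebra ℂ (L2 G →L[ℂ] L2 G) :=
    S.map (NonUnitalStarSubalgebraClass.subtype (idealizer (reducedCStar G)))
  have hS : IsClosed (S : Set (idealizer (reducedCStar G))) :=
    (X.isClosed_asymptoticallyCentral l hξ).preimage (continuous_toMultiplier _)
  have hS' : IsClosed (S' : Set (L2 G →L[ℂ] L2 G)) :=
    (isClosed_idealizer (reducedCStar G)).isClosedEmbedding_subtypeVal.isClosedMap _ hS
  suffices hle : T ∈ S' by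
    obtain ⟨⟨T', hT'⟩, hmem, rfl⟩ := hle
    exact ⟨hT', hmem⟩
  refine NonUnitalStarSubalgebra.topologicalClosure_minimal _
    (NonUnitalStarAlgebra.adjoin_le ?_) hS' hT
  rintro _ ⟨f, rfl⟩
  refine ⟨⟨_, integrated_mem_idealizer j hj f⟩, ?_, rfl⟩
  change integratedMultiplier j hj f ∈ X.asymptoticallyCentral l ξ
  set I : ℝ := ∫ k, ‖f k‖ ∂(Measure.haar : Measure K) with hI
  have hI0 : 0 ≤ I := integral_nonneg fun _ => norm_nonneg _
  have hfi : Integrable (fun k => ‖f k‖) (Measure.haar : Measure K) :=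
    (f.continuous.norm.integrable_of_hasCompactSupport f.hasCompactSupport.norm)
  have hbound : ∀ {F : K → E} {δ : ℝ}, Continuous F → (∀ k ∈ tsupport f, ‖F k‖ ≤ δ) →
      ‖∫ k, f k • F k ∂(Measure.haar : Measure K)‖ ≤ I * δ := by
    intro F δ hF hδ
    rw [hI, ← integral_mul_const]
    refine norm_integral_le_of_norm_le (hfi.mul_const δ) (ae_of_all _ fun k => ?_)
    rw [norm_smul]
    by_cases hk : k ∈ tsupport f
    · exact mul_le_mul_of_nonneg_left (hδ k hk) (norm_nonneg _)
    · simp [image_eq_zero_of_notMem_tsupport hk]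
  refine mem_asymptoticallyCentral.2 ⟨Metric.tendsto_nhds.2 fun ε hε => ?_,
    Metric.tendsto_nhds.2 fun ε hε => ?_⟩
  · filter_upwards [h _ f.hasCompactSupport (ε / (2 * (I + 1))) (by positivity)] with i hi
    have hL := X.continuous_groupLeft_comp hj (ξ i)
    have hR := X.continuous_groupRight_comp hj (ξ i)
    rw [dist_zero_right, leftMul_integratedMultiplier, rightMul_integratedMultiplier,
      ← integral_sub (integrable_smul_comp f hL) (integrable_smul_comp f hR)]
    simp only [← smul_sub]
    refine (hbound (hL.sub hR) hi).trans_lt ?_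
    rw [mul_div_assoc', div_lt_iff₀ (by positivity)]
    nlinarith
  -- K need not be unimodular, so the adjoint of ∫ f(k) λ(j k) dk is not rewritten as an integral.
  -- It is estimated through inner products: moving λ(j k) to the other side inverts k, hence the
  -- inverse of the support.
  · filter_upwards [h _ f.hasCompactSupport.inv (ε / (2 * (I + 1))) (by positivity)] with i hi
    rw [dist_zero_right]
    set x := X.leftMul (star (integratedMultiplier j hj f)) (ξ i)
      - X.rightMul (star (integratedMultiplier j hj f)) (ξ i) with hx
    have key : ∀ y, ‖inner ℂ x y‖ ≤ I * (ε / (2 * (I + 1))) * ‖y‖ := by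
      intro y
      have hL := X.continuous_groupLeft_comp hj y
      have hR := X.continuous_groupRight_comp hj y
      have hsub : Integrable (fun k => f k • X.groupLeft (j k) y - f k • X.groupRight (j k) y)
          (Measure.haar : Measure K) :=
        (integrable_smul_comp f hL).sub (integrable_smul_comp f hR)
      have h1 : inner ℂ x y = ∫ k, f k • inner ℂ (ξ i)
          (X.groupLeft (j k) y - X.groupRight (j k) y) ∂(Measure.haar : Measure K) := by
        rw [hx, inner_sub_left, ← star_leftMul, ← star_rightMul,
          ContinuousLinearMap.star_eq_adjoint, ContinuousLinearMap.star_eq_adjoint,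
          ContinuousLinearMap.adjoint_inner_left, ContinuousLinearMap.adjoint_inner_left,
          ← inner_sub_right, leftMul_integratedMultiplier, rightMul_integratedMultiplier,
          ← integral_sub (integrable_smul_comp f hL) (integrable_smul_comp f hR),
          ← integral_inner hsub]
        refine integral_congr_ae (ae_of_all _ fun k => ?_)
        simp only [← smul_sub, inner_smul_right, smul_eq_mul]
      rw [h1, hI, mul_assoc, ← integral_mul_const]
      refine norm_integral_le_of_norm_le (hfi.mul_const _) (ae_of_all _ fun k => ?_)
      rw [norm_smul]
      by_cases hk : k ∈ tsupport f
      · refine mul_le_mul_of_nonneg_left ?_ (norm_nonneg _)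
        have h2 : inner ℂ (ξ i) (X.groupLeft (j k) y - X.groupRight (j k) y)
            = inner ℂ (X.groupLeft (j k⁻¹) (ξ i) - X.groupRight (j k⁻¹) (ξ i)) y := by
          rw [inner_sub_right, inner_sub_left, map_inv, ← star_groupLeft, ← star_groupRight,
            ContinuousLinearMap.star_eq_adjoint, ContinuousLinearMap.star_eq_adjoint,
            ContinuousLinearMap.adjoint_inner_left, ContinuousLinearMap.adjoint_inner_left]
        rw [h2]
        refine (norm_inner_le_norm _ _).trans (mul_le_mul_of_nonneg_right ?_ (norm_nonneg _))
        exact hi k⁻¹ (Set.inv_mem_inv.2 hk)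
      · simp [image_eq_zero_of_notMem_tsupport hk]
    have hxx : ‖x‖ ≤ I * (ε / (2 * (I + 1))) := by
      have h3 := key x
      rw [inner_self_eq_norm_sq_to_K, norm_pow, RCLike.norm_ofReal, abs_norm, sq] at h3
      rcases (norm_nonneg x).eq_or_lt with h4 | h4
      · rw [← h4]; positivity
      · exact le_of_mul_le_mul_right h3 h4
    refine hxx.trans_lt ?_
    rw [mul_div_assoc', div_lt_iff₀ (by positivity)]
    nlinarith

end Group

end HilbertBimodule

/-! ### Central vectors are invariant vectors -/

namespace HilbertBimodule

variable {G : Type u} [Group G] [TopologicalSpace G] [IsTopologicalGroup G]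
  [LocallyCompactSpace G] [MeasurableSpace G] [BorelSpace G]
  [(Measure.haar : Measure G).IsInvInvariant]
  {E : Type*} [NormedAddCommGroup E] [InnerProductSpace ℂ E] [CompleteSpace E]
  (X : HilbertBimodule (reducedCStar G) E)

/-- A vector invariant under `conjRep` commutes with the C⋆-algebra generated by the
`∫ f(k) λ(j k) dk`. -/
theorem leftMul_eq_rightMul_of_conjRep {K : Type*} [Group K] [TopologicalSpace K]
    [IsTopologicalGroup K] [LocallyCompactSpace K] [MeasurableSpace K] [BorelSpace K]
    (j : K →* G) (hj : Continuous j) {ξ : E} (hξ : ∀ k, X.conjRep.toHom (j k) ξ = ξ)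
    {T : L2 G →L[ℂ] L2 G}
    (hT : T ∈ (NonUnitalStarAlgebra.adjoin ℂ (Set.range fun f : C_c(K, ℂ) =>
      ((regularRep G).comap j hj).integrated f)).topologicalClosure) :
    ∃ hT' : T ∈ idealizer (reducedCStar G),
      X.leftMul (toMultiplier (reducedCStar G) ⟨T, hT'⟩) ξ
        = X.rightMul (toMultiplier (reducedCStar G) ⟨T, hT'⟩) ξ := by
  -- For the constant net on a one-point index set, asymptotic centrality is centrality.
  have h := X.exists_mem_asymptoticallyCentral (ι := Unit) (l := ⊤) (ξ := fun _ => ξ)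
    (c := ‖ξ‖) j hj (fun _ => le_rfl) (fun Q _ ε hε => Eventually.of_forall fun _ k _ => by
      rw [(X.conjRep_eq_iff _ _).1 (hξ k), sub_self, norm_zero]
      exact hε.le) hT
  exact h.imp fun _ h =>
    sub_eq_zero.1 (tendsto_nhds_unique tendsto_const_nhds (mem_asymptoticallyCentral.1 h).1)

/-- Centrality for all ∫ f(h) λ(h) dh recovers centrality for each λ(h) by continuity in h.
Conversely, commuting with each λ(h) passes to integrals and to the closed algebra they generate. -/
theorem mem_central_subgroupMultipliers (H : Subgroup G) [LocallyCompactSpace H] {ξ : E} :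
    ξ ∈ X.central (subgroupMultipliers H) ↔ ∀ h ∈ H, X.conjRep.toHom h ξ = ξ := by
  constructor
  · intro hξ h hh
    rw [conjRep_eq_iff]
    refine X.groupLeft_eq_groupRight_of_integrated (j := H.subtype) (hj := continuous_subtype_val)
      (fun f => hξ _ ⟨_, ?_, fun a => ⟨rfl, rfl⟩⟩) ⟨h, hh⟩
    exact NonUnitalStarSubalgebra.le_topologicalClosure _
      (NonUnitalStarAlgebra.subset_adjoin ℂ _ ⟨f, rfl⟩)
  · rintro hξ m ⟨T, hT, hm⟩
    obtain ⟨hT', h⟩ := X.leftMul_eq_rightMul_of_conjRep H.subtype continuous_subtype_val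
      (fun k => hξ k k.2) hT
    rwa [eq_toMultiplier (reducedCStar G) ⟨T, hT'⟩ hm]

theorem mem_central_range_coeHom {ξ : E} :
    ξ ∈ X.central (NonUnitalStarAlgHom.range
      (DoubleCentralizer.coeHom : reducedCStar G →⋆ₙₐ[ℂ] 𝓜(ℂ, reducedCStar G))) ↔
        ∀ s, X.conjRep.toHom s ξ = ξ := by
  constructor
  · intro hξ s
    rw [conjRep_eq_iff]
    refine X.groupLeft_eq_groupRight_of_integrated (j := MonoidHom.id G) (hj := continuous_id)
      (fun f => hξ _ ?_) s
    refine ⟨⟨_, integrated_mem_reducedCStar f⟩, ?_⟩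
    exact eq_toMultiplier (reducedCStar G) _ fun a => ⟨rfl, rfl⟩
  · rintro hξ _ ⟨a, rfl⟩
    refine (X.leftMul_eq_rightMul_of_conjRep (MonoidHom.id G) continuous_id
      hξ a.2).elim fun hT' h => ?_
    rwa [← eq_toMultiplier (reducedCStar G) ⟨_, hT'⟩
      (m := (DoubleCentralizer.coeHom a : 𝓜(ℂ, reducedCStar G))) fun a => ⟨rfl, rfl⟩] at h

/-- The converse passage, from almost invariance to asymptotic centrality, for single elements of A.
Uniformity on strictly compact sets needs more than this. -/
theorem tendsto_left_sub_right {ι : Type*} [Preorder ι] {ξ : ι → E} {c : ℝ}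
    (hξ : ∀ i, ‖ξ i‖ ≤ c) (h : X.conjRep.IsAlmostInvariant ξ) (a : reducedCStar G) :
    Tendsto (fun i => X.left a (ξ i) - (X.right a).unop (ξ i)) atTop (𝓝 0) := by
  obtain ⟨hT', h⟩ := X.exists_mem_asymptoticallyCentral (MonoidHom.id G) continuous_id hξ
    (l := atTop) (fun Q hQ ε hε => (h Q hQ ε hε).mono fun i hi s hs => by
      rw [MonoidHom.id_apply, ← norm_conjRep_sub]
      exact hi s hs) a.2
  rw [← eq_toMultiplier (reducedCStar G) ⟨_, hT'⟩
      (m := (a : 𝓜(ℂ, reducedCStar G))) fun a => ⟨rfl, rfl⟩] at h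
  simpa only [leftMul_coe, rightMul_coe] using (mem_asymptoticallyCentral.1 h).1

end HilbertBimodule

/-! ### Unimodularity of IN-groups -/

open scoped Pointwise in
/-- Locally compact IN-groups are unimodular. -/
theorem IsINGroup.isInvInvariant_haar {G : Type*} [Group G] [TopologicalSpace G]
    [IsTopologicalGroup G] [LocallyCompactSpace G] [T2Space G] [MeasurableSpace G] [BorelSpace G]
    (hG : IsINGroup G) : (Measure.haar : Measure G).IsInvInvariant := by
  obtain ⟨V, hVc, hV1, hV⟩ := hG
  set μ : Measure G := Measure.haar with hμ
  have hVm : MeasurableSet V := hVc.measurableSet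
  have hpos : μ V ≠ 0 := (Measure.measure_pos_of_mem_nhds μ hV1).ne'
  have hfin : μ V ≠ ∞ := hVc.measure_ne_top
  have hsmul : ∀ c d : NNReal, c • μ V = d • μ V → c = d := fun c d h => by
    rw [ENNReal.smul_def, ENNReal.smul_def, smul_eq_mul, smul_eq_mul,
      ENNReal.mul_left_inj hpos hfin] at h
    exact_mod_cast h
  -- A right translate of μ is left invariant, hence a multiple of μ. Conjugation invariance of V
  -- makes {x : x g ∈ V} equal to {x : g x ∈ V}, so the factor is 1.
  have hright : μ.IsMulRightInvariant := by
    refine ⟨fun g => ?_⟩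
    have : (μ.map (· * g)).Regular := Measure.Regular.map (Homeomorph.mulRight g)
    have h := Measure.isMulLeftInvariant_eq_smul_of_regular (μ.map (· * g)) μ
    suffices hc : Measure.haarScalarFactor (μ.map (· * g)) μ = 1 by rw [h, hc, one_smul]
    apply hsmul
    rw [← Measure.smul_apply, ← h, one_smul, Measure.map_apply (measurable_mul_const g) hVm]
    have : (· * g) ⁻¹' V = (g * ·) ⁻¹' V := by
      ext x
      refine ⟨fun hx => ?_, fun hx => ?_⟩
      · simpa [mul_assoc] using hV g _ hx
      · simpa [mul_assoc] using hV g⁻¹ _ hx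
    rw [this, measure_preimage_mul]
  -- Right invariance makes `μ.inv` left invariant, hence a multiple of μ; the factor is read off
  -- from the symmetric set V ∩ V⁻¹.
  refine ⟨?_⟩
  have h := Measure.isMulLeftInvariant_eq_smul_of_regular μ.inv μ
  suffices hc : Measure.haarScalarFactor μ.inv μ = 1 by rw [h, hc, one_smul]
  have hW : μ (V ∩ V⁻¹) ≠ 0 :=
    (Measure.measure_pos_of_mem_nhds μ (inter_mem hV1 (inv_mem_nhds_one G hV1))).ne'
  have hWfin : μ (V ∩ V⁻¹) ≠ ∞ := ((measure_mono Set.inter_subset_left).trans_lt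
    hVc.measure_lt_top).ne
  have h2 : μ.inv (V ∩ V⁻¹) = μ (V ∩ V⁻¹) := by
    rw [Measure.inv_apply, Set.inter_inv, inv_inv, Set.inter_comm]
  rw [h, Measure.smul_apply, ENNReal.smul_def, smul_eq_mul] at h2
  have h3 := (ENNReal.mul_eq_right hW hWfin).1 h2
  exact_mod_cast h3

/-! ### Invariant vectors, and almost invariant vectors in the case H = G -/

namespace UnitaryRep

variable {G : Type*} [Group G] [TopologicalSpace G]
  {E : Type*} [NormedAddCommGroup E] [InnerProductSpace ℂ E]

/-- The vectors invariant under a subgroup. -/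
def invariants (v : UnitaryRep G E) (H : Subgroup G) : Submodule ℂ E where
  carrier := {ξ | ∀ h ∈ H, v.toHom h ξ = ξ}
  add_mem' hx hy h hh := by rw [map_add, hx h hh, hy h hh]
  zero_mem' h _ := map_zero _
  smul_mem' c x hx h hh := by rw [map_smul, hx h hh]

theorem isClosed_invariants (v : UnitaryRep G E) (H : Subgroup G) :
    IsClosed (v.invariants H : Set E) := by
  have : (v.invariants H : Set E) = ⋂ h ∈ H, {ξ | v.toHom h ξ = ξ} := by
    ext ξ
    simp [invariants]
  rw [this]
  exact isClosed_biInter fun h _ => isClosed_eq (v.toHom h).continuous continuous_id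

instance [CompleteSpace E] (v : UnitaryRep G E) (H : Subgroup G) :
    (v.invariants H).HasOrthogonalProjection :=
  haveI : CompleteSpace (v.invariants H) := (v.isClosed_invariants H).completeSpace_coe
  inferInstance

theorem toHom_one_apply (v : UnitaryRep G E) (ξ : E) : v.toHom 1 ξ = ξ := by
  rw [map_one]
  rfl

theorem inv_toHom_apply (v : UnitaryRep G E) (g : G) (ξ : E) :
    v.toHom g⁻¹ (v.toHom g ξ) = ξ := by
  rw [← toHom_mul_apply, inv_mul_cancel, toHom_one_apply]

/-- The restriction of a unitary representation to an invariant subspace. -/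
def subrep (v : UnitaryRep G E) (S : Submodule ℂ E) (hS : ∀ g, ∀ ξ ∈ S, v.toHom g ξ ∈ S) :
    UnitaryRep G S :=
  ofContractions
    (fun g => ((v.op g).comp S.subtypeL).codRestrict S fun ξ => hS g ξ ξ.2)
    (fun ξ => Subtype.ext (v.toHom_one_apply ξ))
    (fun s t ξ => Subtype.ext (v.toHom_mul_apply s t ξ))
    (fun s ξ => ((v.toHom s).norm_map ξ).le)
    (fun ξ => (v.continuous_apply ξ).subtype_mk _)

/-- This uses that all of G fixes the invariant vectors. For a general subgroup the complement need
not be stable under G, so that case takes another route. -/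
theorem toHom_mem_orthogonal_invariants (v : UnitaryRep G E) (g : G) {ξ : E}
    (hξ : ξ ∈ (v.invariants ⊤)ᗮ) : v.toHom g ξ ∈ (v.invariants ⊤)ᗮ := by
  intro η hη
  rw [← inv_inv g, ← inner_toHom_left, hη _ (Subgroup.mem_top _)]
  exact hξ η hη

end UnitaryRep

/-- The elements of a directed set satisfying a frequent property form a directed set. -/
theorem isDirectedOrder_of_frequently {ι : Type*} [Preorder ι] [IsDirectedOrder ι] [Nonempty ι]
    {p : ι → Prop} (hp : ∃ᶠ i in atTop, p i) :
    IsDirectedOrder {i // p i} ∧ Nonempty {i // p i} ∧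
      Tendsto (Subtype.val : {i // p i} → ι) atTop atTop := by
  rw [frequently_atTop] at hp
  have hd : IsDirectedOrder {i // p i} := ⟨fun a b => by
    obtain ⟨c, hac, hbc⟩ := exists_ge_ge a.1 b.1
    obtain ⟨d, hcd, hd⟩ := hp c
    exact ⟨⟨d, hd⟩, hac.trans hcd, hbc.trans hcd⟩⟩
  obtain ⟨i, -, hi⟩ := hp (Classical.arbitrary ι)
  have hn : Nonempty {i // p i} := ⟨⟨i, hi⟩⟩
  refine ⟨hd, hn, tendsto_atTop_atTop.2 fun b => ?_⟩
  obtain ⟨c, hbc, hc⟩ := hp b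
  exact ⟨⟨c, hc⟩, fun d hd => hbc.trans hd⟩

/-- In a group with Property (T), almost invariant vectors are close to invariant vectors. -/
theorem GroupPropertyT.tendsto_sub_invariants {G : Type u} [Group G] [TopologicalSpace G]
    (hG : GroupPropertyT G) {E : Type u} [NormedAddCommGroup E] [InnerProductSpace ℂ E]
    [CompleteSpace E] (v : UnitaryRep G E) {ι : Type u} [Preorder ι] [IsDirectedOrder ι]
    [Nonempty ι] {ξ : ι → E} (hv : v.IsAlmostInvariant ξ) :
    Tendsto (fun i => ‖ξ i - (v.invariants ⊤).starProjection (ξ i)‖) atTop (𝓝 0) := by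
  by_contra hcon
  have hfr : ∃ δ > 0, ∃ᶠ i in atTop, δ ≤ ‖ξ i - (v.invariants ⊤).starProjection (ξ i)‖ := by
    by_contra! h
    refine hcon (Metric.tendsto_nhds.2 fun ε hε => ?_)
    filter_upwards [h ε hε] with i hi
    rwa [dist_zero_right, norm_norm]
  obtain ⟨δ, hδ, hfr⟩ := hfr
  set P := v.invariants ⊤ with hP
  obtain ⟨_, _, hlim⟩ := isDirectedOrder_of_frequently hfr
  let S := Pᗮ
  let w := v.subrep S fun g ξ hξ => v.toHom_mem_orthogonal_invariants g hξ
  -- Along indices where the distance stays at least δ, the components orthogonal to the invariant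
  -- vectors are normalised. The other component is fixed, so displacements grow by a factor of at
  -- most 1/δ and the η still form an almost invariant net. Property (T) then yields an invariant
  -- vector orthogonal to all invariant vectors.
  let η : {i // δ ≤ ‖ξ i - P.starProjection (ξ i)‖} → S := fun i =>
    ((‖ξ i.1 - P.starProjection (ξ i.1)‖ : ℂ)⁻¹) •
      ⟨ξ i.1 - P.starProjection (ξ i.1), P.sub_starProjection_mem_orthogonal _⟩
  obtain ⟨ζ, hζ0, hζ⟩ := hG S w _ η (fun i => by
    have h0 : ‖ξ i.1 - P.starProjection (ξ i.1)‖ ≠ 0 := (hδ.trans_le i.2).ne'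
    rw [norm_smul, norm_inv, Complex.norm_real, norm_norm]
    exact inv_mul_cancel₀ h0) (fun Q hQ ε hε => by
    filter_upwards [hlim.eventually (hv Q hQ (ε * δ) (by positivity))] with i hi s hs
    have h0 : 0 < ‖ξ i.1 - P.starProjection (ξ i.1)‖ := hδ.trans_le i.2
    have hPi : v.toHom s (P.starProjection (ξ i.1)) = P.starProjection (ξ i.1) :=
      P.starProjection_apply_mem (ξ i.1) s (Subgroup.mem_top _)
    rw [map_smul, ← smul_sub, norm_smul, norm_inv, Complex.norm_real, norm_norm]
    have h2 : ‖w.toHom s ⟨ξ i.1 - P.starProjection (ξ i.1),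
        P.sub_starProjection_mem_orthogonal _⟩ - ⟨ξ i.1 - P.starProjection (ξ i.1),
        P.sub_starProjection_mem_orthogonal _⟩‖ = ‖v.toHom s (ξ i.1) - ξ i.1‖ := by
      change ‖v.toHom s (ξ i.1 - P.starProjection (ξ i.1))
        - (ξ i.1 - P.starProjection (ξ i.1))‖ = _
      rw [map_sub, hPi]
      congr 1
      abel
    rw [h2, inv_mul_le_iff₀ h0]
    exact (hi s hs).trans (by rw [mul_comm]; gcongr; exact i.2))
  refine hζ0 (Subtype.ext ?_)
  have h1 : (ζ : E) ∈ P := fun h hh => congrArg Subtype.val (hζ h hh)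
  have := ζ.2 _ h1
  exact inner_self_eq_zero.1 this

/-! ### Positive semidefinite kernels -/

section Kernel

open scoped ComplexOrder

variable {X : Type*} {B : Type*} [NormedAddCommGroup B] [InnerProductSpace ℂ B]

theorem posSemidef_inner (b : X → B) :
    (Matrix.of fun x y => inner ℂ (b x) (b y)).PosSemidef := by
  refine ⟨Matrix.IsHermitian.ext fun x y => by simp, fun c => ?_⟩
  have h : (c.sum fun x cx => c.sum fun y cy => star cx * inner ℂ (b x) (b y) * cy)
      = inner ℂ (c.sum fun x cx => cx • b x) (c.sum fun y cy => cy • b y) := by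
    simp only [Finsupp.sum, sum_inner, inner_sum, inner_smul_left, inner_smul_right]
    simp only [Finset.mul_sum, RCLike.star_def]
    rw [Finset.sum_comm]
    refine Finset.sum_congr rfl fun x _ => Finset.sum_congr rfl fun y _ => ?_
    ring
  simp only [Matrix.of_apply]
  rw [h, inner_self_eq_norm_sq_to_K]
  simp

theorem posSemidef_mul_star (d : X → ℂ) :
    (Matrix.of fun x y => d x * star (d y)).PosSemidef := by
  have h := posSemidef_inner (X := X) (B := ℂ) fun x => star (d x)
  convert h using 2
  ext x y
  simp [mul_comm]

theorem posSemidef_of_tendsto {M : ℕ → Matrix X X ℂ} {N : Matrix X X ℂ}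
    (hM : ∀ n, (M n).PosSemidef) (h : ∀ x y, Tendsto (fun n => M n x y) atTop (𝓝 (N x y))) :
    N.PosSemidef := by
  refine ⟨Matrix.IsHermitian.ext fun x y => ?_, fun c => ?_⟩
  · refine tendsto_nhds_unique (((continuous_star.tendsto _).comp (h y x)).congr fun n => ?_)
      (h x y)
    exact (hM n).isHermitian.apply x y
  · refine ge_of_tendsto' (x := atTop) (f := fun n =>
      c.sum fun x cx => c.sum fun y cy => star cx * M n x y * cy) ?_ fun n => (hM n).2 c
    refine tendsto_finsetSum _ fun x _ => tendsto_finsetSum _ fun y _ => ?_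
    exact ((h x y).const_mul _).mul_const _

theorem posSemidef_pow {M : Matrix X X ℂ} (hM : M.PosSemidef) (n : ℕ) :
    (Matrix.of fun x y => M x y ^ n).PosSemidef := by
  induction n with
  | zero =>
    convert posSemidef_mul_star (X := X) (fun _ => 1) using 2
    simp
  | succ n ih =>
    exact ih.hadamard hM

/-- Entrywise powers are positive semidefinite by the Schur product theorem; the exponential series
has nonnegative coefficients. -/
theorem posSemidef_exp {M : Matrix X X ℂ} (hM : M.PosSemidef) :
    (Matrix.of fun x y => Complex.exp (M x y)).PosSemidef := by
  refine posSemidef_of_tendsto (M := fun n => ∑ k ∈ Finset.range n,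
    (((k.factorial : ℝ)⁻¹ : ℝ) : ℂ) • Matrix.of fun x y => M x y ^ k) (fun n => ?_) fun x y => ?_
  · refine Matrix.posSemidef_sum _ fun k _ => (posSemidef_pow hM k).smul ?_
    exact_mod_cast inv_nonneg.2 (Nat.cast_nonneg _)
  · have h := (NormedSpace.expSeries_div_hasSum_exp (M x y)).tendsto_sum_nat
    rw [← Complex.exp_eq_exp_ℂ] at h
    refine h.congr fun n => ?_
    rw [Matrix.sum_apply]
    refine Finset.sum_congr rfl fun k _ => ?_
    simp [div_eq_inv_mul]

/-- The Gaussian kernel of a Hilbert space valued map is positive semidefinite. -/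
theorem posSemidef_exp_neg_norm_sub_sq (b : X → B) :
    (Matrix.of fun x y => ((Real.exp (-‖b x - b y‖ ^ 2) : ℝ) : ℂ)).PosSemidef := by
  have h1 := posSemidef_inner b
  -- The Gaussian factors as exp(-‖b x‖²) exp(-‖b y‖²) exp(2 Re ⟨b x, b y⟩), and 2 Re ⟨b x, b y⟩ is
  -- the Gram matrix plus its transpose.
  have h2 := posSemidef_exp (h1.add h1.transpose)
  have h3 := (posSemidef_mul_star fun x => ((Real.exp (-‖b x‖ ^ 2) : ℝ) : ℂ)).hadamard h2
  refine Eq.subst (motive := Matrix.PosSemidef) (Matrix.ext fun x y => ?_) h3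
  symm
  simp only [Matrix.of_apply, Matrix.hadamard_apply, Matrix.add_apply, Matrix.transpose_apply,
    RCLike.star_def, Complex.conj_ofReal]
  have h4 : inner ℂ (b x) (b y) + inner ℂ (b y) (b x)
      = ((2 * RCLike.re (inner ℂ (b x) (b y)) : ℝ) : ℂ) := by
    rw [← inner_conj_symm (b y) (b x), Complex.add_conj]
    rfl
  rw [h4, ← Complex.ofReal_exp, ← Complex.ofReal_mul, ← Complex.ofReal_mul, ← Real.exp_add,
    ← Real.exp_add, @norm_sub_sq ℂ]
  congr 2
  ring

/-- Kolmogorov decomposition of a positive semidefinite kernel. -/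
theorem exists_inner_eq_of_posSemidef {X : Type u} {k : Matrix X X ℂ} (hk : k.PosSemidef) :
    ∃ (F : Type u) (_ : NormedAddCommGroup F) (_ : InnerProductSpace ℂ F) (_ : CompleteSpace F)
      (e : X → F), (∀ x y, inner ℂ (e x) (e y) = k x y) ∧
        Dense (Submodule.span ℂ (Set.range e) : Set F) := by
  -- The scalar kernel is read as one with values in the operators on ℂ; F is its reproducing kernel
  -- Hilbert space.
  let K : Matrix X X (ℂ →L[ℂ] ℂ) := Matrix.of fun x y => k x y • (1 : ℂ →L[ℂ] ℂ)
  have hK : K.PosSemidef := by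
    have htfae := (RKHS.posSemidef_tfae (K := K)).out 0 2
    refine htfae.2 ⟨?_, fun c => ?_⟩
    · refine Matrix.IsHermitian.ext fun x y => ?_
      simp only [K, Matrix.of_apply, star_smul, star_one, hk.isHermitian.apply]
    · have h := (Complex.nonneg_iff.1 (hk.2 c)).1
      refine h.trans_eq (congrArg Complex.re ?_)
      refine Finset.sum_congr rfl fun x _ => Finset.sum_congr rfl fun y _ => ?_
      have h2 := hk.isHermitian.apply x y
      dsimp only
      rw [← h2]
      simp [K]
      ring
  have : Fact K.PosSemidef := ⟨hK⟩
  refine ⟨RKHS.OfKernel K, inferInstance, inferInstance, inferInstance,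
    fun x => RKHS.kerFun (RKHS.OfKernel K) x 1, fun x y => ?_, ?_⟩
  · rw [← RKHS.kernel_inner, RKHS.OfKernel.kernel_ofKernel]
    have h := hk.isHermitian.apply x y
    simpa [K] using h
  · have h := RKHS.kerFun_dense (RKHS.OfKernel K)
    rw [← Submodule.dense_iff_topologicalClosure_eq_top] at h
    refine h.mono (Submodule.span_le.2 ?_)
    rintro _ ⟨x, c, rfl⟩
    have h2 : RKHS.kerFun (RKHS.OfKernel K) x c = c • RKHS.kerFun (RKHS.OfKernel K) x 1 := by
      rw [← map_smul, smul_eq_mul, mul_one]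
    rw [h2]
    exact Submodule.smul_mem _ _ (Submodule.subset_span ⟨x, rfl⟩)

/-- Two families of vectors with the same Gram matrix are related by an isometry. -/
theorem exists_clm_of_inner_eq {F F' : Type*} [NormedAddCommGroup F] [InnerProductSpace ℂ F]
    [NormedAddCommGroup F'] [InnerProductSpace ℂ F'] [CompleteSpace F'] {e : X → F} {e' : X → F'}
    (he : Dense (Submodule.span ℂ (Set.range e) : Set F))
    (h : ∀ x y, inner ℂ (e' x) (e' y) = inner ℂ (e x) (e y)) :
    ∃ T : F →L[ℂ] F', (∀ x, T (e x) = e' x) ∧ ∀ ζ, ‖T ζ‖ ≤ ‖ζ‖ := by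
  have hnorm : ∀ c : X →₀ ℂ, ‖Finsupp.linearCombination ℂ e' c‖
      = ‖Finsupp.linearCombination ℂ e c‖ := fun c => by
    have h2 : inner ℂ (Finsupp.linearCombination ℂ e' c) (Finsupp.linearCombination ℂ e' c)
        = inner ℂ (Finsupp.linearCombination ℂ e c) (Finsupp.linearCombination ℂ e c) := by
      simp only [Finsupp.linearCombination_apply, Finsupp.sum, sum_inner, inner_sum,
        inner_smul_left, inner_smul_right, h]
    rw [inner_self_eq_norm_sq_to_K, inner_self_eq_norm_sq_to_K] at h2
    have h3 : ‖Finsupp.linearCombination ℂ e' c‖ ^ 2 = ‖Finsupp.linearCombination ℂ e c‖ ^ 2 := by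
      exact_mod_cast h2
    exact (sq_eq_sq₀ (norm_nonneg _) (norm_nonneg _)).1 h3
  have hd : DenseRange (Finsupp.linearCombination ℂ e) := by
    rw [← Finsupp.range_linearCombination] at he
    exact he
  have hb : ∀ c : X →₀ ℂ, ‖Finsupp.linearCombination ℂ e' c‖
      ≤ 1 * ‖Finsupp.linearCombination ℂ e c‖ := fun c => by rw [one_mul, hnorm]
  refine ⟨(Finsupp.linearCombination ℂ e').extendOfNorm (Finsupp.linearCombination ℂ e),
    fun x => ?_, fun ζ => ?_⟩
  · have h4 := LinearMap.extendOfNorm_eq hd ⟨1, hb⟩ (Finsupp.single x 1)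
    simpa using h4
  · simpa using LinearMap.norm_extendOfNorm_apply_le hd 1 hb ζ

end Kernel

/-! ### Property (T) bounds Hilbert space valued maps with invariant distances -/

section Cocycle

open scoped ComplexOrder

/-- If `(G, H)` has Property (T), then `H` is bounded for every continuous left invariant kernel
`‖b x - b y‖` on `G` given by a Hilbert space valued map `b`. -/
theorem GroupPairPropertyT.exists_norm_le {G : Type u} [Group G] [TopologicalSpace G]
    [IsTopologicalGroup G] {H : Subgroup G} (hG : GroupPairPropertyT G H) {B : Type*}
    [NormedAddCommGroup B] [InnerProductSpace ℂ B] {b : G → B} (hb : Continuous b)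
    (hinv : ∀ g x y, ‖b (g * x) - b (g * y)‖ = ‖b x - b y‖) : ∃ C, ∀ h ∈ H, ‖b h‖ ≤ C := by
  -- The scaling yields the kernels exp(-‖b x - b y‖²/(n+1)). The identity matrix in the
  -- ℕ-coordinate makes different n orthogonal, so a single kernel encodes the direct sum over n of
  -- their representations.
  let b' : G × ℕ → B := fun p => ((Real.sqrt (p.2 + 1))⁻¹ : ℂ) • b p.1
  let k : Matrix (G × ℕ) (G × ℕ) ℂ :=
    (Matrix.of fun p q => ((Real.exp (-‖b' p - b' q‖ ^ 2) : ℝ) : ℂ)).hadamard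
      ((1 : Matrix ℕ ℕ ℂ).submatrix Prod.snd Prod.snd)
  have hk : k.PosSemidef :=
    (posSemidef_exp_neg_norm_sub_sq b').hadamard (Matrix.PosSemidef.one.submatrix Prod.snd)
  have hb' : ∀ (x y : G) (n : ℕ), ‖b' (x, n) - b' (y, n)‖ ^ 2 = ‖b x - b y‖ ^ 2 / (n + 1) := by
    intro x y n
    have h0 : (0 : ℝ) ≤ (n : ℝ) + 1 := by positivity
    simp only [b', ← smul_sub, norm_smul, norm_inv, Complex.norm_real, mul_pow, inv_pow,
      Real.norm_eq_abs, sq_abs, Real.sq_sqrt h0]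
    rw [inv_mul_eq_div]
  have hk1 : ∀ (x y : G) (n : ℕ),
      k (x, n) (y, n) = ((Real.exp (-(‖b x - b y‖ ^ 2 / (n + 1))) : ℝ) : ℂ) := by
    intro x y n
    simp only [k, Matrix.hadamard_apply, Matrix.of_apply, Matrix.submatrix_apply,
      Matrix.one_apply_eq, mul_one, hb']
  have hk2 : ∀ (x y : G) (n m : ℕ), n ≠ m → k (x, n) (y, m) = 0 := by
    intro x y n m h
    simp only [k, Matrix.hadamard_apply, Matrix.submatrix_apply, Matrix.one_apply_ne h, mul_zero]
  obtain ⟨F, _, _, _, e, he, hd⟩ := exists_inner_eq_of_posSemidef hk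
  have hgram : ∀ (g : G) (p q : G × ℕ),
      inner ℂ (e (g * p.1, p.2)) (e (g * q.1, q.2)) = inner ℂ (e p) (e q) := by
    rintro g ⟨x, n⟩ ⟨y, m⟩
    rw [he, he]
    rcases eq_or_ne n m with rfl | h
    · rw [hk1, hk1, hinv]
    · rw [hk2 _ _ _ _ h, hk2 _ _ _ _ h]
  have hone : ∀ p, ‖e p‖ = 1 := by
    rintro ⟨x, n⟩
    have h := he (x, n) (x, n)
    rw [hk1, inner_self_eq_norm_sq_to_K] at h
    simp only [sub_self, norm_zero] at h
    have h2 : ‖e (x, n)‖ ^ 2 = 1 := by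
      have : ((‖e (x, n)‖ ^ 2 : ℝ) : ℂ) = ((1 : ℝ) : ℂ) := by
        push_cast
        simpa using h
      exact_mod_cast this
    exact (pow_eq_one_iff_of_nonneg (norm_nonneg _) two_ne_zero).1 h2
  have hsub : ∀ (x y : G) (n : ℕ),
      ‖e (x, n) - e (y, n)‖ ^ 2 ≤ 2 * ‖b x - b y‖ ^ 2 / (n + 1) := by
    intro x y n
    rw [@norm_sub_sq ℂ, hone, hone, he, hk1]
    -- The squared distance is 2 - 2 exp(-t) with t = ‖b x - b y‖²/(n+1), and 1 - exp(-t) ≤ t.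
    have h := Real.add_one_le_exp (-(‖b x - b y‖ ^ 2 / (n + 1)))
    rw [RCLike.re_to_complex, Complex.ofReal_re, mul_div_assoc]
    linarith
  -- Left translation in the G-coordinate preserves the Gram matrix, so it is implemented by
  -- contractions; these will form the representation u.
  choose U hU hUn using fun g : G => exists_clm_of_inner_eq (e := e)
    (e' := fun p => e (g * p.1, p.2)) hd (hgram g)
  have hext : ∀ {S T : F →L[ℂ] F}, (∀ p, S (e p) = T (e p)) → S = T := by
    intro S T h
    refine ContinuousLinearMap.ext_on hd ?_
    rintro _ ⟨p, rfl⟩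
    exact h p
  have hcont : ∀ ζ, Continuous fun g => U g ζ := by
    refine fun ζ => continuous_iff_continuousAt.2 fun g => ?_
    refine tendsto_apply_of_total (c := 1) (Eventually.of_forall fun s =>
      ContinuousLinearMap.opNorm_le_bound _ zero_le_one fun ζ => by
        rw [one_mul]; exact hUn s ζ) hd ?_ ζ
    rintro _ ⟨⟨x, n⟩, rfl⟩
    simp only [hU]
    rw [tendsto_iff_norm_sub_tendsto_zero]
    have h1 : Tendsto (fun s => 2 * ‖b (s * x) - b (g * x)‖ ^ 2 / ((n : ℝ) + 1)) (𝓝 g) (𝓝 0) := by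
      have h2 : Continuous fun s => 2 * ‖b (s * x) - b (g * x)‖ ^ 2 / ((n : ℝ) + 1) := by
        fun_prop
      simpa using h2.tendsto g
    have h3 := (squeeze_zero (fun _ => by positivity) (fun s => hsub (s * x) (g * x) n) h1).sqrt
    simpa [Real.sqrt_sq] using h3
  let u : UnitaryRep G F := UnitaryRep.ofContractions U
    (fun ζ => by
      have h : U 1 = 1 := hext fun p => by rw [hU, one_mul]; rfl
      rw [h]; rfl)
    (fun s t ζ => by
      have h : U (s * t) = (U s).comp (U t) := hext fun p => by
        rw [ContinuousLinearMap.comp_apply, hU, hU, hU, mul_assoc]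
      rw [h]; rfl) hUn hcont
  by_contra! hcon
  -- The vectors e(1, n) are almost invariant: on Q their squared displacement is at most 2C²/(n+1).
  obtain ⟨ζ, hζ0, hζ⟩ := hG F u (ULift ℕ) (fun n => e (1, n.down)) (fun _ => hone _) (by
    intro Q hQ ε hε
    have hb1 : Continuous fun s => ‖b s - b 1‖ := by fun_prop
    obtain ⟨C, hC⟩ := (hQ.image hb1).bddAbove
    have hC0 : ∀ s ∈ Q, ‖b s - b 1‖ ≤ C := fun s hs => hC ⟨s, hs, rfl⟩
    obtain ⟨N, hN⟩ := exists_nat_gt (2 * C ^ 2 / ε ^ 2)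
    refine eventually_atTop.2 ⟨⟨N⟩, fun n hn s hs => ?_⟩
    change ‖U s (e (1, n.down)) - e (1, n.down)‖ ≤ ε
    rw [hU, mul_one]
    refine (sq_le_sq₀ (norm_nonneg _) hε.le).1 ((hsub s 1 n.down).trans ?_)
    have hn' : (N : ℝ) ≤ n.down := by exact_mod_cast hn
    rw [div_lt_iff₀ (by positivity)] at hN
    rw [div_le_iff₀ (by positivity)]
    have h1 : ‖b s - b 1‖ ^ 2 ≤ C ^ 2 := by
      gcongr
      exact hC0 s hs
    nlinarith [sq_nonneg ε])
  choose h hhH hh using fun n : ℕ => hcon n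
  have hbh : Tendsto (fun j => ‖b (h j)‖) atTop atTop :=
    tendsto_atTop_mono (fun n => (hh n).le) tendsto_natCast_atTop_atTop
  -- Since ‖b (h j)‖ → ∞, the matrix coefficients of u along h j tend to 0 on the total family e. An
  -- H-invariant vector has constant coefficients along h j, so it is orthogonal to every e p and
  -- vanishes.
  have hlim : ∀ p q : G × ℕ, Tendsto (fun j => inner ℂ (e (h j * p.1, p.2)) (e q)) atTop (𝓝 0) := by
    rintro ⟨x, n⟩ ⟨y, m⟩
    simp only [he]
    rcases eq_or_ne n m with rfl | hnm
    · simp only [hk1]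
      have h1 : Tendsto (fun j => ‖b (h j * x) - b y‖) atTop atTop := by
        refine tendsto_atTop_mono (fun j => ?_)
          (tendsto_atTop_add_const_right _ (-(‖b x - b 1‖ + ‖b y‖)) hbh)
        have h2 := hinv (h j) x 1
        rw [mul_one] at h2
        have h3 : ‖b (h j)‖ ≤ ‖b (h j * x) - b y‖ + ‖b y‖ + ‖b (h j * x) - b (h j)‖ := by
          calc ‖b (h j)‖ = ‖(b (h j * x) - b y) + b y - (b (h j * x) - b (h j))‖ := by
                congr 1; abel
            _ ≤ _ := (norm_sub_le _ _).trans (by gcongr; exact norm_add_le _ _)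
        linarith
      have h4 : Tendsto (fun j => Real.exp (-(‖b (h j * x) - b y‖ ^ 2 / (n + 1)))) atTop
          (𝓝 0) := by
        refine Real.tendsto_exp_atBot.comp (tendsto_neg_atTop_atBot.comp ?_)
        exact ((tendsto_pow_atTop two_ne_zero).comp h1).atTop_div_const (by positivity)
      have h5 := (Complex.continuous_ofReal.tendsto 0).comp h4
      rwa [Complex.ofReal_zero] at h5
    · simp only [hk2 _ _ _ _ hnm]
      exact tendsto_const_nhds
  have horth : ∀ p, inner ℂ (e p) ζ = 0 := by
    intro p
    have h1 : ∀ j, inner ℂ (e (h j * p.1, p.2)) ζ = inner ℂ (e p) ζ := fun j => by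
      have h2 : u.toHom (h j) (e p) = e (h j * p.1, p.2) := hU _ _
      rw [← h2]
      conv_lhs => rw [← hζ (h j) (hhH j)]
      exact LinearIsometryEquiv.inner_map_map _ _ _
    have h3 : Tendsto (fun j => (innerSL ℂ (e (h j * p.1, p.2))) ζ) atTop (𝓝 0) := by
      refine tendsto_apply_of_total (S := 0) (c := 1) (Eventually.of_forall fun j => ?_) hd ?_ ζ
      · rw [innerSL_apply_norm, hone]
      · rintro _ ⟨q, rfl⟩
        exact hlim p q
    exact tendsto_nhds_unique (tendsto_const_nhds.congr fun j => (h1 j).symm) h3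
  refine hζ0 ?_
  have h6 : innerSL ℂ ζ = 0 := by
    refine ContinuousLinearMap.ext_on hd ?_
    rintro _ ⟨p, rfl⟩
    change inner ℂ ζ (e p) = 0
    rw [← inner_conj_symm, horth, map_zero]
  have h7 : innerSL ℂ ζ ζ = 0 := by rw [h6]; rfl
  exact inner_self_eq_zero.1 h7

end Cocycle

/-! ### Small displacement under a subgroup gives a nearby invariant vector -/

section Circumcentre

variable {G : Type*} [Group G] [TopologicalSpace G]
  {E : Type*} [NormedAddCommGroup E] [InnerProductSpace ℂ E] [CompleteSpace E]

/-- A nonempty closed convex set in a Hilbert space has a vector determined by its norm. -/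
theorem exists_forall_norm_eq_imp_eq {F : Type*} [NormedAddCommGroup F] [InnerProductSpace ℝ F]
    [CompleteSpace F] {C : Set F} (hne : C.Nonempty) (hC : IsClosed C) (hconv : Convex ℝ C) :
    ∃ η ∈ C, ∀ ζ ∈ C, ‖ζ‖ = ‖η‖ → ζ = η := by
  -- The vector η is the point of C nearest to 0. A point of the same norm is also nearest, and the
  -- variational inequalities at the two points force them to agree.
  obtain ⟨η, hηC, hη⟩ := exists_norm_eq_iInf_of_complete_convex hne hC.isComplete hconv 0
  refine ⟨η, hηC, fun ζ hζC hζ => ?_⟩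
  have hζ' : ‖(0 : F) - ζ‖ = ⨅ w : C, ‖(0 : F) - w‖ := by
    rw [← hη, zero_sub, zero_sub, norm_neg, norm_neg, hζ]
  have h1 := (norm_eq_iInf_iff_real_inner_le_zero hconv hηC).1 hη ζ hζC
  have h2 := (norm_eq_iInf_iff_real_inner_le_zero hconv hζC).1 hζ' η hηC
  have h3 : inner ℝ (ζ - η) (ζ - η) ≤ 0 := by
    have h4 : inner ℝ (ζ - η) (ζ - η) = inner ℝ (0 - η) (ζ - η) + inner ℝ (0 - ζ) (η - ζ) := by
      rw [← neg_sub ζ η, inner_neg_right, ← sub_eq_add_neg, ← inner_sub_left]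
      congr 1
      abel
    linarith
  rw [real_inner_self_eq_norm_sq] at h3
  exact sub_eq_zero.1 (norm_eq_zero.1 (pow_eq_zero_iff two_ne_zero |>.1
    (le_antisymm h3 (sq_nonneg _))))

/-- If a subgroup moves `ξ` by at most `c`, then `ξ` has distance at most `c` to the vectors
invariant under the subgroup. -/
theorem UnitaryRep.norm_sub_invariants_le (v : UnitaryRep G E) {H : Subgroup G} {ξ : E} {c : ℝ}
    (hξ : ∀ h ∈ H, ‖v.toHom h ξ - ξ‖ ≤ c) :
    ‖ξ - (v.invariants H).starProjection ξ‖ ≤ c := by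
  let O : Set E := {η | ∃ h ∈ H, v.toHom h ξ = η}
  -- The closed convex hull of the orbit is H-stable and lies in the ball of radius c about ξ. Its
  -- element of least norm is unique, hence fixed by H.
  let C : Set E := closure (convexHull ℝ O)
  have hOC : O ⊆ C := (subset_convexHull ℝ O).trans subset_closure
  have hne : C.Nonempty := ⟨ξ, hOC ⟨1, H.one_mem, v.toHom_one_apply ξ⟩⟩
  have hconv : Convex ℝ C := (convex_convexHull ℝ O).closure
  have hball : C ⊆ Metric.closedBall ξ c := by
    refine closure_minimal (convexHull_min ?_ (convex_closedBall ξ c)) Metric.isClosed_closedBall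
    rintro _ ⟨h, hh, rfl⟩
    rw [Metric.mem_closedBall, dist_eq_norm]
    exact hξ h hh
  have hmaps : ∀ h ∈ H, ∀ η ∈ C, v.toHom h η ∈ C := by
    intro h hh
    have h1 : Set.MapsTo (v.toHom h) (convexHull ℝ O) (convexHull ℝ O) := by
      have h2 := ((v.toHom h).toLinearEquiv.toLinearMap.restrictScalars ℝ).image_convexHull O
      intro η hη
      have h3 : v.toHom h η ∈ convexHull ℝ (v.toHom h '' O) := by
        have h4 : v.toHom h η ∈ v.toHom h '' convexHull ℝ O := ⟨η, hη, rfl⟩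
        exact h2.subset h4
      refine convexHull_mono ?_ h3
      rintro _ ⟨_, ⟨k, hk, rfl⟩, rfl⟩
      exact ⟨h * k, H.mul_mem hh hk, v.toHom_mul_apply h k ξ⟩
    exact fun η hη => h1.closure (v.toHom h).continuous hη
  obtain ⟨η, hηC, huniq⟩ : ∃ η ∈ C, ∀ ζ ∈ C, ‖ζ‖ = ‖η‖ → ζ = η :=
    letI : InnerProductSpace ℝ E := InnerProductSpace.complexToReal
    exists_forall_norm_eq_imp_eq hne isClosed_closure hconv
  have hinv : η ∈ v.invariants H := fun h hh =>
    huniq _ (hmaps h hh η hηC) ((v.toHom h).norm_map η)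
  have h5 := hball hηC
  rw [Metric.mem_closedBall', dist_eq_norm] at h5
  refine le_trans ?_ h5
  rw [Submodule.starProjection_minimal]
  have hbdd : BddBelow (Set.range fun x : v.invariants H => ‖ξ - x‖) :=
    ⟨0, by rintro _ ⟨x, rfl⟩; exact norm_nonneg _⟩
  exact ciInf_le hbdd ⟨η, hinv⟩

end Circumcentre

/-! ### Almost invariant vectors are close to H-invariant ones when G is σ-compact -/

theorem lp.norm_congr {E : Type*} [NormedAddCommGroup E] {f g : lp (fun _ : ℕ => E) 2}
    (h : ∀ n, ‖f n‖ = ‖g n‖) : ‖f‖ = ‖g‖ := by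
  rw [lp.norm_eq_tsum_rpow (by simp), lp.norm_eq_tsum_rpow (by simp)]
  simp only [h]

/-- If `(G, H)` has Property (T) and `G` is `σ`-compact, then almost invariant vectors are close
to `H`-invariant vectors. -/
theorem GroupPairPropertyT.tendsto_sub_invariants {G : Type u} [Group G] [TopologicalSpace G]
    [IsTopologicalGroup G] [LocallyCompactSpace G] [SigmaCompactSpace G] {H : Subgroup G}
    (hG : GroupPairPropertyT G H) {E : Type u} [NormedAddCommGroup E] [InnerProductSpace ℂ E]
    [CompleteSpace E] (v : UnitaryRep G E) {ι : Type u} [Preorder ι] [IsDirectedOrder ι]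
    [Nonempty ι] {ξ : ι → E} (hξ : ∀ i, ‖ξ i‖ = 1) (hv : v.IsAlmostInvariant ξ) :
    Tendsto (fun i => ‖ξ i - (v.invariants H).starProjection (ξ i)‖) atTop (𝓝 0) := by
  by_contra hcon
  obtain ⟨δ, hδ, hfr⟩ : ∃ δ > 0, ∃ᶠ i in atTop,
      δ ≤ ‖ξ i - (v.invariants H).starProjection (ξ i)‖ := by
    by_contra! h
    refine hcon (Metric.tendsto_nhds.2 fun ε hε => ?_)
    filter_upwards [h ε hε] with i hi
    rwa [dist_zero_right, norm_norm]
  let K := CompactExhaustion.choice G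
  -- If all of H moved ξ i by at most δ/2, its distance to the H-invariant vectors would be at most
  -- δ/2, not at least δ. The rate (1/8)^n on K n leaves room for the weights 2^n below.
  have hex : ∀ n : ℕ, ∃ η : E, ‖η‖ = 1 ∧ (∀ s ∈ K n, ‖v.toHom s η - η‖ ≤ (1 / 8) ^ n) ∧
      ∃ h ∈ H, δ / 2 < ‖v.toHom h η - η‖ := by
    intro n
    obtain ⟨i, hi, hi'⟩ := (hfr.and_eventually
      (hv (K n) (K.isCompact n) ((1 / 8) ^ n) (by positivity))).exists
    refine ⟨ξ i, hξ i, hi', ?_⟩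
    by_contra! h
    have := v.norm_sub_invariants_le h
    linarith
  choose η hη1 hηK h hhH hh using hex
  -- One geometric majorant for all n: if m ≤ n the square is at most (2^n / 8^n)² = 16^(-n). If n ≤
  -- m only ‖v(g)η - η‖ ≤ 2 is used, and 4^n = 16^n 4^(-n) is paid for by the factor 16^m.
  have hterm : ∀ (m n : ℕ) (g : G), g ∈ K m →
      (2 ^ n * ‖v.toHom g (η n) - η n‖) ^ 2 ≤ 4 * 16 ^ m * (1 / 4) ^ n := by
    intro m n g hg
    rw [mul_pow, ← pow_mul, mul_comm n 2, pow_mul]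
    norm_num only
    have h16 : (4 : ℝ) ^ n = 16 ^ n * (1 / 4) ^ n := by
      rw [← mul_pow]; norm_num
    rcases le_total m n with hmn | hmn
    · have h1 := hηK n g (K.subset hmn hg)
      have h2 : ‖v.toHom g (η n) - η n‖ ^ 2 ≤ ((1 / 8) ^ n) ^ 2 := by gcongr
      have h3 : (4 : ℝ) ^ n * ((1 / 8) ^ n) ^ 2 = (1 / 16) ^ n := by
        rw [← pow_mul, mul_comm n 2, pow_mul, ← mul_pow]; norm_num
      have h4 : ((1 : ℝ) / 16) ^ n ≤ (1 / 4) ^ n := by gcongr; norm_num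
      have h5 : (1 : ℝ) ≤ 16 ^ m := one_le_pow₀ (by norm_num)
      have h6 : (0 : ℝ) < (1 / 4) ^ n := by positivity
      calc (4 : ℝ) ^ n * ‖v.toHom g (η n) - η n‖ ^ 2 ≤ 4 ^ n * ((1 / 8) ^ n) ^ 2 := by gcongr
        _ ≤ (1 / 4) ^ n := h3.trans_le h4
        _ ≤ _ := by nlinarith
    · have h1 : ‖v.toHom g (η n) - η n‖ ≤ 2 := by
        refine (norm_sub_le _ _).trans ?_
        rw [LinearIsometryEquiv.norm_map, hη1]
        norm_num
      have h2 : ‖v.toHom g (η n) - η n‖ ^ 2 ≤ 2 ^ 2 := by gcongr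
      have h3 : (16 : ℝ) ^ n ≤ 16 ^ m := by gcongr; norm_num
      calc (4 : ℝ) ^ n * ‖v.toHom g (η n) - η n‖ ^ 2 ≤ 16 ^ n * (1 / 4) ^ n * 2 ^ 2 := by
            rw [h16]; gcongr
        _ ≤ 16 ^ m * (1 / 4) ^ n * 2 ^ 2 := by gcongr
        _ = _ := by ring
  have hsum : ∀ m : ℕ, Summable fun n : ℕ => 4 * (16 : ℝ) ^ m * (1 / 4) ^ n := fun m =>
    (summable_geometric_of_lt_one (by norm_num) (by norm_num)).mul_left _
  have hnorm : ∀ (g g' : G) (n : ℕ),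
      ‖((2 : ℂ) ^ n) • (v.toHom g (η n) - η n) - ((2 : ℂ) ^ n) • (v.toHom g' (η n) - η n)‖
        = 2 ^ n * ‖v.toHom g (η n) - v.toHom g' (η n)‖ := fun g g' n => by
    rw [← smul_sub, sub_sub_sub_cancel_right, norm_smul, norm_pow, Complex.norm_ofNat]
  have hmem : ∀ g : G, Memℓp (fun n => ((2 : ℂ) ^ n) • (v.toHom g (η n) - η n)) 2 := by
    intro g
    obtain ⟨m, hm⟩ := K.exists_mem g
    refine memℓp_gen ?_
    refine (hsum m).of_nonneg_of_le (fun n => by positivity) fun n => ?_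
    have h1 := hterm m n g hm
    rw [norm_smul, norm_pow, Complex.norm_ofNat]
    simpa using h1
  -- The direct sum of the coboundaries of the η n with weights 2^n: summable because the η n are
  -- almost invariant, yet unbounded on H because h n moves η n by more than δ/2.
  let b : G → lp (fun _ : ℕ => E) 2 := fun g => ⟨_, hmem g⟩
  have hb1 : b 1 = 0 := by
    ext n
    change ((2 : ℂ) ^ n) • (v.toHom 1 (η n) - η n) = 0
    rw [UnitaryRep.toHom_one_apply, sub_self, smul_zero]
  have hinv : ∀ g x y, ‖b (g * x) - b (g * y)‖ = ‖b x - b y‖ := by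
    intro g x y
    refine lp.norm_congr fun n => (hnorm _ _ n).trans (Eq.trans ?_ (hnorm _ _ n).symm)
    rw [UnitaryRep.toHom_mul_apply, UnitaryRep.toHom_mul_apply, ← map_sub,
      LinearIsometryEquiv.norm_map]
  have hb0 : Tendsto (fun g => ‖b g‖ ^ 2) (𝓝 1) (𝓝 0) := by
    have h1 : ∀ g, ‖b g‖ ^ 2 = ∑' n, (2 ^ n * ‖v.toHom g (η n) - η n‖) ^ 2 := by
      intro g
      have h2 := lp.norm_rpow_eq_tsum (p := 2) (by simp) (b g)
      simp only [ENNReal.toReal_ofNat, Real.rpow_ofNat] at h2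
      rw [h2]
      refine tsum_congr fun n => ?_
      change ‖((2 : ℂ) ^ n) • (v.toHom g (η n) - η n)‖ ^ 2 = _
      rw [norm_smul, norm_pow, Complex.norm_ofNat]
    simp only [h1]
    -- On a neighbourhood of 1 inside K m the majorant does not depend on g, so dominated
    -- convergence gives continuity at 1. Invariance of distances carries it to every point.
    obtain ⟨m, hm⟩ := K.exists_mem_nhds (1 : G)
    have h3 := tendsto_tsum_of_dominated_convergence (𝓕 := 𝓝 (1 : G)) (hsum m)
      (f := fun g n => (2 ^ n * ‖v.toHom g (η n) - η n‖) ^ 2) (g := fun _ => 0)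
      (fun n => ?_) ?_
    · simpa using h3
    · have hc : Continuous fun g => (2 ^ n * ‖v.toHom g (η n) - η n‖) ^ 2 := by
        have := v.continuous_apply (η n)
        fun_prop
      have h4 := hc.tendsto 1
      rwa [UnitaryRep.toHom_one_apply, sub_self, norm_zero, mul_zero, zero_pow two_ne_zero] at h4
    · filter_upwards [hm] with g hg n
      rw [Real.norm_of_nonneg (by positivity)]
      exact hterm m n g hg
  have hb : Continuous b := by
    refine continuous_iff_continuousAt.2 fun x => ?_
    rw [ContinuousAt, tendsto_iff_norm_sub_tendsto_zero]
    have h1 : ∀ g, ‖b g - b x‖ = ‖b (x⁻¹ * g)‖ := fun g => by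
      have h2 := hinv x⁻¹ g x
      rw [inv_mul_cancel, hb1, sub_zero] at h2
      exact h2.symm
    simp only [h1]
    have h3 : Tendsto (fun g => x⁻¹ * g) (𝓝 x) (𝓝 1) := by
      have h4 : Continuous fun g => x⁻¹ * g := by fun_prop
      simpa using h4.tendsto x
    have h5 := (hb0.comp h3).sqrt
    simpa [Function.comp_def, Real.sqrt_sq] using h5
  obtain ⟨C, hC⟩ := hG.exists_norm_le hb hinv
  -- The n-th coordinate of b (h n) already has norm at least 2^n δ/2, which exceeds the bound C for
  -- large n.
  obtain ⟨n, hn⟩ := pow_unbounded_of_one_lt (C / (δ / 2)) (one_lt_two : (1 : ℝ) < 2)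
  have h1 : ‖b (h n) n‖ ≤ C := (lp.norm_apply_le_norm two_ne_zero (b (h n)) n).trans
    (hC _ (hhH n))
  have h2 : ‖b (h n) n‖ = 2 ^ n * ‖v.toHom (h n) (η n) - η n‖ := by
    change ‖((2 : ℂ) ^ n) • (v.toHom (h n) (η n) - η n)‖ = _
    rw [norm_smul, norm_pow, Complex.norm_ofNat]
  rw [div_lt_iff₀ (by positivity)] at hn
  have h3 : (2 : ℝ) ^ n * (δ / 2) ≤ 2 ^ n * ‖v.toHom (h n) (η n) - η n‖ := by
    gcongr
    exact (hh n).le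
  linarith

/-! ### Operators a ⊗ 1 on a Hilbert space tensor product -/

section Amplification

open scoped TensorProduct

variable {L E F : Type*} [NormedAddCommGroup L] [InnerProductSpace ℂ L]
  [NormedAddCommGroup E] [InnerProductSpace ℂ E] [NormedAddCommGroup F] [InnerProductSpace ℂ F]

/-- The completed tensor product is presented by an isometry T of dense range rather than as a fixed
completion, because L²(G, E) will carry two such presentations. -/
theorem clm_ext_tmul {F' : Type*} [NormedAddCommGroup F'] [NormedSpace ℂ F']
    {T : L ⊗[ℂ] E →ₗᵢ[ℂ] F} (hT : DenseRange T) {R S : F →L[ℂ] F'}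
    (h : ∀ g ξ, R (T (g ⊗ₜ ξ)) = S (T (g ⊗ₜ ξ))) : R = S := by
  have h1 : ∀ x, R (T x) = S (T x) := fun x => by
    induction x using TensorProduct.induction_on with
    | zero => simp
    | tmul g ξ => exact h g ξ
    | add x y hx hy => simp only [map_add, hx, hy]
  exact DFunLike.coe_injective (hT.equalizer R.continuous S.continuous (funext h1))

theorem continuous_tmul_right (T : L ⊗[ℂ] E →ₗᵢ[ℂ] F) (ξ : E) :
    Continuous fun g : L => T (g ⊗ₜ ξ) :=
  T.continuous.comp ((TensorProduct.mkL ℂ L E).flip ξ).continuous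

theorem dense_span_tmul {T : L ⊗[ℂ] E →ₗᵢ[ℂ] F} (hT : DenseRange T) :
    Dense (Submodule.span ℂ {η : F | ∃ g ξ, T (g ⊗ₜ ξ) = η} : Set F) := by
  refine Dense.mono (Set.range_subset_iff.2 fun x => ?_) hT
  induction x using TensorProduct.induction_on with
  | zero => simp
  | tmul g ξ => exact Submodule.subset_span ⟨g, ξ, rfl⟩
  | add x y hx hy => rw [map_add]; exact Submodule.add_mem _ hx hy

variable [CompleteSpace F]

/-- The operator `a ⊗ 1` on a Hilbert space tensor product `F` of `L` and `E`. -/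
def ampOp (T : L ⊗[ℂ] E →ₗᵢ[ℂ] F) (a : L →L[ℂ] L) : F →L[ℂ] F :=
  (T.toContinuousLinearMap.comp (a.rTensor E)).extend T.toContinuousLinearMap

theorem ampOp_tmul {T : L ⊗[ℂ] E →ₗᵢ[ℂ] F} (hT : DenseRange T) (a : L →L[ℂ] L) (g : L) (ξ : E) :
    ampOp T a (T (g ⊗ₜ ξ)) = T (a g ⊗ₜ ξ) :=
  (T.toContinuousLinearMap.comp (a.rTensor E)).extend_eq (e := T.toContinuousLinearMap) hT
    T.isometry.isUniformInducing (g ⊗ₜ ξ)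

theorem star_eq_of_inner_tmul {T : L ⊗[ℂ] E →ₗᵢ[ℂ] F} (hT : DenseRange T) {R S : F →L[ℂ] F}
    (h : ∀ g ξ g' ξ', inner ℂ (R (T (g ⊗ₜ ξ))) (T (g' ⊗ₜ ξ'))
      = inner ℂ (T (g ⊗ₜ ξ)) (S (T (g' ⊗ₜ ξ')))) : star R = S := by
  refine clm_ext_tmul hT fun g' ξ' => ?_
  refine ext_inner_left ℂ fun ζ => ?_
  rw [ContinuousLinearMap.star_eq_adjoint, ContinuousLinearMap.adjoint_inner_right]
  suffices h1 : (innerSL ℂ (T (g' ⊗ₜ ξ'))).comp R = innerSL ℂ (S (T (g' ⊗ₜ ξ'))) by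
    have h2 := congrArg (fun φ => starRingEnd ℂ (φ ζ)) h1
    simpa using h2
  refine clm_ext_tmul hT fun g ξ => ?_
  have h3 := congrArg (starRingEnd ℂ) (h g ξ g' ξ')
  simpa using h3

variable [CompleteSpace L]

/-- The amplification `a ↦ a ⊗ 1` to a Hilbert space tensor product. -/
def amp (T : L ⊗[ℂ] E →ₗᵢ[ℂ] F) (hT : DenseRange T) : (L →L[ℂ] L) →⋆ₙₐ[ℂ] (F →L[ℂ] F) where
  toFun := ampOp T
  map_smul' c a := clm_ext_tmul hT fun g ξ => by
    rw [ampOp_tmul hT, MonoidHom.id_apply, _root_.smul_apply, _root_.smul_apply, ampOp_tmul hT,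
      ← TensorProduct.smul_tmul', map_smul]
  map_zero' := clm_ext_tmul hT fun g ξ => by
    rw [ampOp_tmul hT, _root_.zero_apply, _root_.zero_apply, TensorProduct.zero_tmul, map_zero]
  map_add' a b := clm_ext_tmul hT fun g ξ => by
    rw [ampOp_tmul hT, _root_.add_apply, _root_.add_apply, ampOp_tmul hT, ampOp_tmul hT,
      ← map_add, TensorProduct.add_tmul]
  map_mul' a b := clm_ext_tmul hT fun g ξ => by
    rw [ampOp_tmul hT, mul_apply_eq_comp, mul_apply_eq_comp, ampOp_tmul hT, ampOp_tmul hT]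
  map_star' a := (star_eq_of_inner_tmul hT fun g ξ g' ξ' => by
    rw [ampOp_tmul hT, ampOp_tmul hT, T.inner_map_map, T.inner_map_map,
      TensorProduct.inner_tmul, TensorProduct.inner_tmul, ContinuousLinearMap.star_eq_adjoint,
      ContinuousLinearMap.adjoint_inner_right]).symm

theorem amp_tmul {T : L ⊗[ℂ] E →ₗᵢ[ℂ] F} (hT : DenseRange T) (a : L →L[ℂ] L) (g : L) (ξ : E) :
    amp T hT a (T (g ⊗ₜ ξ)) = T (a g ⊗ₜ ξ) := ampOp_tmul hT a g ξ

theorem amp_one {T : L ⊗[ℂ] E →ₗᵢ[ℂ] F} (hT : DenseRange T) : amp T hT 1 = 1 :=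
  clm_ext_tmul hT fun g ξ => by rw [amp_tmul]; rfl

/-- Amplifications of nondegenerate families of operators are nondegenerate. -/
theorem dense_span_amp {T : L ⊗[ℂ] E →ₗᵢ[ℂ] F} (hT : DenseRange T) {I : Type*}
    (S : I → L →L[ℂ] L)
    (hS : Dense (Submodule.span ℂ {η : L | ∃ a ξ, S a ξ = η} : Set L)) :
    Dense (Submodule.span ℂ {η : F | ∃ a ξ, amp T hT (S a) ξ = η} : Set F) := by
  set M := (Submodule.span ℂ {η : F | ∃ a ξ, amp T hT (S a) ξ = η}).topologicalClosure with hM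
  have h1 : ∀ (ξ : E) (g : L), T (g ⊗ₜ ξ) ∈ M := by
    intro ξ
    let φ : L →ₗ[ℂ] F := T.toLinearMap.comp ((TensorProduct.mk ℂ L E).flip ξ)
    have hφ : Continuous φ := continuous_tmul_right T ξ
    have hcl : IsClosed ((M.comap φ : Submodule ℂ L) : Set L) :=
      (Submodule.isClosed_topologicalClosure _).preimage hφ
    have hle : Submodule.span ℂ {η : L | ∃ a ξ, S a ξ = η} ≤ M.comap φ := by
      refine Submodule.span_le.2 ?_
      rintro _ ⟨a, g, rfl⟩
      refine Submodule.le_topologicalClosure _ (Submodule.subset_span ⟨a, T (g ⊗ₜ ξ), ?_⟩)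
      exact amp_tmul hT _ _ _
    exact fun g => closure_minimal hle hcl (hS g)
  have h2 : ∀ x, T x ∈ M := fun x => by
    induction x using TensorProduct.induction_on with
    | zero => simp
    | tmul g ξ => exact h1 ξ g
    | add x y hx hy => rw [map_add]; exact M.add_mem hx hy
  intro ζ
  exact closure_minimal (Set.range_subset_iff.2 h2)
    (Submodule.isClosed_topologicalClosure _) (hT ζ)

end Amplification

/-! ### Continuous fields of unitaries on square integrable functions -/

section Fiberwise

variable {X : Type*} [TopologicalSpace X] [T2Space X] [MeasurableSpace X] [BorelSpace X]
  {μ : Measure X} [μ.Regular] {E : Type*} [NormedAddCommGroup E]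

/-- E need not be separable and X need not be σ-compact, so continuity alone does not give strong
measurability. On a set of finite measure, inner regularity leaves, up to a null set, a countable
union of compact sets, and f is strongly measurable on each. -/
theorem aestronglyMeasurable_indicator_of_continuous {s : Set X} (hs : MeasurableSet s)
    (hμs : μ s < ∞) {f : X → E} (hf : Continuous f) :
    AEStronglyMeasurable (s.indicator f) μ := by
  rw [aestronglyMeasurable_indicator_iff hs]
  have hex : ∀ n : ℕ, ∃ K ⊆ s, IsCompact K ∧ μ (s \ K) < (n + 1 : ℝ≥0∞)⁻¹ := fun n =>
    hs.exists_isCompact_sdiff_lt hμs.ne (by simp)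
  choose K hKs hK hμK using hex
  have hKm : ∀ n, MeasurableSet (K n) := fun n => (hK n).measurableSet
  have hae : s =ᵐ[μ] ⋃ n, K n := by
    refine (ae_le_set.2 ?_).antisymm (Set.iUnion_subset hKs).eventuallyLE
    refine le_antisymm (le_of_forall_gt fun ε hε => ?_) bot_le
    obtain ⟨n, hn⟩ := ENNReal.exists_inv_nat_lt hε.ne'
    have h1 : μ (s \ ⋃ n, K n) ≤ μ (s \ K n) :=
      measure_mono (Set.sdiff_subset_sdiff_right (Set.subset_iUnion K n))
    refine (h1.trans_lt (hμK n)).trans_le (le_trans ?_ hn.le)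
    exact ENNReal.inv_le_inv.2 le_self_add
  rw [Measure.restrict_congr_set hae, aestronglyMeasurable_iUnion_iff]
  exact fun n => hf.continuousOn.aestronglyMeasurable_of_isCompact (hK n) (hKm n)

variable [InnerProductSpace ℂ E] {U : X → E ≃ₗᵢ[ℂ] E}

/-- By approximation with simple functions of finite measure support: on each fibre with a nonzero
value y the function is the continuous x ↦ U x y, restricted to a set of finite measure. -/
theorem aestronglyMeasurable_fiberwise (hU : ∀ ξ, Continuous fun x => U x ξ) (f : Lp E 2 μ) :
    AEStronglyMeasurable (fun x => U x (f x)) μ := by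
  obtain ⟨fs, hfs, hlim⟩ := Lp.finStronglyMeasurable f two_ne_zero (by simp)
  refine aestronglyMeasurable_of_tendsto_ae atTop (f := fun n x => U x (fs n x)) (fun n => ?_)
    (ae_of_all _ fun x => ((U x).continuous.tendsto _).comp (hlim x))
  have h1 : (fun x => U x (fs n x)) = ∑ y ∈ (fs n).range,
      ((fs n) ⁻¹' {y}).indicator fun x => U x y := by
    ext x
    rw [Finset.sum_apply, Finset.sum_eq_single (fs n x)]
    · rw [Set.indicator_of_mem (by simp)]
    · intro y _ hy
      exact Set.indicator_of_notMem (fun h => hy h.symm) _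
    · intro h
      exact absurd ((fs n).mem_range_self x) h
  rw [h1]
  refine Finset.aestronglyMeasurable_sum _ fun y _ => ?_
  rcases eq_or_ne y 0 with rfl | hy
  · simpa using aestronglyMeasurable_const
  · refine aestronglyMeasurable_indicator_of_continuous ((fs n).measurableSet_fiber y)
      ((measure_mono fun x hx => ?_).trans_lt (hfs n)) (hU y)
    rw [Function.mem_support]
    exact (Set.mem_singleton_iff.1 hx).trans_ne hy

theorem memLp_fiberwise (hU : ∀ ξ, Continuous fun x => U x ξ) (f : Lp E 2 μ) :
    MemLp (fun x => U x (f x)) 2 μ :=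
  (Lp.memLp f).congr_norm (aestronglyMeasurable_fiberwise hU f)
    (ae_of_all _ fun x => ((U x).norm_map _).symm)

/-- The fibrewise action of a strongly continuous family of unitaries on square integrable
functions. -/
def fiberwise (U : X → E ≃ₗᵢ[ℂ] E) (hU : ∀ ξ, Continuous fun x => U x ξ) :
    Lp E 2 μ →ₗᵢ[ℂ] Lp E 2 μ where
  toFun f := (memLp_fiberwise hU f).toLp
  map_add' f g := by
    refine Lp.ext ?_
    filter_upwards [(memLp_fiberwise hU (f + g)).coeFn_toLp, Lp.coeFn_add f g,
      (memLp_fiberwise hU f).coeFn_toLp, (memLp_fiberwise hU g).coeFn_toLp,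
      Lp.coeFn_add (memLp_fiberwise hU f).toLp (memLp_fiberwise hU g).toLp] with x h1 h2 h3 h4 h5
    rw [h1, h2, h5, Pi.add_apply, Pi.add_apply, map_add, h3, h4]
  map_smul' c f := by
    refine Lp.ext ?_
    filter_upwards [(memLp_fiberwise hU (c • f)).coeFn_toLp, Lp.coeFn_smul c f,
      (memLp_fiberwise hU f).coeFn_toLp,
      Lp.coeFn_smul c (memLp_fiberwise hU f).toLp] with x h1 h2 h3 h4
    rw [RingHom.id_apply, h1, h2, h4, Pi.smul_apply, Pi.smul_apply, map_smul, h3]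
  norm_map' f := by
    change ‖(memLp_fiberwise hU f).toLp‖ = _
    rw [Lp.norm_toLp, Lp.norm_def]
    congr 1
    exact eLpNorm_congr_norm_ae (ae_of_all _ fun x => (U x).norm_map _)

theorem coeFn_fiberwise (hU : ∀ ξ, Continuous fun x => U x ξ) (f : Lp E 2 μ) :
    fiberwise U hU f =ᵐ[μ] fun x => U x (f x) := (memLp_fiberwise hU f).coeFn_toLp

theorem fiberwise_surjective (hU : ∀ ξ, Continuous fun x => U x ξ)
    (hU' : ∀ ξ, Continuous fun x => (U x).symm ξ) :
    Function.Surjective (fiberwise (μ := μ) U hU) := by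
  intro f
  refine ⟨fiberwise (fun x => (U x).symm) hU' f, Lp.ext ?_⟩
  filter_upwards [coeFn_fiberwise hU (fiberwise (fun x => (U x).symm) hU' f),
    coeFn_fiberwise hU' f] with x h1 h2
  rw [h1, h2, LinearIsometryEquiv.apply_symm_apply]

end Fiberwise

/-! ### L²(X, E) as a tensor product -/

section Tensor

open scoped TensorProduct

variable {X : Type*} [MeasurableSpace X] (μ : Measure X)
  (E : Type*) [NormedAddCommGroup E] [InnerProductSpace ℂ E]

/-- The bilinear map `(g, ξ) ↦ (x ↦ g x • ξ)`. -/
def lpTmulₗ : Lp ℂ 2 μ →ₗ[ℂ] E →ₗ[ℂ] Lp E 2 μ :=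
  ((ContinuousLinearMap.coeLM ℂ).comp
    (ContinuousLinearMap.compLpL₂ 2 μ
      (ContinuousLinearMap.lsmul ℂ ℂ : ℂ →L[ℂ] E →L[ℂ] E).flip).toLinearMap).flip

variable {μ E} in
theorem coeFn_lpTmulₗ (g : Lp ℂ 2 μ) (ξ : E) : lpTmulₗ μ E g ξ =ᵐ[μ] fun x => g x • ξ :=
  ContinuousLinearMap.coeFn_compLp _ _

/-- The isometry `L²(X) ⊗ E → L²(X, E)`. -/
def lpTensor : Lp ℂ 2 μ ⊗[ℂ] E →ₗᵢ[ℂ] Lp E 2 μ :=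
  (TensorProduct.lift (lpTmulₗ μ E)).isometryOfInner fun x y => by
    have h : ∀ (g h : Lp ℂ 2 μ) (ξ η : E),
        inner ℂ (lpTmulₗ μ E g ξ) (lpTmulₗ μ E h η) = inner ℂ g h * inner ℂ ξ η := by
      intro g h ξ η
      rw [L2.inner_def, L2.inner_def, ← integral_mul_const]
      refine integral_congr_ae ?_
      filter_upwards [coeFn_lpTmulₗ g ξ, coeFn_lpTmulₗ h η] with x h1 h2
      rw [h1, h2, inner_smul_left, inner_smul_right, RCLike.inner_apply]
      ring
    induction x using TensorProduct.induction_on with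
    | zero => simp
    | add x x' hx hx' => rw [map_add, inner_add_left, inner_add_left, hx, hx']
    | tmul g ξ =>
      induction y using TensorProduct.induction_on with
      | zero => simp
      | add y y' hy hy' => rw [map_add, inner_add_right, inner_add_right, hy, hy']
      | tmul h' η => simp [h]

variable {μ E}

theorem coeFn_lpTensor_tmul (g : Lp ℂ 2 μ) (ξ : E) :
    lpTensor μ E (g ⊗ₜ ξ) =ᵐ[μ] fun x => g x • ξ := coeFn_lpTmulₗ g ξ

theorem denseRange_lpTensor : DenseRange (lpTensor μ E) := by
  intro f
  refine Lp.induction (by simp) (fun f => f ∈ closure (Set.range (lpTensor μ E))) ?_ ?_ ?_ f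
  · intro c s hs hμs
    refine subset_closure ⟨indicatorConstLp 2 hs hμs.ne (1 : ℂ) ⊗ₜ c, Lp.ext ?_⟩
    rw [Lp.simpleFunc.coe_indicatorConst]
    filter_upwards [coeFn_lpTensor_tmul (indicatorConstLp 2 hs hμs.ne (1 : ℂ)) c,
      indicatorConstLp_coeFn (p := 2) (hs := hs) (hμs := hμs.ne) (c := (1 : ℂ)),
      indicatorConstLp_coeFn (p := 2) (hs := hs) (hμs := hμs.ne) (c := c)] with x h1 h2 h3
    rw [h1, h2, h3]
    by_cases hx : x ∈ s <;> simp [hx]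
  · intro f g hf hg _ h1 h2
    have h3 : closure (Set.range (lpTensor μ E))
        = ((LinearMap.range (lpTensor μ E).toLinearMap).topologicalClosure : Set (Lp E 2 μ)) := rfl
    rw [h3] at h1 h2 ⊢
    exact Submodule.add_mem _ h1 h2
  · exact isClosed_closure

end Tensor

/-! ### The commuting left and right actions on L²(G) -/

section Regular

open scoped TensorProduct

variable {G : Type u} [Group G] [TopologicalSpace G] [IsTopologicalGroup G]
  [LocallyCompactSpace G] [MeasurableSpace G] [BorelSpace G]

theorem coeFn_regularRep (s : G) (g : L2 G) :
    (regularRep G).toHom s g =ᵐ[Measure.haar] fun t => g (s⁻¹ * t) :=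
  DomMulAct.smul_Lp_ae_eq (DomMulAct.mk s⁻¹) g

theorem ae_mul_left (s : G) {p : G → Prop} (h : ∀ᵐ t ∂(Measure.haar : Measure G), p t) :
    ∀ᵐ t ∂(Measure.haar : Measure G), p (s * t) :=
  (measurePreserving_mul_left Measure.haar s).quasiMeasurePreserving.ae h

variable [(Measure.haar : Measure G).IsInvInvariant]

theorem ae_inv {p : G → Prop} (h : ∀ᵐ t ∂(Measure.haar : Measure G), p t) :
    ∀ᵐ t ∂(Measure.haar : Measure G), p t⁻¹ :=
  (Measure.measurePreserving_inv Measure.haar).quasiMeasurePreserving.ae h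

theorem ae_mul_right (s : G) {p : G → Prop} (h : ∀ᵐ t ∂(Measure.haar : Measure G), p t) :
    ∀ᵐ t ∂(Measure.haar : Measure G), p (t * s) := by
  have h1 := ae_inv (ae_mul_left s⁻¹ (ae_inv h))
  simpa using h1

variable (G) in
/-- The antiunitary involution `(J g)(t) = conj (g t⁻¹)` of `L²(G)`. -/
def modularConj : L2 G →L⋆[ℂ] L2 G :=
  (((starL ℂ : ℂ ≃L⋆[ℂ] ℂ) : ℂ →L⋆[ℂ] ℂ).compLpL 2 (Measure.haar : Measure G)).comp
    (Lp.compMeasurePreservingₗᵢ ℂ Inv.inv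
      (Measure.measurePreserving_inv (Measure.haar : Measure G))).toContinuousLinearMap

theorem coeFn_modularConj (g : L2 G) :
    modularConj G g =ᵐ[Measure.haar] fun t => star (g t⁻¹) := by
  have h1 := Lp.coeFn_compMeasurePreserving g
    (Measure.measurePreserving_inv (Measure.haar : Measure G))
  have h2 := ContinuousLinearMap.coeFn_compLpL (p := 2)
    (μ := (Measure.haar : Measure G)) ((starL ℂ : ℂ ≃L⋆[ℂ] ℂ) : ℂ →L⋆[ℂ] ℂ)
    (Lp.compMeasurePreserving Inv.inv
      (Measure.measurePreserving_inv (Measure.haar : Measure G)) g)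
  filter_upwards [h1, h2] with t h1 h2
  refine h2.trans ?_
  rw [h1]
  rfl

theorem modularConj_modularConj (g : L2 G) : modularConj G (modularConj G g) = g := by
  refine Lp.ext ?_
  filter_upwards [coeFn_modularConj (modularConj G g), ae_inv (coeFn_modularConj g)] with t h1 h2
  rw [h1, h2, star_star, inv_inv]

theorem inner_modularConj (f g : L2 G) :
    inner ℂ (modularConj G f) (modularConj G g) = inner ℂ g f := by
  rw [L2.inner_def, L2.inner_def, ← integral_inv_eq_self _ (Measure.haar : Measure G)]
  refine integral_congr_ae ?_
  filter_upwards [ae_inv (coeFn_modularConj f), ae_inv (coeFn_modularConj g)] with t h1 h2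
  rw [h1, h2, RCLike.inner_apply, RCLike.inner_apply, inv_inv, RCLike.star_def, RCLike.conj_conj,
    mul_comm]

theorem inner_modularConj_left (f g : L2 G) :
    inner ℂ (modularConj G f) g = inner ℂ (modularConj G g) f := by
  rw [← inner_modularConj, modularConj_modularConj]

theorem inner_modularConj_right (f g : L2 G) :
    inner ℂ f (modularConj G g) = inner ℂ g (modularConj G f) := by
  rw [← inner_modularConj, modularConj_modularConj]

/-- Conjugation of an operator with `modularConj`. -/
def conjOp (a : L2 G →L[ℂ] L2 G) : L2 G →L[ℂ] L2 G :=
  (modularConj G).comp (a.comp (modularConj G))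

theorem conjOp_apply (a : L2 G →L[ℂ] L2 G) (g : L2 G) :
    conjOp a g = modularConj G (a (modularConj G g)) := rfl

theorem conjOp_mul (a b : L2 G →L[ℂ] L2 G) : conjOp (a * b) = conjOp a * conjOp b := by
  ext1 g
  rw [mul_apply_eq_comp, conjOp_apply, conjOp_apply, conjOp_apply, modularConj_modularConj,
    mul_apply_eq_comp]

theorem star_conjOp (a : L2 G →L[ℂ] L2 G) : star (conjOp a) = conjOp (star a) := by
  refine ContinuousLinearMap.ext fun g => ext_inner_right ℂ fun f => ?_
  rw [ContinuousLinearMap.star_eq_adjoint, ContinuousLinearMap.adjoint_inner_left, conjOp_apply,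
    conjOp_apply, inner_modularConj_left, ContinuousLinearMap.star_eq_adjoint,
    ContinuousLinearMap.adjoint_inner_right, inner_modularConj_right]

theorem conjOp_conjOp (a : L2 G →L[ℂ] L2 G) : conjOp (conjOp a) = a := by
  ext1 g
  rw [conjOp_apply, conjOp_apply, modularConj_modularConj, modularConj_modularConj]

/-- The anti-representation `a ↦ J a⋆ J` of the operators on `L²(G)`. -/
def conjHom : (L2 G →L[ℂ] L2 G) →⋆ₙₐ[ℂ] (L2 G →L[ℂ] L2 G)ᵐᵒᵖ where
  toFun a := MulOpposite.op (conjOp (star a))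
  map_smul' c a := by
    rw [MonoidHom.id_apply, ← MulOpposite.op_smul]
    congr 1
    ext1 g
    rw [_root_.smul_apply, conjOp_apply, conjOp_apply, star_smul, _root_.smul_apply,
      ContinuousLinearMap.map_smulₛₗ]
    simp
  map_zero' := by
    rw [← MulOpposite.op_zero]
    congr 1
    ext1 g
    rw [conjOp_apply, star_zero, _root_.zero_apply, map_zero, _root_.zero_apply]
  map_add' a b := by
    rw [← MulOpposite.op_add]
    congr 1
    ext1 g
    rw [_root_.add_apply, conjOp_apply, conjOp_apply, conjOp_apply, star_add, _root_.add_apply,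
      map_add]
  map_mul' a b := by
    rw [star_mul, conjOp_mul, MulOpposite.op_mul]
  map_star' a := by
    rw [← MulOpposite.op_star, star_conjOp]

/-- `conjOp (λ s)` is the right translation `g ↦ g (· s)`. -/
theorem coeFn_conjOp_op (s : G) (g : L2 G) :
    conjOp ((regularRep G).op s) g =ᵐ[Measure.haar] fun t => g (t * s) := by
  filter_upwards [coeFn_modularConj ((regularRep G).op s (modularConj G g)),
    ae_inv (coeFn_regularRep s (modularConj G g)),
    ae_inv (ae_mul_left s⁻¹ (coeFn_modularConj g))] with t h1 h2 h3
  rw [conjOp_apply, h1]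
  change star (((regularRep G).toHom s (modularConj G g)) t⁻¹) = _
  rw [h2, h3, star_star]
  simp

/-- Left and right translations commute by associativity. -/
theorem op_mul_conjOp_op (s t : G) :
    (regularRep G).op t * conjOp ((regularRep G).op s)
      = conjOp ((regularRep G).op s) * (regularRep G).op t := by
  refine ContinuousLinearMap.ext fun g => Lp.ext ?_
  filter_upwards [coeFn_regularRep t (conjOp ((regularRep G).op s) g),
    ae_mul_left t⁻¹ (coeFn_conjOp_op s g), coeFn_conjOp_op s ((regularRep G).op t g),
    ae_mul_right s (coeFn_regularRep t g)] with x h1 h2 h3 h4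
  rw [mul_apply_eq_comp, mul_apply_eq_comp, h3]
  change ((regularRep G).toHom t (conjOp ((regularRep G).op s) g)) x
    = ((regularRep G).toHom t g) (x * s)
  rw [h1, h2, h4, mul_assoc]

/-- The reduced group C⋆-algebra commutes with the right translations. -/
theorem mul_conjOp_op_of_mem {a : L2 G →L[ℂ] L2 G} (ha : a ∈ reducedCStar G) (s : G) :
    a * conjOp ((regularRep G).op s) = conjOp ((regularRep G).op s) * a := by
  let S : NonUnitalStarSubalgebra ℂ (L2 G →L[ℂ] L2 G) :=
    NonUnitalStarSubalgebra.centralizer ℂ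
      (Set.range fun s : G => conjOp ((regularRep G).op s))
  have hS : IsClosed (S : Set (L2 G →L[ℂ] L2 G)) := Set.isClosed_centralizer _
  have hle : reducedCStar G ≤ S := by
    refine NonUnitalStarSubalgebra.topologicalClosure_minimal _
      (NonUnitalStarAlgebra.adjoin_le ?_) hS
    rintro _ ⟨f, rfl⟩
    have h1 : ∀ s : G, conjOp ((regularRep G).op s) * (regularRep G).integrated f
        = (regularRep G).integrated f * conjOp ((regularRep G).op s) := by
      intro s
      ext1 g
      rw [mul_apply_eq_comp, mul_apply_eq_comp, UnitaryRep.integrated_apply,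
        UnitaryRep.integrated_apply,
        map_integral_smul_of_linear f ((regularRep G).continuous_apply g)
          (conjOp ((regularRep G).op s)).continuous (fun _ _ => map_add _ _ _)
          fun _ _ => map_smul _ _ _]
      refine integral_congr_ae (ae_of_all _ fun t => ?_)
      have h2 := congrArg (fun b : L2 G →L[ℂ] L2 G => b g) (op_mul_conjOp_op s t)
      dsimp only
      rw [← UnitaryRep.op_apply, ← UnitaryRep.op_apply, ← mul_apply_eq_comp, ← h2]
      rfl
    refine (NonUnitalStarSubalgebra.mem_centralizer_iff ℂ).2 ?_
    rintro _ ⟨s, rfl⟩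
    dsimp only
    rw [star_conjOp, UnitaryRep.star_op]
    exact ⟨h1 s, h1 s⁻¹⟩
  exact (((NonUnitalStarSubalgebra.mem_centralizer_iff ℂ).1 (hle ha)) _ ⟨s, rfl⟩).1.symm

theorem op_mul_conjOp_of_mem {a : L2 G →L[ℂ] L2 G} (ha : a ∈ reducedCStar G) (s : G) :
    (regularRep G).op s * conjOp a = conjOp a * (regularRep G).op s := by
  have h := congrArg conjOp (mul_conjOp_op_of_mem ha s)
  rw [conjOp_mul, conjOp_mul, conjOp_conjOp] at h
  exact h.symm

/-- The operators in the reduced group C⋆-algebra act nondegenerately. -/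
theorem dense_span_reducedCStar :
    Dense (Submodule.span ℂ {η : L2 G | ∃ (a : reducedCStar G) (g : L2 G),
      (a : L2 G →L[ℂ] L2 G) g = η} : Set (L2 G)) := by
  rw [Submodule.dense_iff_topologicalClosure_eq_top, Submodule.topologicalClosure_eq_top_iff,
    Submodule.eq_bot_iff]
  intro η hη
  -- For η orthogonal to all λ(f)g, the continuous function s ↦ ⟨η, λ(s)g⟩ integrates to 0 against
  -- every f, so it vanishes, in particular at s = 1.
  have h0 : ∀ g, inner ℂ η g = 0 := by
    intro g
    have h1 := eq_zero_of_forall_integral_smul_eq_zero (G := G)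
      (F := fun s => inner ℂ η ((regularRep G).toHom s g))
      (continuous_const.inner ((regularRep G).continuous_apply g)) (fun f => ?_) 1
    · simpa using h1
    · simp only [smul_eq_mul]
      rw [← UnitaryRep.inner_integrated, ← inner_conj_symm]
      rw [hη _ (Submodule.subset_span ⟨⟨_, integrated_mem_reducedCStar f⟩, g, rfl⟩), map_zero]
  exact inner_self_eq_zero.1 (h0 η)

theorem dense_span_conjOp_reducedCStar :
    Dense (Submodule.span ℂ {η : L2 G | ∃ (a : reducedCStar G) (g : L2 G),
      conjOp (star (a : L2 G →L[ℂ] L2 G)) g = η} : Set (L2 G)) := by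
  rw [Submodule.dense_iff_topologicalClosure_eq_top, Submodule.topologicalClosure_eq_top_iff,
    Submodule.eq_bot_iff]
  intro η hη
  have h1 : ∀ (a : reducedCStar G) (g : L2 G),
      inner ℂ (modularConj G η) ((a : L2 G →L[ℂ] L2 G) g) = 0 := by
    intro a g
    have h2 := hη _ (Submodule.subset_span ⟨star a, modularConj G g, rfl⟩)
    rw [conjOp_apply, modularConj_modularConj, inner_modularConj_left] at h2
    simpa using h2
  have h3 : innerSL ℂ (modularConj G η) = 0 := by
    refine ContinuousLinearMap.ext_on dense_span_reducedCStar ?_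
    rintro _ ⟨a, g, rfl⟩
    exact h1 a g
  have h4 : modularConj G η = 0 := innerSL_inj.1 (h3.trans (map_zero _).symm)
  rw [← modularConj_modularConj η, h4, map_zero]

variable {E F : Type*} [NormedAddCommGroup E] [InnerProductSpace ℂ E]
  [NormedAddCommGroup F] [InnerProductSpace ℂ F] [CompleteSpace F]
  {T : L2 G ⊗[ℂ] E →ₗᵢ[ℂ] F} (hT : DenseRange T)

/-- The amplification `s ↦ λ(s) ⊗ 1` of the regular representation. -/
def ampRep : UnitaryRep G F :=
  UnitaryRep.ofContractions (fun s => amp T hT ((regularRep G).op s))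
    (fun ζ => by rw [UnitaryRep.op_one, amp_one]; rfl)
    (fun s t ζ => by rw [UnitaryRep.op_mul, map_mul]; rfl)
    (fun s ζ => (ContinuousLinearMap.le_of_opNorm_le _
      ((NonUnitalStarAlgHom.norm_apply_le (amp T hT) _).trans
        ((regularRep G).norm_op_le s)) ζ).trans_eq (one_mul _))
    (fun ζ => by
      refine continuous_iff_continuousAt.2 fun s => ?_
      refine tendsto_apply_of_total (c := 1) (Eventually.of_forall fun s =>
        (NonUnitalStarAlgHom.norm_apply_le (amp T hT) _).trans
          ((regularRep G).norm_op_le s)) (dense_span_tmul hT) ?_ ζ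
      rintro _ ⟨g, ξ, rfl⟩
      simp only [amp_tmul]
      exact ((continuous_tmul_right T ξ).comp ((regularRep G).continuous_apply g)).tendsto s)

theorem op_ampRep (s : G) : (ampRep hT).op s = amp T hT ((regularRep G).op s) := rfl

/-- Writing λ(f) ⊗ 1 as an integral of the operators λ(s) ⊗ 1 reduces commutation relations to
single group elements. -/
theorem amp_integrated (f : C_c(G, ℂ)) :
    amp T hT ((regularRep G).integrated f) = (ampRep hT).integrated f := by
  refine clm_ext_tmul hT fun g ξ => ?_
  rw [amp_tmul, UnitaryRep.integrated_apply, UnitaryRep.integrated_apply,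
    map_integral_smul_of_linear f ((regularRep G).continuous_apply g)
      (φ := fun k => T (k ⊗ₜ[ℂ] ξ)) (continuous_tmul_right T ξ)
      (fun _ _ => by rw [TensorProduct.add_tmul, map_add])
      fun _ _ => by rw [← TensorProduct.smul_tmul', map_smul]]
  refine integral_congr_ae (ae_of_all _ fun t => ?_)
  dsimp only
  rw [← UnitaryRep.op_apply, ← UnitaryRep.op_apply, op_ampRep, amp_tmul]

end Regular

/-! ### The bimodule attached to a unitary representation -/

section Bimodule

open scoped TensorProduct

variable {G : Type u} [Group G] [TopologicalSpace G] [IsTopologicalGroup G]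
  [LocallyCompactSpace G] [T2Space G] [MeasurableSpace G] [BorelSpace G]
  [(Measure.haar : Measure G).IsInvInvariant]
  {E : Type*} [NormedAddCommGroup E] [InnerProductSpace ℂ E] (v : UnitaryRep G E)

theorem UnitaryRep.continuous_inv_apply {G : Type*} [Group G] [TopologicalSpace G]
    [IsTopologicalGroup G] {E : Type*} [NormedAddCommGroup E] [InnerProductSpace ℂ E]
    (v : UnitaryRep G E) (ξ : E) : Continuous fun t : G => v.toHom t⁻¹ ξ :=
  (v.continuous_apply ξ).comp continuous_inv

/-- The isometry `L²(G) ⊗ E → L²(G, E)`, `g ⊗ ξ ↦ (t ↦ g t • v(t⁻¹) ξ)`. -/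
def twistedTensor : L2 G ⊗[ℂ] E →ₗᵢ[ℂ] Lp E 2 (Measure.haar : Measure G) :=
  (fiberwise (fun t => v.toHom t⁻¹) v.continuous_inv_apply).comp (lpTensor Measure.haar E)

theorem coeFn_twistedTensor_tmul (g : L2 G) (ξ : E) :
    twistedTensor v (g ⊗ₜ ξ) =ᵐ[Measure.haar] fun t => g t • v.toHom t⁻¹ ξ := by
  filter_upwards [coeFn_fiberwise v.continuous_inv_apply
    (lpTensor (Measure.haar : Measure G) E (g ⊗ₜ ξ)), coeFn_lpTensor_tmul g ξ] with t h1 h2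
  refine h1.trans ?_
  rw [h2, map_smul]

theorem denseRange_twistedTensor : DenseRange (twistedTensor v) := by
  suffices hsurj : Function.Surjective (fiberwise (μ := (Measure.haar : Measure G))
      (fun t => v.toHom t⁻¹) v.continuous_inv_apply) by
    exact hsurj.denseRange.comp (denseRange_lpTensor (μ := (Measure.haar : Measure G)) (E := E))
      (LinearIsometry.continuous _)
  refine fiberwise_surjective _ fun ξ => (v.continuous_apply ξ).congr fun t => ?_
  rw [LinearIsometryEquiv.eq_symm_apply, UnitaryRep.inv_toHom_apply]

variable [CompleteSpace E]

theorem coeFn_op_ampRep (s : G) (ζ : Lp E 2 (Measure.haar : Measure G)) :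
    (ampRep (denseRange_lpTensor (μ := (Measure.haar : Measure G)) (E := E))).op s ζ
      =ᵐ[Measure.haar] fun t => ζ (s⁻¹ * t) := by
  have hτ := measurePreserving_mul_left (Measure.haar : Measure G) s⁻¹
  have h : (ampRep (denseRange_lpTensor (μ := (Measure.haar : Measure G)) (E := E))).op s
      = (Lp.compMeasurePreservingₗᵢ ℂ (s⁻¹ * ·) hτ).toContinuousLinearMap := by
    refine clm_ext_tmul (T := lpTensor (Measure.haar : Measure G) E) denseRange_lpTensor fun g ξ => ?_
    rw [op_ampRep, amp_tmul]
    refine Lp.ext ?_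
    filter_upwards [coeFn_lpTensor_tmul ((regularRep G).op s g) ξ, coeFn_regularRep s g,
      ae_mul_left s⁻¹ (coeFn_lpTensor_tmul g ξ),
      Lp.coeFn_compMeasurePreserving (lpTensor (Measure.haar : Measure G) E (g ⊗ₜ ξ)) hτ]
      with t h1 h2 h3 h4
    rw [h1]
    refine Eq.trans ?_ h4.symm
    rw [Function.comp_apply, h3, ← h2]
    rfl
  rw [h]
  exact Lp.coeFn_compMeasurePreserving ζ hτ

/-- Fell's absorption principle. -/
theorem op_ampRep_twistedTensor (s : G) (g : L2 G) (ξ : E) :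
    (ampRep (denseRange_lpTensor (μ := (Measure.haar : Measure G)) (E := E))).op s
      (twistedTensor v (g ⊗ₜ ξ))
      = twistedTensor v ((regularRep G).op s g ⊗ₜ v.toHom s ξ) := by
  refine Lp.ext ?_
  filter_upwards [coeFn_op_ampRep s (twistedTensor v (g ⊗ₜ ξ)),
    ae_mul_left s⁻¹ (coeFn_twistedTensor_tmul v g ξ),
    coeFn_twistedTensor_tmul v ((regularRep G).op s g) (v.toHom s ξ),
    coeFn_regularRep s g] with t h1 h2 h3 h4
  -- At t the translated function carries v((s⁻¹t)⁻¹) = v(t⁻¹)v(s). Thus λ(s) ⊗ 1 in the plain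
  -- decomposition becomes λ(s) ⊗ v(s) in the twisted one.
  rw [h1, h2, h3, UnitaryRep.op_apply, h4, ← UnitaryRep.toHom_mul_apply, mul_inv_rev, inv_inv]

/-- By Fell absorption the left operator is λ(s) ⊗ v(s) in twisted coordinates; there JaJ ⊗ 1
commutes with it because λ(s) commutes with JaJ. -/
theorem commute_op_ampRep (s : G) {a : L2 G →L[ℂ] L2 G} (ha : a ∈ reducedCStar G) :
    (ampRep (denseRange_lpTensor (μ := (Measure.haar : Measure G)) (E := E))).op s
        * amp (twistedTensor v) (denseRange_twistedTensor v) (conjOp a)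
      = amp (twistedTensor v) (denseRange_twistedTensor v) (conjOp a)
        * (ampRep (denseRange_lpTensor (μ := (Measure.haar : Measure G)) (E := E))).op s := by
  refine clm_ext_tmul (denseRange_twistedTensor v) fun g ξ => ?_
  have h := congrArg (fun b : L2 G →L[ℂ] L2 G => b g) (op_mul_conjOp_of_mem ha s)
  rw [mul_apply_eq_comp, mul_apply_eq_comp, amp_tmul, op_ampRep_twistedTensor,
    op_ampRep_twistedTensor, amp_tmul, ← mul_apply_eq_comp, ← mul_apply_eq_comp]
  rw [h]

theorem commute_amp {a b : L2 G →L[ℂ] L2 G} (ha : a ∈ reducedCStar G) (hb : b ∈ reducedCStar G) :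
    amp (lpTensor (Measure.haar : Measure G) E) denseRange_lpTensor a
        * amp (twistedTensor v) (denseRange_twistedTensor v) (conjOp b)
      = amp (twistedTensor v) (denseRange_twistedTensor v) (conjOp b)
        * amp (lpTensor (Measure.haar : Measure G) E) denseRange_lpTensor a := by
  let S : NonUnitalStarSubalgebra ℂ (L2 G →L[ℂ] L2 G) :=
    (NonUnitalStarSubalgebra.centralizer ℂ
      {amp (twistedTensor v) (denseRange_twistedTensor v) (conjOp b)}).comap
        (amp (lpTensor (Measure.haar : Measure G) E) denseRange_lpTensor)
  have hcont : Continuous (amp (lpTensor (Measure.haar : Measure G) E) denseRange_lpTensor) :=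
    AddMonoidHomClass.continuous_of_bound _ 1
      fun y => by simpa using NonUnitalStarAlgHom.norm_apply_le _ y
  have hS : IsClosed (S : Set (L2 G →L[ℂ] L2 G)) := (Set.isClosed_centralizer _).preimage hcont
  have hint : ∀ (f : C_c(G, ℂ)) {c : L2 G →L[ℂ] L2 G}, c ∈ reducedCStar G →
      amp (twistedTensor v) (denseRange_twistedTensor v) (conjOp c)
        * amp (lpTensor (Measure.haar : Measure G) E) denseRange_lpTensor
          ((regularRep G).integrated f)
      = amp (lpTensor (Measure.haar : Measure G) E) denseRange_lpTensor
          ((regularRep G).integrated f)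
        * amp (twistedTensor v) (denseRange_twistedTensor v) (conjOp c) := by
    intro f c hc
    rw [amp_integrated]
    ext1 ζ
    rw [mul_apply_eq_comp, mul_apply_eq_comp, UnitaryRep.integrated_apply,
      UnitaryRep.integrated_apply, map_integral_smul_of_linear f
        (UnitaryRep.continuous_apply _ ζ) (ContinuousLinearMap.continuous _)
        (fun _ _ => map_add _ _ _) fun _ _ => map_smul _ _ _]
    refine integral_congr_ae (ae_of_all _ fun t => ?_)
    have h2 := congrArg (fun b => b ζ) (commute_op_ampRep v t hc)
    dsimp only at h2 ⊢
    rw [← UnitaryRep.op_apply, ← UnitaryRep.op_apply, ← mul_apply_eq_comp, ← h2]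
    rfl
  have hle : reducedCStar G ≤ S := by
    refine NonUnitalStarSubalgebra.topologicalClosure_minimal _
      (NonUnitalStarAlgebra.adjoin_le ?_) hS
    rintro _ ⟨f, rfl⟩
    refine (NonUnitalStarSubalgebra.mem_centralizer_iff ℂ).2 ?_
    rintro _ rfl
    refine ⟨hint f hb, ?_⟩
    rw [← map_star, star_conjOp]
    exact hint f (star_mem hb)
  exact ((NonUnitalStarSubalgebra.mem_centralizer_iff ℂ).1 (hle ha) _ rfl).1.symm

/-- The bimodule over `C⋆_r(G)` attached to a unitary representation `v` of `G`. On `L²(G, E)`,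
`λ(s)` acts from the left by translation, and from the right by
`(g ⊗ ξ) · λ(s) = g (· s⁻¹) ⊗ ξ` in the coordinates given by `twistedTensor`. -/
def repBimodule : HilbertBimodule (reducedCStar G) (Lp E 2 (Measure.haar : Measure G)) where
  left := (amp (lpTensor (Measure.haar : Measure G) E) denseRange_lpTensor).comp
    (NonUnitalStarSubalgebraClass.subtype (reducedCStar G))
  right :=
    { toFun := fun a => MulOpposite.op
        (amp (twistedTensor v) (denseRange_twistedTensor v) (conjHom (a : L2 G →L[ℂ] L2 G)).unop)
      map_smul' := fun c a => by
        rw [MonoidHom.id_apply, ← MulOpposite.op_smul, ← map_smul, ← MulOpposite.unop_smul,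
          ← map_smul]
        rfl
      map_zero' := by
        rw [← MulOpposite.op_zero, ZeroMemClass.coe_zero, map_zero, MulOpposite.unop_zero, map_zero]
      map_add' := fun a b => by
        rw [← MulOpposite.op_add, ← map_add, ← MulOpposite.unop_add, ← map_add]
        rfl
      map_mul' := fun a b => by
        rw [← MulOpposite.op_mul, ← map_mul, ← MulOpposite.unop_mul, ← map_mul]
        rfl
      map_star' := fun a => by
        rw [← MulOpposite.op_star, ← map_star, ← MulOpposite.unop_star, ← map_star]
        rfl }
  commute a b ζ := congrArg (fun c => c ζ) (commute_amp v a.2 (star_mem b.2))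
  left_nondegenerate := dense_span_amp denseRange_lpTensor
    (fun a : reducedCStar G => (a : L2 G →L[ℂ] L2 G)) dense_span_reducedCStar
  right_nondegenerate := dense_span_amp (denseRange_twistedTensor v)
    (fun a : reducedCStar G => conjOp (star (a : L2 G →L[ℂ] L2 G))) dense_span_conjOp_reducedCStar

theorem repBimodule_left (a : reducedCStar G) : (repBimodule v).left a
    = amp (lpTensor (Measure.haar : Measure G) E) denseRange_lpTensor a := rfl

theorem repBimodule_right (a : reducedCStar G) : ((repBimodule v).right a).unop
    = amp (twistedTensor v) (denseRange_twistedTensor v)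
      (conjOp (star (a : L2 G →L[ℂ] L2 G))) := rfl

theorem groupLeft_repBimodule (s : G) : (repBimodule v).groupLeft s
    = (ampRep (denseRange_lpTensor (μ := (Measure.haar : Measure G)) (E := E))).op s := by
  refine ((repBimodule v).existsUnique_leftMul (groupMultiplier s)).unique
    (fun a ζ => (repBimodule v).leftMul_apply _ a ζ) fun a ζ => ?_
  rw [repBimodule_left, repBimodule_left, coe_groupMultiplier_fst, map_mul, op_ampRep]
  rfl

theorem groupRight_repBimodule (s : G) : (repBimodule v).groupRight s
    = amp (twistedTensor v) (denseRange_twistedTensor v)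
      (conjOp ((regularRep G).op s⁻¹)) := by
  refine ((repBimodule v).existsUnique_rightMul (groupMultiplier s)).unique
    (fun a ζ => (repBimodule v).rightMul_apply _ a ζ) fun a ζ => ?_
  rw [repBimodule_right, repBimodule_right, coe_groupMultiplier_snd, star_mul, conjOp_mul, map_mul,
    UnitaryRep.star_op]
  rfl

/-- In twisted coordinates the left action contributes λ(s) ⊗ v(s) and the right action a right
translation. Hence `conjRep` is conjugation on L²(G) tensored with v, and a conjugation invariant
vector gives a copy of v. -/
theorem conjRep_repBimodule (s : G) (g : L2 G) (ξ : E) :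
    (repBimodule v).conjRep.toHom s (twistedTensor v (g ⊗ₜ ξ))
      = twistedTensor v
        (conjOp ((regularRep G).op s) ((regularRep G).op s g) ⊗ₜ v.toHom s ξ) := by
  rw [HilbertBimodule.conjRep_apply, groupLeft_repBimodule, groupRight_repBimodule,
    op_ampRep_twistedTensor, amp_tmul, inv_inv]

/-- In an IN-group, `L²(G)` contains a unit vector that is invariant under conjugation. -/
theorem exists_conj_invariant (hG : IsINGroup G) :
    ∃ χ : L2 G, ‖χ‖ = 1 ∧
      ∀ s, conjOp ((regularRep G).op s) ((regularRep G).op s χ) = χ := by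
  obtain ⟨V, hVc, hV1, hV⟩ := hG
  have hconj : ∀ g x : G, g * x * g⁻¹ ∈ V ↔ x ∈ V := fun g x =>
    ⟨fun h => by simpa [mul_assoc] using hV g⁻¹ _ h, hV g x⟩
  have hVm : MeasurableSet V := hVc.measurableSet
  have hfin : (Measure.haar : Measure G) V ≠ ∞ := hVc.measure_ne_top
  -- The indicator of the invariant neighbourhood: compactness gives finite measure, being a
  -- neighbourhood gives a nonzero norm.
  set k : L2 G := indicatorConstLp 2 hVm hfin (1 : ℂ) with hk
  have hk0 : ‖k‖ ≠ 0 := by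
    rw [hk, norm_indicatorConstLp two_ne_zero (by simp), norm_one, one_mul]
    refine (Real.rpow_pos_of_pos ?_ _).ne'
    exact ENNReal.toReal_pos (Measure.measure_pos_of_mem_nhds _ hV1).ne' hfin
  have hkinv : ∀ s, conjOp ((regularRep G).op s) ((regularRep G).op s k) = k := by
    intro s
    have hkV : k =ᵐ[Measure.haar] V.indicator fun _ => (1 : ℂ) := indicatorConstLp_coeFn
    refine Lp.ext ?_
    filter_upwards [coeFn_conjOp_op s ((regularRep G).op s k),
      ae_mul_right s (coeFn_regularRep s k), ae_mul_right s (ae_mul_left s⁻¹ hkV), hkV]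
      with t h1 h2 h3 h4
    rw [h1, UnitaryRep.op_apply, h2, h3, h4]
    have h5 := hconj s⁻¹ t
    rw [inv_inv, mul_assoc] at h5
    by_cases ht : t ∈ V
    · rw [Set.indicator_of_mem ht, Set.indicator_of_mem (h5.2 ht)]
    · rw [Set.indicator_of_notMem ht, Set.indicator_of_notMem fun h => ht (h5.1 h)]
  refine ⟨((‖k‖ : ℂ)⁻¹) • k, ?_, fun s => ?_⟩
  · rw [norm_smul, norm_inv, Complex.norm_real, norm_norm, inv_mul_cancel₀ hk0]
  · rw [map_smul, map_smul, hkinv]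

end Bimodule

/-! ### The two implications -/

section Main

open scoped TensorProduct

variable {G : Type u} [Group G] [TopologicalSpace G] [IsTopologicalGroup G]
  [LocallyCompactSpace G] [MeasurableSpace G] [BorelSpace G]
  [(Measure.haar : Measure G).IsInvInvariant] {H : Subgroup G}
  {B : NonUnitalStarSubalgebra ℂ 𝓜(ℂ, reducedCStar G)}

theorem starProjection_congr {E : Type*} [NormedAddCommGroup E] [InnerProductSpace ℂ E]
    {U V : Submodule ℂ E} [U.HasOrthogonalProjection] [V.HasOrthogonalProjection] (h : U = V) :
    U.starProjection = V.starProjection := by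
  subst h
  rfl

/-- B enters only through its central vectors, so C⋆_r(H) and A itself are treated at once. The
group enters only through the strengthened form of Property (T) in `hG`. -/
theorem strongPropertyTPair_of_tendsto
    (hB : ∀ {E : Type u} [NormedAddCommGroup E] [InnerProductSpace ℂ E] [CompleteSpace E]
      (X : HilbertBimodule (reducedCStar G) E) (ξ : E),
      ξ ∈ X.central B ↔ ∀ h ∈ H, X.conjRep.toHom h ξ = ξ)
    (hG : ∀ {E : Type u} [NormedAddCommGroup E] [InnerProductSpace ℂ E] [CompleteSpace E]
      (v : UnitaryRep G E) {ι : Type u} [Preorder ι] [IsDirectedOrder ι] [Nonempty ι] {ξ : ι → E},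
      (∀ i, ‖ξ i‖ = 1) → v.IsAlmostInvariant ξ →
      Tendsto (fun i => ‖ξ i - (v.invariants H).starProjection (ξ i)‖) atTop (𝓝 0)) :
    StrongPropertyTPair (reducedCStar G) B := by
  intro E _ _ _ X ι _ _ _ ξ hξ h
  have hX : X.central B = X.conjRep.invariants H := Submodule.ext fun ζ => hB X ζ
  rw [starProjection_congr hX]
  exact hG X.conjRep hξ (X.isAlmostInvariant_of_isAlmostCentral h)

theorem groupPairPropertyT_of_strongPropertyTPair [T2Space G] (hG : IsINGroup G)
    (hB : ∀ {E : Type u} [NormedAddCommGroup E] [InnerProductSpace ℂ E] [CompleteSpace E]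
      (X : HilbertBimodule (reducedCStar G) E) (ξ : E),
      ξ ∈ X.central B ↔ ∀ h ∈ H, X.conjRep.toHom h ξ = ξ)
    (hstrong : StrongPropertyTPair (reducedCStar G) B) : GroupPairPropertyT G H := by
  intro E _ _ _ v ι _ _ _ ξ hξ hv
  obtain ⟨χ, hχ, hχinv⟩ := exists_conj_invariant hG
  let X := repBimodule v
  let T := twistedTensor v
  -- The embedding η ↦ χ ⊗ η in twisted coordinates; invariance of χ makes it intertwine v with
  -- `conjRep`.
  let j : E →L[ℂ] Lp E 2 (Measure.haar : Measure G) :=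
    T.toContinuousLinearMap.comp (TensorProduct.mkL ℂ (L2 G) E χ)
  have hj : ∀ η, j η = T (χ ⊗ₜ η) := fun η => rfl
  have hjnorm : ∀ η, ‖j η‖ = ‖η‖ := fun η => by
    rw [hj, LinearIsometry.norm_map, TensorProduct.norm_tmul, hχ, one_mul]
  have hjv : ∀ s η, X.conjRep.toHom s (j η) = j (v.toHom s η) := fun s η => by
    rw [hj, hj, conjRep_repBimodule, hχinv]
  have hcentral : X.IsAlmostCentral fun i => j (ξ i) := by
    refine X.isAlmostCentral_of_tendsto (fun i => (hjnorm _).trans (hξ i)) (fun a => ?_) ?_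
    · refine X.tendsto_left_sub_right (c := 1) (fun i => ((hjnorm _).trans (hξ i)).le)
        (fun Q hQ ε hε => ?_) a
      filter_upwards [hv Q hQ ε hε] with i hi s hs
      rw [hjv, ← map_sub, hjnorm]
      exact hi s hs
    -- The right action moves only the factor χ, so one approximate unit element serves all i
    -- simultaneously.
    · intro K hK ε hε
      obtain ⟨e, he1, heK, hex⟩ := exists_approximate_right_unit
        (conjHom.comp (NonUnitalStarSubalgebraClass.subtype (reducedCStar G)))
        dense_span_conjOp_reducedCStar hK χ hε
      refine ⟨e, he1, heK, fun i => ?_⟩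
      have h1 : (X.right e).unop (j (ξ i)) = T (conjOp (star (e : L2 G →L[ℂ] L2 G)) χ ⊗ₜ ξ i) := by
        rw [hj]
        exact amp_tmul _ _ _ _
      rw [h1, hj, ← map_sub, ← TensorProduct.sub_tmul, LinearIsometry.norm_map,
        TensorProduct.norm_tmul, hξ, mul_one]
      exact hex
  have hlim := hstrong _ X ι _ (fun i => (hjnorm _).trans (hξ i)) hcentral
  obtain ⟨i, hi⟩ := (hlim.eventually (gt_mem_nhds one_pos)).exists
  set ζ := (X.central B).starProjection (j (ξ i)) with hζ
  have hζmem : ζ ∈ X.central B := Submodule.starProjection_apply_mem _ _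
  -- The adjoint of an intertwiner is an intertwiner, so the image of ζ is H-invariant. If it were
  -- 0, then ζ would be orthogonal to j (ξ i), which forces the projection ζ to be 0 and the
  -- distance to be 1, but i was chosen with distance below 1.
  refine ⟨j.adjoint ζ, fun h0 => ?_, fun h hh => ?_⟩
  · have h1 : inner ℂ ζ (j (ξ i)) = 0 := by
      rw [← ContinuousLinearMap.adjoint_inner_left, h0, inner_zero_left]
    have h2 : inner ℂ ζ (j (ξ i) - ζ) = 0 :=
      (X.central B).sub_starProjection_mem_orthogonal (j (ξ i)) ζ hζmem
    rw [inner_sub_right, h1, zero_sub, neg_eq_zero, inner_self_eq_zero] at h2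
    rw [h2, sub_zero, hjnorm, hξ] at hi
    exact lt_irrefl _ hi
  · refine ext_inner_right ℂ fun η => ?_
    rw [UnitaryRep.inner_toHom_left, ContinuousLinearMap.adjoint_inner_left,
      ContinuousLinearMap.adjoint_inner_left, ← hjv, ← UnitaryRep.inner_toHom_left,
      (hB X ζ).1 hζmem h hh]

end Main

end PropertyT

end

theorem theorem1p6 (G : Type u) [Group G] [TopologicalSpace G] [IsTopologicalGroup G]
    [LocallyCompactSpace G] [T2Space G] [MeasurableSpace G] [BorelSpace G]
    (hG : IsINGroup G) :
    (∀ (H : Subgroup G) (hH : IsClosed (H : Set G)),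
      haveI : LocallyCompactSpace H := hH.isClosedEmbedding_subtypeVal.locallyCompactSpace
      (StrongPropertyTPair (reducedCStar G) (subgroupMultipliers H) → GroupPairPropertyT G H) ∧
      (SigmaCompactSpace G →
        (GroupPairPropertyT G H ↔
          StrongPropertyTPair (reducedCStar G) (subgroupMultipliers H)))) ∧
    (GroupPropertyT G ↔ StrongPropertyT (reducedCStar G)) := by
  have hinv := hG.isInvInvariant_haar
  refine ⟨fun H hH => ?_, ?_⟩
  · have hlc : LocallyCompactSpace H := hH.isClosedEmbedding_subtypeVal.locallyCompactSpace
    have ha : StrongPropertyTPair (reducedCStar G) (subgroupMultipliers H) →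
        GroupPairPropertyT G H :=
      groupPairPropertyT_of_strongPropertyTPair hG fun X _ => X.mem_central_subgroupMultipliers H
    exact ⟨ha, fun _ => ⟨fun hT => strongPropertyTPair_of_tendsto
      (fun X _ => X.mem_central_subgroupMultipliers H)
      fun v => hT.tendsto_sub_invariants v, ha⟩⟩
  · have hB : ∀ {E : Type u} [NormedAddCommGroup E] [InnerProductSpace ℂ E] [CompleteSpace E]
        (X : HilbertBimodule (reducedCStar G) E) (ξ : E),
        ξ ∈ X.central (NonUnitalStarAlgHom.range
          (DoubleCentralizer.coeHom : reducedCStar G →⋆ₙₐ[ℂ] 𝓜(ℂ, reducedCStar G))) ↔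
          ∀ h ∈ (⊤ : Subgroup G), X.conjRep.toHom h ξ = ξ := fun X ξ => by
      rw [X.mem_central_range_coeHom]
      exact ⟨fun h s _ => h s, fun h s => h s (Subgroup.mem_top s)⟩
    exact ⟨fun hT => strongPropertyTPair_of_tendsto hB fun v =>
      fun _ hv => GroupPropertyT.tendsto_sub_invariants hT v hv,
      fun h => groupPairPropertyT_of_strongPropertyTPair hG hB h⟩
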